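/- Let $k\in\mathbb R$ and let $\psi:\mathbb R\to\mathbb R$ be Lipschitz and even with $0\le\psi\le\psi_M$, where $\psi_M>0$. Consider the Euler–Poisson–Alignment system on $\mathbb R$ $$\partial_t\rho+\partial_x(\rho u)=0,\qquad \partial_t u+u\,\partial_x u=\int_{\mathbb R}\psi(x-y)\big(u(y,t)-u(x,t)\big)\rho(y,t)\,dy-\partial_xK\star\rho,\qquad K(x)=\tfrac{k}{2}|x|,$$ with initial data $(\rho_0,u_0)$, where $\rho_0\in C^1(\mathbb R)$ is a probability density that vanishes at infinity, $u_0\in C^2(\mathbb R)$, $\partial_xu_0$ is bounded and $\rho_0u_0\in L^1(\mathbb R)$. A classical solution on $[0,T)$, $0<T\le\infty$, is a pair $(\rho,u)$ of $C^1$ functions on $\mathbb R\times[0,T)$ that takes the initial data at $t=0$ and satisfies the equations pointwise for $0<t<T$, such that each $\rho(\cdot,t)$ is a probability density and, on every interval $[0,t]$ with $t<T$, the functions $\rho$ and $\partial_xu$ are bounded and $\rho u$ is bounded in $L^1(\mathbb R)$ uniformly in time. We say that the solution blows up in finite time if there is $0<T<\infty$ such that a classical solution on $[0,T)$ exists and every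 classical solution on $[0,T)$ satisfies $\inf_x\partial_xu(x,t)\to-\infty$ as $t\to T^-$ (so that none extends beyond $T$). 1. (Attractive forcing.) If $k>0$, then the solution blows up in finite time, for all such initial data. 2. (Repulsive forcing.) Let $k<0$. - (Subcritical region.) There is a unique function $\sigma_+:\mathbb R\to\mathbb R$ such that $\sigma_+(x)=0$ whenever $\rho_0(x)=0$ and, whenever $\rho_0(x)>0$, $\sigma_+(x)$ is a negative root of $$\frac1{\rho_0(x)}-\frac1{\psi_M^2}\left(k+\frac{\psi_M\,\sigma_+(x)}{\rho_0(x)}-k\,e^{\psi_M\sigma_+(x)/(k\rho_0(x))}\right)=0.$$ If $\partial_xu_0(x)>-\psi\star\rho_0(x)+\sigma_+(x)$ for all $x\in\mathbb R$, then there is a classical solution on $[0,\infty)$. - (Supercritical region.) If $\partial_xu_0(x)<-\psi\star\rho_0(x)-\sqrt{-2k\rho_0(x)}$ for some $x\in\mathbb R$, then the solution blows up in finite time. -/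

import Mathlib

open MeasureTheory Set Filter Topology

noncomputable section

/-- Convolution `f ⋆ g` on the real line. -/
def conv (f g : ℝ → ℝ) (x : ℝ) : ℝ := ∫ y, f (x - y) * g y

/-- The one-dimensional Newtonian potential `K(x) = k|x|/2`. Its derivative is `(k/2) sgn(x)`
for `x ≠ 0`. -/
def newtonianPotential (k : ℝ) (x : ℝ) : ℝ := k * |x| / 2

/-- The influence function: symmetric, bounded and Lipschitz (that is, of class `W^{1,∞}`), with
`0 ≤ ψ ≤ ψM`. The upper bound `ψM` is taken to be positive. -/
structure IsInfluenceFunction (ψ : ℝ → ℝ) (ψM : ℝ) : Prop where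
  lipschitz : ∃ L : NNReal, LipschitzWith L ψ
  symm : ∀ x, ψ (-x) = ψ x
  nonneg : ∀ x, 0 ≤ ψ x
  le_bound : ∀ x, ψ x ≤ ψM
  bound_pos : 0 < ψM

/-- Admissible initial data: a probability density `ρ₀` of class `C¹` which vanishes at infinity,
and a velocity `u₀` of class `C²` with bounded slope and finite total momentum. -/
structure IsInitialData (ρ₀ u₀ : ℝ → ℝ) : Prop where
  contDiff_density : ContDiff ℝ 1 ρ₀
  density_nonneg : ∀ x, 0 ≤ ρ₀ x
  density_integrable : Integrable ρ₀
  density_mass : ∫ x, ρ₀ x = 1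
  density_vanishes : Tendsto ρ₀ (cocompact ℝ) (𝓝 0)
  contDiff_velocity : ContDiff ℝ 2 u₀
  slope_bounded : ∃ C : ℝ, ∀ x, |deriv u₀ x| ≤ C
  momentum_integrable : Integrable (fun x => ρ₀ x * u₀ x)

/-- `(ρ, u)` is a classical solution on the time interval `I` (used with `I = [0, T)` and
`I = [0, ∞)`) of the Euler–Poisson–Alignment system
`∂ₜρ + ∂ₓ(ρu) = 0`,
`∂ₜu + u ∂ₓu = ∫ ψ(x-y) (u(y,t) - u(x,t)) ρ(y,t) dy - ∂ₓK ⋆ ρ`, `K = k|x|/2`,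
with initial data `(ρ₀, u₀)`. The time variable comes first: `ρ t x`, `u t x`. -/
structure IsClassicalSolution (k : ℝ) (ψ ρ₀ u₀ : ℝ → ℝ) (I : Set ℝ) (ρ u : ℝ → ℝ → ℝ) :
    Prop where
  /-- `ρ` and `u` are `C¹` in `(t, x)`, up to the initial time. -/
  contDiff_density : ContDiffOn ℝ 1 (Function.uncurry ρ) (I ×ˢ univ)
  contDiff_velocity : ContDiffOn ℝ 1 (Function.uncurry u) (I ×ˢ univ)
  initial_density : ∀ x, ρ 0 x = ρ₀ x
  initial_velocity : ∀ x, u 0 x = u₀ x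
  /-- `ρ(·,t)` is a probability density. -/
  density_nonneg : ∀ t ∈ I, ∀ x, 0 ≤ ρ t x
  density_integrable : ∀ t ∈ I, Integrable (ρ t)
  density_mass : ∀ t ∈ I, ∫ x, ρ t x = 1
  momentum_integrable : ∀ t ∈ I, Integrable (fun x => ρ t x * u t x)
  /-- `ρ` and `∂ₓu` are bounded in `L^∞`, and `ρu` is bounded in `L¹`, locally uniformly in time
  on `I`. -/
  locally_bounded : ∀ t ∈ I, ∃ C : ℝ, ∀ s ∈ Icc 0 t,
    (∀ x, ρ s x ≤ C) ∧ (∀ x, |deriv (u s) x| ≤ C) ∧ ∫ x, |ρ s x * u s x| ≤ C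
  continuity_eq : ∀ t ∈ I, 0 < t → ∀ x,
    deriv (fun s => ρ s x) t + deriv (fun y => ρ t y * u t y) x = 0
  momentum_eq : ∀ t ∈ I, 0 < t → ∀ x,
    deriv (fun s => u s x) t + u t x * deriv (u t) x =
      (∫ y, ψ (x - y) * (u t y - u t x) * ρ t y) - conv (deriv (newtonianPotential k)) (ρ t) x

/-- The initial data launch a classical solution for all times `t ≥ 0`. -/
def HasGlobalClassicalSolution (k : ℝ) (ψ ρ₀ u₀ : ℝ → ℝ) : Prop :=
  ∃ ρ u : ℝ → ℝ → ℝ, IsClassicalSolution k ψ ρ₀ u₀ (Ici 0) ρ u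

/-- Finite-time blow-up: for some finite `T > 0` a classical solution exists on `[0, T)`, and for
every classical solution on `[0, T)` the slope `∂ₓu` blows up to `-∞` as `t → T⁻`, that is,
`inf_x ∂ₓu(x,t) → -∞`. As `∂ₓu` is bounded, locally uniformly in time, for classical solutions,
no classical solution exists beyond time `T`. -/
def BlowsUpInFiniteTime (k : ℝ) (ψ ρ₀ u₀ : ℝ → ℝ) : Prop :=
  ∃ T : ℝ, 0 < T ∧
    (∃ ρ u : ℝ → ℝ → ℝ, IsClassicalSolution k ψ ρ₀ u₀ (Ico 0 T) ρ u) ∧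
    ∀ ρ u : ℝ → ℝ → ℝ, IsClassicalSolution k ψ ρ₀ u₀ (Ico 0 T) ρ u →
      ∀ M : ℝ, ∀ᶠ t in 𝓝[<] T, ∃ x, deriv (u t) x < -M

/-- `σ` is the upper threshold `σ₊`: it vanishes where `ρ₀` vanishes, and elsewhere `σ(x)` is a
negative root of the transcendental equation below. -/
def IsUpperThreshold (k ψM : ℝ) (ρ₀ σ : ℝ → ℝ) : Prop :=
  ∀ x, (ρ₀ x = 0 → σ x = 0) ∧
    (0 < ρ₀ x → σ x < 0 ∧
      1 / ρ₀ x - 1 / ψM ^ 2 *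
        (k + ψM * σ x / ρ₀ x - k * Real.exp (ψM * σ x / (k * ρ₀ x))) = 0)

/-- The lower threshold `σ₋(x) = -√(-2kρ₀(x))`, for `k < 0`. -/
def lowerThreshold (k : ℝ) (ρ₀ : ℝ → ℝ) (x : ℝ) : ℝ := -Real.sqrt (-2 * k * ρ₀ x)

end

open Function (uncurry)

noncomputable section

/-! ### Ordinary differential equations with a globally Lipschitz right-hand side -/

theorem integral_exp_const_mul' {c : ℝ} (hc : c ≠ 0) (a b : ℝ) :
    ∫ s in a..b, Real.exp (c * s) = (Real.exp (c * b) - Real.exp (c * a)) / c := by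
  rw [intervalIntegral.integral_comp_mul_left (fun x => Real.exp x) hc, integral_exp, smul_eq_mul,
    inv_mul_eq_div]

theorem norm_integral_le_of_norm_le_exp {E : Type*} [NormedAddCommGroup E] [NormedSpace ℝ E]
    {h : ℝ → E} {c l : ℝ} (hl : 0 < l) (hh : ∀ s, ‖h s‖ ≤ c * Real.exp (l * |s|)) (t : ℝ) :
    ‖∫ s in (0 : ℝ)..t, h s‖ ≤ c / l * Real.exp (l * |t|) := by
  have hc : 0 ≤ c := by
    have := (norm_nonneg _).trans (hh 0)
    simpa using this
  have key : |∫ s in (0 : ℝ)..t, c * Real.exp (l * |s|)| = c / l * (Real.exp (l * |t|) - 1) := by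
    rcases le_total 0 t with ht | ht
    · have : ∫ s in (0 : ℝ)..t, c * Real.exp (l * |s|) = ∫ s in (0 : ℝ)..t, c * Real.exp (l * s) := by
        apply intervalIntegral.integral_congr
        intro s hs
        rw [uIcc_of_le ht] at hs
        simp only [abs_of_nonneg hs.1]
      rw [this, intervalIntegral.integral_const_mul, integral_exp_const_mul' hl.ne']
      rw [abs_of_nonneg ht, mul_zero, Real.exp_zero, abs_of_nonneg]
      · ring
      · have : 1 ≤ Real.exp (l * t) := Real.one_le_exp (by positivity)
        exact mul_nonneg hc (div_nonneg (by linarith) hl.le)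
    · have : ∫ s in (0 : ℝ)..t, c * Real.exp (l * |s|) = ∫ s in (0 : ℝ)..t, c * Real.exp (-l * s) := by
        apply intervalIntegral.integral_congr
        intro s hs
        rw [uIcc_of_ge ht] at hs
        simp only [abs_of_nonpos hs.2, mul_neg, neg_mul]
      rw [this, intervalIntegral.integral_const_mul, integral_exp_const_mul' (neg_ne_zero.2 hl.ne')]
      rw [abs_of_nonpos ht, mul_zero, Real.exp_zero, ← abs_neg, abs_of_nonneg]
      · rw [mul_neg l t, div_neg, neg_mul]; ring
      · have : 1 ≤ Real.exp (-l * t) := Real.one_le_exp (by nlinarith)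
        rw [div_neg, mul_neg, neg_neg]
        exact mul_nonneg hc (div_nonneg (by linarith) hl.le)
  calc ‖∫ s in (0 : ℝ)..t, h s‖ ≤ |∫ s in (0 : ℝ)..t, c * Real.exp (l * |s|)| := by
        apply intervalIntegral.norm_integral_le_abs_of_norm_le
        · exact Eventually.of_forall fun s => hh s
        · exact (by fun_prop : Continuous fun s : ℝ => c * Real.exp (l * |s|)).intervalIntegrable _ _
    _ = _ := key
    _ ≤ _ := by
        gcongr
        linarith

theorem exists_forall_hasDerivAt_of_lipschitzWith {E : Type*} [NormedAddCommGroup E]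
    [NormedSpace ℝ E] [CompleteSpace E] {f : ℝ → E → E} {K : NNReal} {C : ℝ}
    (hL : ∀ t, LipschitzWith K (f t)) (hc : ∀ x, Continuous fun t => f t x)
    (hC : ∀ t, ‖f t 0‖ ≤ C * Real.exp |t|) (x₀ : E) :
    ∃ x : ℝ → E, x 0 = x₀ ∧ ∀ t, HasDerivAt x (f t (x t)) t := by
  set l : ℝ := 2 * K + 1 with hl
  have hK0 : (0 : ℝ) ≤ K := K.2
  have hl1 : 1 ≤ l := by linarith
  have hl0 : 0 < l := by linarith
  have hC0 : 0 ≤ C := by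
    have := (norm_nonneg _).trans (hC 0)
    simpa using this
  have hfc : Continuous fun p : ℝ × E => f p.1 p.2 :=
    continuous_prod_of_continuous_lipschitzWith' _ K (fun t => hL t) hc
  have hint : ∀ y : BoundedContinuousFunction ℝ E,
      Continuous fun s => f s (Real.exp (l * |s|) • y s) := fun y =>
    hfc.comp (continuous_id.prodMk (by fun_prop))
  have hbd : ∀ (y : BoundedContinuousFunction ℝ E) (s : ℝ),
      ‖f s (Real.exp (l * |s|) • y s)‖ ≤ (C + K * ‖y‖) * Real.exp (l * |s|) := by
    intro y s
    have h1 : ‖f s (Real.exp (l * |s|) • y s) - f s 0‖ ≤ K * (Real.exp (l * |s|) * ‖y‖) := by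
      refine ((hL s).norm_sub_le _ _).trans ?_
      rw [sub_zero, norm_smul, Real.norm_eq_abs, Real.abs_exp]
      gcongr
      exact y.norm_coe_le_norm s
    have h2 : ‖f s 0‖ ≤ C * Real.exp (l * |s|) := by
      refine (hC s).trans ?_
      gcongr
      nlinarith [abs_nonneg s]
    calc ‖f s (Real.exp (l * |s|) • y s)‖
        = ‖(f s (Real.exp (l * |s|) • y s) - f s 0) + f s 0‖ := by rw [sub_add_cancel]
      _ ≤ _ := norm_add_le _ _
      _ ≤ _ := by linarith
  have hexp : ∀ t, Real.exp (-(l * |t|)) * Real.exp (l * |t|) = 1 := fun t => by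
    rw [← Real.exp_add]; simp
  let P : BoundedContinuousFunction ℝ E → BoundedContinuousFunction ℝ E := fun y =>
    BoundedContinuousFunction.ofNormedAddCommGroup
      (fun t => Real.exp (-(l * |t|)) • (x₀ + ∫ s in (0 : ℝ)..t, f s (Real.exp (l * |s|) • y s)))
      (by
        have := intervalIntegral.continuous_primitive (μ := volume)
          (fun a b => (hint y).intervalIntegrable a b) 0
        fun_prop)
      (‖x₀‖ + (C + K * ‖y‖) / l) (by
        intro t
        rw [norm_smul, Real.norm_eq_abs, Real.abs_exp]
        have h1 := norm_integral_le_of_norm_le_exp hl0 (hbd y) t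
        have h3 : Real.exp (-(l * |t|)) ≤ 1 := Real.exp_le_one_iff.2 (by
          have := mul_nonneg hl0.le (abs_nonneg t); linarith)
        calc Real.exp (-(l * |t|)) * ‖x₀ + ∫ s in (0 : ℝ)..t, f s (Real.exp (l * |s|) • y s)‖
            ≤ Real.exp (-(l * |t|)) * (‖x₀‖ + (C + K * ‖y‖) / l * Real.exp (l * |t|)) := by
              gcongr
              exact (norm_add_le _ _).trans (by linarith)
          _ = Real.exp (-(l * |t|)) * ‖x₀‖ + (C + K * ‖y‖) / l *
                (Real.exp (-(l * |t|)) * Real.exp (l * |t|)) := by ring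
          _ ≤ _ := by
              rw [hexp]
              nlinarith [norm_nonneg x₀])
  have hP : ContractingWith (1 / 2) P := by
    refine ⟨by rw [← NNReal.coe_lt_coe]; norm_num, LipschitzWith.of_dist_le_mul fun y z => ?_⟩
    rw [BoundedContinuousFunction.dist_le (by positivity)]
    intro t
    have e1 : P y t - P z t = Real.exp (-(l * |t|)) • ∫ s in (0 : ℝ)..t,
        (f s (Real.exp (l * |s|) • y s) - f s (Real.exp (l * |s|) • z s)) := by
      rw [intervalIntegral.integral_sub ((hint y).intervalIntegrable _ _)
        ((hint z).intervalIntegrable _ _)]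
      simp only [P, BoundedContinuousFunction.coe_ofNormedAddCommGroup, ← smul_sub]
      congr 1
      abel
    rw [dist_eq_norm, e1, norm_smul, Real.norm_eq_abs, Real.abs_exp]
    have h1 := norm_integral_le_of_norm_le_exp (c := K * dist y z) (h := fun s =>
        f s (Real.exp (l * |s|) • y s) - f s (Real.exp (l * |s|) • z s)) hl0 (fun s => by
      refine ((hL s).norm_sub_le _ _).trans ?_
      rw [← smul_sub, norm_smul, Real.norm_eq_abs, Real.abs_exp, ← dist_eq_norm]
      have := BoundedContinuousFunction.dist_coe_le_dist (f := y) (g := z) s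
      calc (K : ℝ) * (Real.exp (l * |s|) * dist (y s) (z s))
          ≤ K * (Real.exp (l * |s|) * dist y z) := by gcongr
        _ = _ := by ring) t
    calc _ ≤ Real.exp (-(l * |t|)) * (K * dist y z / l * Real.exp (l * |t|)) := by gcongr
      _ = K * dist y z / l * (Real.exp (-(l * |t|)) * Real.exp (l * |t|)) := by ring
      _ = (K / l) * dist y z := by rw [hexp]; ring
      _ ≤ _ := by
        gcongr
        rw [div_le_iff₀ hl0]
        push_cast
        linarith
  obtain ⟨y, hy⟩ : ∃ y, P y = y := ⟨_, hP.fixedPoint_isFixedPt⟩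
  have hx : ∀ t, Real.exp (l * |t|) • y t =
      x₀ + ∫ s in (0 : ℝ)..t, f s (Real.exp (l * |s|) • y s) := by
    intro t
    conv_lhs => rw [← hy]
    simp only [P, BoundedContinuousFunction.coe_ofNormedAddCommGroup]
    rw [smul_smul, mul_comm, hexp, one_smul]
  refine ⟨fun t => Real.exp (l * |t|) • y t, by simpa using hx 0, fun t => ?_⟩
  beta_reduce
  have := ((hint y).integral_hasStrictDerivAt 0 t).hasDerivAt.const_add x₀
  rwa [← funext hx] at this

/-! ### Calculus in two real variables -/

theorem hasStrictFDerivAt_of_partial_derivs {f f₁ f₂ : ℝ → ℝ → ℝ} {S : Set (ℝ × ℝ)} (hS : IsOpen S)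
    (h₁ : ∀ p ∈ S, HasDerivAt (fun s => f s p.2) (f₁ p.1 p.2) p.1)
    (h₂ : ∀ p ∈ S, HasDerivAt (f p.1) (f₂ p.1 p.2) p.2)
    (c₁ : ContinuousOn (uncurry f₁) S) (c₂ : ContinuousOn (uncurry f₂) S) {p : ℝ × ℝ}
    (hp : p ∈ S) :
    HasStrictFDerivAt (uncurry f) (f₁ p.1 p.2 • ContinuousLinearMap.fst ℝ ℝ ℝ +
      f₂ p.1 p.2 • ContinuousLinearMap.snd ℝ ℝ ℝ) p := by
  have hSp := hS.mem_nhds hp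
  have e : Continuous (fun c : ℝ => ContinuousLinearMap.toSpanSingleton ℝ c) :=
    (ContinuousLinearMap.toSpanSingletonCLE (𝕜 := ℝ) (E := ℝ)).continuous
  have := hasStrictFDerivAt_uncurry_coprod (𝕜 := ℝ) (u := p) (f := f)
    (f₁ := fun a b => ContinuousLinearMap.toSpanSingleton ℝ (f₁ a b))
    (f₂ := fun a b => ContinuousLinearMap.toSpanSingleton ℝ (f₂ a b))
    (by filter_upwards [hSp] with v hv using (h₁ v hv).hasFDerivAt)
    (by filter_upwards [hSp] with v hv using (h₂ v hv).hasFDerivAt)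
    (e.continuousAt.comp (c₁.continuousAt hSp)) (e.continuousAt.comp (c₂.continuousAt hSp))
  convert! this using 1
  ext <;> simp [Function.HasUncurry.uncurry]

theorem contDiffOn_one_of_partial_derivs {f f₁ f₂ : ℝ → ℝ → ℝ} {S : Set (ℝ × ℝ)} (hS : IsOpen S)
    (h₁ : ∀ p ∈ S, HasDerivAt (fun s => f s p.2) (f₁ p.1 p.2) p.1)
    (h₂ : ∀ p ∈ S, HasDerivAt (f p.1) (f₂ p.1 p.2) p.2)
    (c₁ : ContinuousOn (uncurry f₁) S) (c₂ : ContinuousOn (uncurry f₂) S) :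
    ContDiffOn ℝ 1 (uncurry f) S := by
  have key := fun p hp => hasStrictFDerivAt_of_partial_derivs hS h₁ h₂ c₁ c₂ (p := p) hp
  rw [show (1 : WithTop ℕ∞) = 0 + 1 from (zero_add 1).symm, contDiffOn_succ_iff_fderiv_of_isOpen hS]
  refine ⟨fun p hp => (key p hp).hasFDerivAt.differentiableAt.differentiableWithinAt, by simp, ?_⟩
  rw [contDiffOn_zero]
  have : ContinuousOn (fun p : ℝ × ℝ => f₁ p.1 p.2 • ContinuousLinearMap.fst ℝ ℝ ℝ +
      f₂ p.1 p.2 • ContinuousLinearMap.snd ℝ ℝ ℝ) S := by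
    have c₁' : ContinuousOn (fun p : ℝ × ℝ => f₁ p.1 p.2) S := c₁
    have c₂' : ContinuousOn (fun p : ℝ × ℝ => f₂ p.1 p.2) S := c₂
    fun_prop
  exact this.congr fun p hp => (key p hp).hasFDerivAt.fderiv

/-- A set of times containing, with each time, all times between it and the initial time `0`. -/
def StarShapedTimes (O : Set ℝ) : Prop := ∀ t ∈ O, uIcc 0 t ⊆ O

theorem continuousOn_intervalIntegral_param {f : ℝ → ℝ → ℝ} {O : Set ℝ} (hO : IsOpen O)
    (hst : StarShapedTimes O) (hf : ContinuousOn (uncurry f) (O ×ˢ univ)) :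
    ContinuousOn (fun p : ℝ × ℝ => ∫ s in (0 : ℝ)..p.1, f s p.2) (O ×ˢ univ) := by
  rintro ⟨t, a⟩ ⟨ht, -⟩
  simp only at ht
  obtain ⟨ε, hε, hball⟩ := Metric.isOpen_iff.1 hO t ht
  have h0 : (0 : ℝ) ∈ O := hst t ht left_mem_uIcc
  obtain ⟨t₁, t₂, h1, h2, h3, h4, hsub⟩ : ∃ t₁ t₂ : ℝ, t₁ < t ∧ t < t₂ ∧ t₁ ≤ 0 ∧ 0 ≤ t₂ ∧
      Icc t₁ t₂ ⊆ O := by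
    have m1 : t - ε / 2 ∈ O := hball (by rw [Metric.mem_ball, Real.dist_eq]; rw [abs_lt]; constructor <;> linarith)
    have m2 : t + ε / 2 ∈ O := hball (by rw [Metric.mem_ball, Real.dist_eq]; rw [abs_lt]; constructor <;> linarith)
    refine ⟨min (t - ε / 2) 0, max (t + ε / 2) 0, ?_, ?_, min_le_right _ _, le_max_right _ _, ?_⟩
    · exact (min_le_left _ _).trans_lt (by linarith)
    · exact (by linarith : t < t + ε / 2).trans_le (le_max_left _ _)
    · intro s hs
      rcases le_total s 0 with hs0 | hs0
      · rcases le_total (t - ε / 2) 0 with h | h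
        · apply hst _ m1
          rw [uIcc_of_ge h]
          exact ⟨by simpa [h] using hs.1, hs0⟩
        · have : 0 ≤ s := by simpa [h] using hs.1
          rwa [le_antisymm hs0 this]
      · rcases le_total (t + ε / 2) 0 with h | h
        · have : s ≤ 0 := by simpa [h] using hs.2
          rwa [le_antisymm this hs0]
        · apply hst _ m2
          rw [uIcc_of_le h]
          exact ⟨hs0, by simpa [h] using hs.2⟩
  have h12 : t₁ ≤ t₂ := h3.trans h4
  let G : ℝ → ℝ → ℝ := fun b s => f (projIcc t₁ t₂ h12 s) b
  have hG : Continuous (uncurry G) := by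
    have : Continuous fun p : ℝ × ℝ => (((projIcc t₁ t₂ h12 p.2 : ℝ), p.1) : ℝ × ℝ) := by
      have := continuous_projIcc (a := t₁) (b := t₂) (h := h12)
      fun_prop
    exact hf.comp_continuous this fun p => ⟨hsub (projIcc t₁ t₂ h12 p.2).2, mem_univ _⟩
  have hc := intervalIntegral.continuous_parametric_primitive_of_continuous (μ := volume) (a₀ := 0) hG
  have hc' : Continuous fun p : ℝ × ℝ => ∫ s in (0 : ℝ)..p.1, G p.2 s :=
    hc.comp (continuous_snd.prodMk continuous_fst)
  refine (hc'.continuousAt.congr ?_).continuousWithinAt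
  have : Ioo t₁ t₂ ×ˢ (univ : Set ℝ) ∈ 𝓝 (t, a) :=
    (isOpen_Ioo.prod isOpen_univ).mem_nhds ⟨⟨h1, h2⟩, mem_univ _⟩
  filter_upwards [this] with p hp
  apply intervalIntegral.integral_congr
  intro s hs
  have hs' : s ∈ Icc t₁ t₂ := (uIcc_subset_Icc ⟨h3, h4⟩ (Ioo_subset_Icc_self hp.1)) hs
  simp only [G, projIcc_of_mem h12 hs']

theorem hasDerivAt_intervalIntegral_param {f f' : ℝ → ℝ → ℝ} {O : Set ℝ}
    (hst : StarShapedTimes O) (hf : ContinuousOn (uncurry f) (O ×ˢ univ))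
    (hf' : ContinuousOn (uncurry f') (O ×ˢ univ))
    (hd : ∀ s ∈ O, ∀ a, HasDerivAt (f s) (f' s a) a) {t : ℝ} (ht : t ∈ O) (a : ℝ) :
    HasDerivAt (fun b => ∫ s in (0 : ℝ)..t, f s b) (∫ s in (0 : ℝ)..t, f' s a) a := by
  have slice : ∀ {g : ℝ → ℝ → ℝ}, ContinuousOn (uncurry g) (O ×ˢ univ) → ∀ b,
      ContinuousOn (fun s => g s b) (uIcc 0 t) := fun {g} hg b =>
    hg.comp (f := fun s => (s, b)) (by fun_prop) fun s hs => ⟨hst t ht hs, mem_univ _⟩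
  have hK : IsCompact (uIcc 0 t ×ˢ Metric.closedBall a 1) :=
    isCompact_uIcc.prod (isCompact_closedBall a 1)
  obtain ⟨C, hC⟩ := hK.exists_bound_of_continuousOn (f := uncurry f')
    (hf'.mono (prod_mono (hst t ht) (subset_univ _)))
  refine (intervalIntegral.hasDerivAt_integral_of_dominated_loc_of_deriv_le (F := fun b s => f s b)
    (F' := fun b s => f' s b) (bound := fun _ => C)
    (Metric.closedBall_mem_nhds a one_pos) ?_ ?_ ?_ ?_ ?_ ?_).2
  · refine Eventually.of_forall fun b => ?_
    exact ((slice hf b).mono uIoc_subset_uIcc).aestronglyMeasurable measurableSet_uIoc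
  · exact (slice hf a).intervalIntegrable
  · exact ((slice hf' a).mono uIoc_subset_uIcc).aestronglyMeasurable measurableSet_uIoc
  · exact Eventually.of_forall fun s hs b hb => hC (s, b) ⟨uIoc_subset_uIcc hs, hb⟩
  · exact intervalIntegrable_const
  · exact Eventually.of_forall fun s hs b _ => hd s (hst t ht (uIoc_subset_uIcc hs)) b

/-! ### Linear equations and the spatial derivative of a flow -/

/-- The solution of the linear equation `y' = α + β y`, `y 0 = y₀`. -/
def linearSolution (α β : ℝ → ℝ) (y₀ t : ℝ) : ℝ :=
  Real.exp (∫ s in (0 : ℝ)..t, β s) *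
    (y₀ + ∫ s in (0 : ℝ)..t, α s * Real.exp (-∫ r in (0 : ℝ)..s, β r))

theorem hasDerivAt_primitive {β : ℝ → ℝ} (hβ : Continuous β) (t : ℝ) :
    HasDerivAt (fun t => ∫ s in (0 : ℝ)..t, β s) (β t) t :=
  (hβ.integral_hasStrictDerivAt 0 t).hasDerivAt

theorem continuous_primitive' {β : ℝ → ℝ} (hβ : Continuous β) :
    Continuous fun t => ∫ s in (0 : ℝ)..t, β s :=
  continuous_iff_continuousAt.2 fun t => (hasDerivAt_primitive hβ t).continuousAt

theorem hasDerivAt_linearSolution {α β : ℝ → ℝ} (hα : Continuous α) (hβ : Continuous β)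
    (y₀ t : ℝ) :
    HasDerivAt (linearSolution α β y₀) (α t + β t * linearSolution α β y₀ t) t := by
  have h1 := (hasDerivAt_primitive hβ t).exp
  have h2 := (hasDerivAt_primitive (β := fun s => α s * Real.exp (-∫ r in (0 : ℝ)..s, β r))
    (hα.mul (continuous_primitive' hβ).neg.rexp) t).const_add y₀
  have h3 := h1.mul h2
  refine h3.congr_deriv ?_
  unfold linearSolution
  have : Real.exp (∫ s in (0 : ℝ)..t, β s) * Real.exp (-∫ s in (0 : ℝ)..t, β s) = 1 := by
    rw [← Real.exp_add]; simp
  linear_combination (α t) * this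

theorem eq_linearSolution {α β y : ℝ → ℝ} (hα : Continuous α) (hβ : Continuous β)
    (hy : ∀ t, HasDerivAt y (α t + β t * y t) t) (t : ℝ) : y t = linearSolution α β (y 0) t := by
  set z : ℝ → ℝ := fun t => (y t - linearSolution α β (y 0) t) * Real.exp (-∫ s in (0 : ℝ)..t, β s)
  have hz : ∀ t, HasDerivAt z 0 t := fun t => by
    refine (((hy t).sub (hasDerivAt_linearSolution hα hβ (y 0) t)).mul
      (hasDerivAt_primitive hβ t).neg.exp).congr_deriv ?_
    simp only [Pi.sub_apply, Pi.neg_apply]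
    ring
  have h0 : z t = z 0 := is_const_of_deriv_eq_zero (fun t => (hz t).differentiableAt)
    (fun t => (hz t).deriv) t 0
  have h1 : z 0 = 0 := by simp [z, linearSolution]
  rw [h1] at h0
  have := (mul_eq_zero.1 h0).resolve_right (Real.exp_pos _).ne'
  linarith

theorem sub_eq_mul_integral_segment {f f' : ℝ → ℝ} (hf : ∀ y, HasDerivAt f (f' y) y)
    (hf' : Continuous f') (x y : ℝ) :
    f y - f x = (y - x) * ∫ θ in (0 : ℝ)..1, f' (x + θ * (y - x)) := by
  have h : ∀ θ ∈ uIcc (0 : ℝ) 1, HasDerivAt (fun θ => f (x + θ * (y - x)))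
      (f' (x + θ * (y - x)) * (y - x)) θ := fun θ _ =>
    (hf _).comp θ (by simpa using ((hasDerivAt_id θ).mul_const (y - x)).const_add x)
  have := intervalIntegral.integral_eq_sub_of_hasDerivAt h
    ((by fun_prop : Continuous fun θ => f' (x + θ * (y - x)) * (y - x)).intervalIntegrable _ _)
  rw [intervalIntegral.integral_mul_const] at this
  simp only [one_mul, add_sub_cancel, zero_mul, add_zero] at this
  rw [← this, mul_comm]

theorem continuous_linearSolution_param {T : Type*} [TopologicalSpace T] {α β : T → ℝ → ℝ}
    (hα : Continuous (uncurry α)) (hβ : Continuous (uncurry β)) (y₀ : ℝ) :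
    Continuous fun p : T × ℝ => linearSolution (α p.1) (β p.1) y₀ p.2 := by
  have h1 := intervalIntegral.continuous_parametric_primitive_of_continuous (μ := volume) (a₀ := 0) hβ
  have h2 := intervalIntegral.continuous_parametric_primitive_of_continuous (μ := volume) (a₀ := 0)
    (f := fun p s => α p s * Real.exp (-∫ r in (0 : ℝ)..s, β p r)) (hα.mul h1.neg.rexp)
  exact h1.rexp.mul (continuous_const.add h2)

theorem hasDerivAt_flow {X W Wa v vy : ℝ → ℝ → ℝ} (hX : Continuous (uncurry X))
    (hX0 : ∀ a, X 0 a = a)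
    (hXt : ∀ t a, HasDerivAt (fun s => X s a) (W t a + v t (X t a)) t)
    (hW : ∀ t a, HasDerivAt (W t) (Wa t a) a) (hWa : Continuous (uncurry Wa))
    (hv : ∀ t y, HasDerivAt (v t) (vy t y) y) (hvy : Continuous (uncurry vy)) (t a : ℝ) :
    HasDerivAt (X t) (linearSolution (fun s => Wa s a) (fun s => vy s (X s a)) 1 t) a := by
  let A : ℝ → ℝ → ℝ := fun h s => ∫ θ in (0 : ℝ)..1, Wa s (a + θ * h)
  let B : ℝ → ℝ → ℝ := fun h s => ∫ θ in (0 : ℝ)..1, vy s (X s a + θ * (X s (a + h) - X s a))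
  have hX' : ∀ {Z : Type} [TopologicalSpace Z] {p q : Z → ℝ}, Continuous p → Continuous q →
      Continuous fun z => X (p z) (q z) := fun hp hq => hX.comp (hp.prodMk hq)
  have hA : Continuous (uncurry A) :=
    intervalIntegral.continuous_parametric_intervalIntegral_of_continuous'
      (f := fun (p : ℝ × ℝ) θ => Wa p.2 (a + θ * p.1))
      (hWa.comp ((by fun_prop : Continuous fun q : (ℝ × ℝ) × ℝ => (q.1.2, a + q.2 * q.1.1)))) 0 1
  have hB : Continuous (uncurry B) := by
    have e1 : Continuous fun q : (ℝ × ℝ) × ℝ => X q.1.2 a := hX' (by fun_prop) (by fun_prop)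
    have e2 : Continuous fun q : (ℝ × ℝ) × ℝ => X q.1.2 (a + q.1.1) :=
      hX' (by fun_prop) (by fun_prop)
    exact intervalIntegral.continuous_parametric_intervalIntegral_of_continuous'
      (f := fun (p : ℝ × ℝ) θ => vy p.2 (X p.2 a + θ * (X p.2 (a + p.1) - X p.2 a)))
      (hvy.comp ((by fun_prop : Continuous fun q : (ℝ × ℝ) × ℝ =>
        (q.1.2, X q.1.2 a + q.2 * (X q.1.2 (a + q.1.1) - X q.1.2 a))))) 0 1
  have hWac : ∀ s, Continuous (Wa s) := fun s => hWa.comp (by fun_prop : Continuous fun y => (s, y))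
  have hvyc : ∀ s, Continuous (vy s) := fun s => hvy.comp (by fun_prop : Continuous fun y => (s, y))
  have hAh : ∀ h, Continuous (A h) := fun h => hA.comp (by fun_prop : Continuous fun s => (h, s))
  have hBh : ∀ h, Continuous (B h) := fun h => hB.comp (by fun_prop : Continuous fun s => (h, s))
  have key : ∀ h t, X t (a + h) - X t a = h * linearSolution (A h) (B h) 1 t := by
    intro h t
    have := eq_linearSolution (y := fun t => X t (a + h) - X t a) ((hAh h).const_mul h) (hBh h)
      (fun s => by
        refine ((hXt s (a + h)).sub (hXt s a)).congr_deriv ?_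
        have e1 := sub_eq_mul_integral_segment (hW s) (hWac s) a (a + h)
        have e2 := sub_eq_mul_integral_segment (hv s) (hvyc s) (X s a) (X s (a + h))
        rw [add_sub_cancel_left] at e1
        simp only [A, B]
        linear_combination e1 + e2) t
    rw [this, hX0, hX0, add_sub_cancel_left]
    simp only [linearSolution, mul_assoc, intervalIntegral.integral_const_mul]
    ring
  have hQ : Continuous fun h => linearSolution (A h) (B h) 1 t :=
    (continuous_linearSolution_param hA hB 1).comp (by fun_prop : Continuous fun h => (h, t))
  rw [hasDerivAt_iff_tendsto_slope_zero]
  have h0 : linearSolution (fun s => Wa s a) (fun s => vy s (X s a)) 1 t =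
      linearSolution (A 0) (B 0) 1 t := by
    simp [A, B]
  rw [h0]
  refine (hQ.continuousAt.tendsto.mono_left nhdsWithin_le_nhds).congr' ?_
  filter_upwards [self_mem_nhdsWithin] with h hh
  rw [key, smul_eq_mul, inv_mul_cancel_left₀ hh]

/-! ### Integration against densities -/

theorem tendsto_integral_mul_of_tendsto_density {ι : Type*} {l : Filter ι}
    [l.IsCountablyGenerated] {F : ι → ℝ → ℝ} {f h : ℝ → ℝ} {C : ℝ}
    (hF : ∀ᶠ n in l, (∀ z, 0 ≤ F n z) ∧ Integrable (F n) ∧ ∫ z, F n z = 1)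
    (hf0 : ∀ z, 0 ≤ f z) (hfi : Integrable f) (hf1 : ∫ z, f z = 1)
    (hlim : ∀ z, Tendsto (fun n => F n z) l (𝓝 (f z)))
    (hh : Measurable h) (hC : ∀ z, |h z| ≤ C) :
    Tendsto (fun n => ∫ z, h z * F n z) l (𝓝 (∫ z, h z * f z)) := by
  have hmin : Tendsto (fun n => ∫ z, min (F n z) (f z)) l (𝓝 (∫ z, f z)) := by
    apply tendsto_integral_filter_of_dominated_convergence f
    · filter_upwards [hF] with n hn
      exact hn.2.1.aestronglyMeasurable.inf hfi.aestronglyMeasurable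
    · filter_upwards [hF] with n hn
      refine Eventually.of_forall fun z => ?_
      rw [Real.norm_eq_abs, abs_of_nonneg (le_min (hn.1 z) (hf0 z))]
      exact min_le_right _ _
    · exact hfi
    · refine Eventually.of_forall fun z => ?_
      simpa using (hlim z).min (tendsto_const_nhds (x := f z))
  rw [tendsto_iff_dist_tendsto_zero]
  have hz : Tendsto (fun n => C * (2 - 2 * ∫ z, min (F n z) (f z))) l (𝓝 0) := by
    have := ((hmin.const_mul 2).const_sub 2).const_mul C
    rwa [hf1, mul_one, sub_self, mul_zero] at this
  refine squeeze_zero' (Eventually.of_forall fun _ => dist_nonneg) ?_ hz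
  filter_upwards [hF] with n ⟨hn0, hni, hn1⟩
  have hb : ∀ {g : ℝ → ℝ}, Integrable g → Integrable fun z => h z * g z := fun hg =>
    hg.bdd_mul hh.aestronglyMeasurable (Eventually.of_forall fun z => hC z)
  have hmi : Integrable fun z => min (F n z) (f z) := hni.inf hfi
  rw [dist_eq_norm, ← integral_sub (hb hni) (hb hfi)]
  have e : ∫ z, C * (F n z + f z - 2 * min (F n z) (f z)) =
      C * (2 - 2 * ∫ z, min (F n z) (f z)) := by
    have hs : Integrable fun z => F n z + f z := hni.add hfi
    rw [integral_const_mul, integral_sub hs (hmi.const_mul 2), integral_add hni hfi,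
      integral_const_mul, hn1, hf1]
    ring
  rw [← e]
  refine norm_integral_le_of_norm_le (((hni.add hfi).sub (hmi.const_mul 2)).const_mul C)
    (Eventually.of_forall fun z => ?_)
  rw [← mul_sub, norm_mul]
  have : ‖F n z - f z‖ = F n z + f z - 2 * min (F n z) (f z) := by
    rw [Real.norm_eq_abs]
    rcases le_total (F n z) (f z) with h | h
    · rw [min_eq_left h, abs_of_nonpos (by linarith)]; ring
    · rw [min_eq_right h, abs_of_nonneg (by linarith)]; ring
  rw [← this]
  exact mul_le_mul_of_nonneg_right (hC z) (norm_nonneg _)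

theorem integrable_mul_density_iff {Y J ρ₀ ρ : ℝ → ℝ} (hY : ∀ a, HasDerivAt Y (J a) a)
    (hJ : ∀ a, 0 < J a) (hsurj : Function.Surjective Y) (hρ : ∀ a, ρ (Y a) * J a = ρ₀ a)
    (g : ℝ → ℝ) :
    Integrable (fun y => g y * ρ y) ↔ Integrable fun a => g (Y a) * ρ₀ a := by
  have hinj : InjOn Y univ := (strictMono_of_deriv_pos fun a => by
    rw [(hY a).deriv]; exact hJ a).injective.injOn
  have := integrableOn_image_iff_integrableOn_abs_deriv_smul MeasurableSet.univ
    (fun a _ => (hY a).hasDerivWithinAt) hinj (fun y => g y * ρ y)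
  rw [image_univ, hsurj.range_eq, integrableOn_univ, integrableOn_univ] at this
  rw [this]
  refine integrable_congr (Eventually.of_forall fun a => ?_)
  simp only [smul_eq_mul, abs_of_pos (hJ a), ← hρ]
  ring

theorem integral_mul_density_eq {Y J ρ₀ ρ : ℝ → ℝ} (hY : ∀ a, HasDerivAt Y (J a) a)
    (hJ : ∀ a, 0 < J a) (hsurj : Function.Surjective Y) (hρ : ∀ a, ρ (Y a) * J a = ρ₀ a)
    (g : ℝ → ℝ) :
    ∫ y, g y * ρ y = ∫ a, g (Y a) * ρ₀ a := by
  have hinj : InjOn Y univ := (strictMono_of_deriv_pos fun a => by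
    rw [(hY a).deriv]; exact hJ a).injective.injOn
  have := integral_image_eq_integral_abs_deriv_smul MeasurableSet.univ
    (fun a _ => (hY a).hasDerivWithinAt) hinj (fun y => g y * ρ y)
  rw [image_univ, hsurj.range_eq, setIntegral_univ, setIntegral_univ] at this
  rw [this]
  refine integral_congr_ae (Eventually.of_forall fun a => ?_)
  simp only [smul_eq_mul, abs_of_pos (hJ a), ← hρ]
  ring

/-- The measure with density `ρ₀`. -/
def densityMeasure (ρ₀ : ℝ → ℝ) : Measure ℝ :=
  volume.withDensity fun x => ENNReal.ofReal (ρ₀ x)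

theorem integrable_densityMeasure_iff {ρ₀ : ℝ → ℝ} (hm : Measurable ρ₀) (h0 : ∀ x, 0 ≤ ρ₀ x)
    {f : ℝ → ℝ} : Integrable f (densityMeasure ρ₀) ↔ Integrable fun x => f x * ρ₀ x := by
  unfold densityMeasure
  rw [integrable_withDensity_iff hm.ennreal_ofReal (Eventually.of_forall fun x => by simp)]
  simp only [ENNReal.toReal_ofReal (h0 _)]

theorem integral_densityMeasure {ρ₀ : ℝ → ℝ} (hm : Measurable ρ₀) (h0 : ∀ x, 0 ≤ ρ₀ x)
    (f : ℝ → ℝ) : ∫ x, f x ∂densityMeasure ρ₀ = ∫ x, f x * ρ₀ x := by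
  unfold densityMeasure
  rw [integral_withDensity_eq_integral_toReal_smul hm.ennreal_ofReal
    (Eventually.of_forall fun x => by simp)]
  simp only [ENNReal.toReal_ofReal (h0 _), smul_eq_mul, mul_comm]

theorem isProbabilityMeasure_densityMeasure {ρ₀ : ℝ → ℝ} (h0 : ∀ x, 0 ≤ ρ₀ x)
    (hi : Integrable ρ₀) (h1 : ∫ x, ρ₀ x = 1) : IsProbabilityMeasure (densityMeasure ρ₀) := by
  constructor
  rw [densityMeasure, withDensity_apply _ MeasurableSet.univ, Measure.restrict_univ,
    ← ofReal_integral_eq_lintegral_ofReal hi (Eventually.of_forall h0), h1, ENNReal.ofReal_one]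

/-! ### Integrals depending on parameters -/

theorem integrable_of_le_mul {μ : Measure ℝ} {f : ℝ → ℝ} {w : ℝ → ℝ} {c : ℝ}
    (hf : Continuous f) (hw : Integrable w μ) (hb : ∀ b, |f b| ≤ c * w b) : Integrable f μ :=
  (hw.const_mul c).mono' hf.aestronglyMeasurable (Eventually.of_forall hb)

theorem continuous_integral_of_le_mul {T : Type*} [TopologicalSpace T] [FirstCountableTopology T]
    {μ : Measure ℝ} {f : T → ℝ → ℝ} {w : ℝ → ℝ} {φ : T → ℝ} (hf : Continuous (uncurry f))
    (hw : Integrable w μ) (hw0 : ∀ b, 0 ≤ w b) (hφ : Continuous φ)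
    (hb : ∀ p b, |f p b| ≤ φ p * w b) : Continuous fun p => ∫ b, f p b ∂μ := by
  refine continuous_iff_continuousAt.2 fun p₀ => ?_
  refine continuousAt_of_dominated (bound := fun b => (φ p₀ + 1) * w b) ?_ ?_ (hw.const_mul _) ?_
  · exact Eventually.of_forall fun p =>
      (hf.comp (by fun_prop : Continuous fun b => (p, b))).aestronglyMeasurable
  · filter_upwards [hφ.continuousAt.eventually_lt_const (lt_add_one (φ p₀))] with p hp
    refine Eventually.of_forall fun b => (hb p b).trans ?_
    exact mul_le_mul_of_nonneg_right hp.le (hw0 b)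
  · exact Eventually.of_forall fun b =>
      (hf.comp (by fun_prop : Continuous fun p => (p, b))).continuousAt

theorem hasDerivAt_integral_of_le_mul {μ : Measure ℝ} {f f' : ℝ → ℝ → ℝ} {w φ : ℝ → ℝ}
    (hf : ∀ s, Continuous (f s)) (hfi : ∀ s, Integrable (f s) μ) (hf' : ∀ s, Continuous (f' s))
    (hd : ∀ s b, HasDerivAt (fun s => f s b) (f' s b) s)
    (hw : Integrable w μ) (hw0 : ∀ b, 0 ≤ w b) (hφ : Continuous φ)
    (hb : ∀ s b, |f' s b| ≤ φ s * w b) (s : ℝ) :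
    HasDerivAt (fun s => ∫ b, f s b ∂μ) (∫ b, f' s b ∂μ) s := by
  refine (hasDerivAt_integral_of_dominated_loc_of_deriv_le (bound := fun b => (φ s + 1) * w b)
    (hφ.continuousAt.eventually_lt_const (lt_add_one (φ s))) ?_ (hfi s)
    (hf' s).aestronglyMeasurable ?_ (hw.const_mul _) ?_).2
  · exact Eventually.of_forall fun p => (hf p).aestronglyMeasurable
  · refine Eventually.of_forall fun b p hp => (hb p b).trans ?_
    exact mul_le_mul_of_nonneg_right (le_of_lt hp) (hw0 b)
  · exact Eventually.of_forall fun b p _ => hd p b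

/-! ### The primitive of the influence function -/

/-- The primitive of `ψ` vanishing at the origin. -/
def primitive (ψ : ℝ → ℝ) (x : ℝ) : ℝ := ∫ s in (0 : ℝ)..x, ψ s

namespace IsInfluenceFunction
variable {ψ : ℝ → ℝ} {ψM : ℝ}

theorem continuous (h : IsInfluenceFunction ψ ψM) : Continuous ψ := h.lipschitz.choose_spec.continuous

theorem abs_le (h : IsInfluenceFunction ψ ψM) (x : ℝ) : |ψ x| ≤ ψM := by
  rw [abs_of_nonneg (h.nonneg x)]; exact h.le_bound x

theorem hasDerivAt_primitive (h : IsInfluenceFunction ψ ψM) (x : ℝ) :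
    HasDerivAt (primitive ψ) (ψ x) x := _root_.hasDerivAt_primitive h.continuous x

theorem continuous_primitive (h : IsInfluenceFunction ψ ψM) : Continuous (primitive ψ) :=
  continuous_iff_continuousAt.2 fun x => (h.hasDerivAt_primitive x).continuousAt

theorem abs_primitive_sub_le (h : IsInfluenceFunction ψ ψM) (x y : ℝ) :
    |primitive ψ x - primitive ψ y| ≤ ψM * |x - y| := by
  have := convex_univ.norm_image_sub_le_of_norm_hasDerivWithin_le
    (fun z _ => (h.hasDerivAt_primitive z).hasDerivWithinAt) (fun z _ => h.abs_le z)
    (mem_univ y) (mem_univ x)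
  simpa using this

end IsInfluenceFunction

/-! ### Initial data -/

/-- The weight `1 + |u₀|`, which controls the displacement of particles. -/
def velocityWeight (u₀ : ℝ → ℝ) (a : ℝ) : ℝ := 1 + |u₀ a|

/-- The centred cumulative mass, so that `∂ₓK ⋆ ρ₀ = k * centredMass ρ₀`. -/
def centredMass (ρ₀ : ℝ → ℝ) (a : ℝ) : ℝ := (∫ y in Iic a, ρ₀ y) - 1 / 2

theorem one_le_velocityWeight (u₀ : ℝ → ℝ) (a : ℝ) : 1 ≤ velocityWeight u₀ a := by
  unfold velocityWeight; linarith [abs_nonneg (u₀ a)]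

theorem velocityWeight_pos (u₀ : ℝ → ℝ) (a : ℝ) : 0 < velocityWeight u₀ a :=
  one_pos.trans_le (one_le_velocityWeight u₀ a)

namespace IsInitialData
variable {ρ₀ u₀ : ℝ → ℝ}

theorem continuous_density (h : IsInitialData ρ₀ u₀) : Continuous ρ₀ := h.contDiff_density.continuous

theorem continuous_velocity (h : IsInitialData ρ₀ u₀) : Continuous u₀ := h.contDiff_velocity.continuous

theorem hasDerivAt_velocity (h : IsInitialData ρ₀ u₀) (a : ℝ) : HasDerivAt u₀ (deriv u₀ a) a :=
  (h.contDiff_velocity.differentiable (by norm_num) a).hasDerivAt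

theorem contDiff_deriv_velocity (h : IsInitialData ρ₀ u₀) : ContDiff ℝ 1 (deriv u₀) := by
  have := h.contDiff_velocity
  rw [show (2 : WithTop ℕ∞) = 1 + 1 from one_add_one_eq_two.symm, contDiff_succ_iff_deriv] at this
  exact this.2.2

theorem continuous_velocityWeight (h : IsInitialData ρ₀ u₀) : Continuous (velocityWeight u₀) :=
  continuous_const.add h.continuous_velocity.abs

theorem isProbabilityMeasure (h : IsInitialData ρ₀ u₀) : IsProbabilityMeasure (densityMeasure ρ₀) :=
  isProbabilityMeasure_densityMeasure h.density_nonneg h.density_integrable h.density_mass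

theorem integral_densityMeasure (h : IsInitialData ρ₀ u₀) (f : ℝ → ℝ) :
    ∫ x, f x ∂densityMeasure ρ₀ = ∫ x, f x * ρ₀ x :=
  _root_.integral_densityMeasure h.continuous_density.measurable h.density_nonneg f

theorem integrable_densityMeasure_iff (h : IsInitialData ρ₀ u₀) {f : ℝ → ℝ} :
    Integrable f (densityMeasure ρ₀) ↔ Integrable fun x => f x * ρ₀ x :=
  _root_.integrable_densityMeasure_iff h.continuous_density.measurable h.density_nonneg

theorem integrable_velocityWeight (h : IsInitialData ρ₀ u₀) :
    Integrable (velocityWeight u₀) (densityMeasure ρ₀) := by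
  rw [h.integrable_densityMeasure_iff]
  refine (h.density_integrable.add h.momentum_integrable.abs).congr (Eventually.of_forall fun x => ?_)
  simp only [Pi.add_apply, abs_mul, abs_of_nonneg (h.density_nonneg x), velocityWeight]
  ring

theorem hasDerivAt_centredMass (h : IsInitialData ρ₀ u₀) (a : ℝ) :
    HasDerivAt (centredMass ρ₀) (ρ₀ a) a := by
  have e : centredMass ρ₀ = fun a => (∫ y in (0 : ℝ)..a, ρ₀ y) + ((∫ y in Iic 0, ρ₀ y) - 1 / 2) := by
    funext a
    have := intervalIntegral.integral_Iic_sub_Iic (μ := volume) (a := 0) (b := a) (f := ρ₀)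
      h.density_integrable.integrableOn h.density_integrable.integrableOn
    rw [← this, centredMass]
    ring
  rw [e]
  exact (hasDerivAt_primitive h.continuous_density a).add_const _

theorem continuous_centredMass (h : IsInitialData ρ₀ u₀) : Continuous (centredMass ρ₀) :=
  continuous_iff_continuousAt.2 fun a => (h.hasDerivAt_centredMass a).continuousAt

theorem abs_centredMass_le (h : IsInitialData ρ₀ u₀) (a : ℝ) : |centredMass ρ₀ a| ≤ 1 := by
  have h1 : 0 ≤ ∫ y in Iic a, ρ₀ y := setIntegral_nonneg measurableSet_Iic fun x _ => h.density_nonneg x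
  have h2 : ∫ y in Iic a, ρ₀ y ≤ 1 := h.density_mass ▸ setIntegral_le_integral h.density_integrable
    (Eventually.of_forall h.density_nonneg)
  rw [centredMass, abs_le]
  constructor <;> linarith

end IsInitialData

/-! ### The Lagrangian flow -/

/-- The change of velocity of the particle `a` caused by alignment, when the particle `b`
has moved to `Y b`. -/
def alignmentDrift (ψ ρ₀ Y : ℝ → ℝ) (a : ℝ) : ℝ :=
  ∫ b, (primitive ψ (a - b) - primitive ψ (Y a - Y b)) ∂densityMeasure ρ₀

section Drift
variable {ψ ρ₀ u₀ : ℝ → ℝ} {ψM : ℝ}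

theorem integrable_alignmentDrift (hψ : IsInfluenceFunction ψ ψM) (hd : IsInitialData ρ₀ u₀)
    {Y : ℝ → ℝ} {C : ℝ} (hY : Continuous Y) (hC : ∀ b, |Y b - b| ≤ C * velocityWeight u₀ b) (a : ℝ) :
    Integrable (fun b => primitive ψ (a - b) - primitive ψ (Y a - Y b)) (densityMeasure ρ₀) := by
  have := hψ.continuous_primitive
  refine integrable_of_le_mul (w := velocityWeight u₀)
    (c := ψM * (C * velocityWeight u₀ a + C)) (by fun_prop) hd.integrable_velocityWeight fun b => ?_
  refine (hψ.abs_primitive_sub_le _ _).trans ?_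
  rw [mul_assoc]
  refine mul_le_mul_of_nonneg_left ?_ hψ.bound_pos.le
  have h1 := hC a
  have h2 := hC b
  have h3 : |a - b - (Y a - Y b)| ≤ |Y a - a| + |Y b - b| := by
    rw [show a - b - (Y a - Y b) = (Y b - b) - (Y a - a) by ring, add_comm]
    exact abs_sub _ _
  have h4 : 0 ≤ C * velocityWeight u₀ a := (abs_nonneg _).trans h1
  nlinarith [one_le_velocityWeight u₀ b]

theorem abs_alignmentDrift_sub_le (hψ : IsInfluenceFunction ψ ψM) (hd : IsInitialData ρ₀ u₀)
    {Y Z : ℝ → ℝ} {C C' δ : ℝ} (hY : Continuous Y) (hC : ∀ b, |Y b - b| ≤ C * velocityWeight u₀ b)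
    (hZ : Continuous Z) (hC' : ∀ b, |Z b - b| ≤ C' * velocityWeight u₀ b)
    (hδ : ∀ b, |Y b - Z b| ≤ δ * velocityWeight u₀ b) (a : ℝ) :
    |alignmentDrift ψ ρ₀ Y a - alignmentDrift ψ ρ₀ Z a| ≤
      ψM * (1 + ∫ b, velocityWeight u₀ b ∂densityMeasure ρ₀) * δ * velocityWeight u₀ a := by
  have := hd.isProbabilityMeasure
  have hδ0 : 0 ≤ δ := by
    have := (abs_nonneg _).trans (hδ a)
    exact nonneg_of_mul_nonneg_left this (velocityWeight_pos u₀ a)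
  unfold alignmentDrift
  rw [← integral_sub (integrable_alignmentDrift hψ hd hY hC a)
    (integrable_alignmentDrift hψ hd hZ hC' a)]
  have hi : Integrable (fun b => ψM * (δ * velocityWeight u₀ a) + ψM * δ * velocityWeight u₀ b)
      (densityMeasure ρ₀) := (integrable_const _).add (hd.integrable_velocityWeight.const_mul _)
  rw [← Real.norm_eq_abs]
  refine (norm_integral_le_of_norm_le hi (Eventually.of_forall fun b => ?_)).trans ?_
  · rw [Real.norm_eq_abs, sub_sub_sub_cancel_left]
    refine (hψ.abs_primitive_sub_le _ _).trans ?_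
    have h1 := hδ a
    have h2 := hδ b
    have h3 : |Z a - Z b - (Y a - Y b)| ≤ |Y a - Z a| + |Y b - Z b| := by
      rw [show Z a - Z b - (Y a - Y b) = (Y b - Z b) - (Y a - Z a) by ring, add_comm]
      exact abs_sub _ _
    calc ψM * |Z a - Z b - (Y a - Y b)|
        ≤ ψM * (δ * velocityWeight u₀ a + δ * velocityWeight u₀ b) :=
          mul_le_mul_of_nonneg_left (by linarith) hψ.bound_pos.le
      _ = _ := by ring
  · rw [integral_add (integrable_const _) (hd.integrable_velocityWeight.const_mul _),
      integral_const, integral_const_mul, probReal_univ, one_smul]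
    have h1 : 0 ≤ ∫ b, velocityWeight u₀ b ∂densityMeasure ρ₀ :=
      integral_nonneg fun b => (velocityWeight_pos u₀ b).le
    have h2 := one_le_velocityWeight u₀ a
    have h3 : 0 ≤ ψM * δ * ∫ b, velocityWeight u₀ b ∂densityMeasure ρ₀ := by
      have := hψ.bound_pos
      positivity
    nlinarith [hψ.bound_pos]

theorem alignmentDrift_id : alignmentDrift ψ ρ₀ (fun a => a) = 0 := by
  funext a; simp [alignmentDrift]

theorem abs_alignmentDrift_le (hψ : IsInfluenceFunction ψ ψM) (hd : IsInitialData ρ₀ u₀)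
    {Y : ℝ → ℝ} {C : ℝ} (hY : Continuous Y) (hC : ∀ b, |Y b - b| ≤ C * velocityWeight u₀ b) (a : ℝ) :
    |alignmentDrift ψ ρ₀ Y a| ≤
      ψM * (1 + ∫ b, velocityWeight u₀ b ∂densityMeasure ρ₀) * C * velocityWeight u₀ a := by
  have := abs_alignmentDrift_sub_le (Z := fun a => a) (C' := 0) hψ hd hY hC continuous_id
    (by simp) hC a
  simpa [alignmentDrift_id] using this

theorem continuous_alignmentDrift (hψ : IsInfluenceFunction ψ ψM) (hd : IsInitialData ρ₀ u₀)
    {Y : ℝ → ℝ} {C : ℝ} (hY : Continuous Y) (hC : ∀ b, |Y b - b| ≤ C * velocityWeight u₀ b) :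
    Continuous (alignmentDrift ψ ρ₀ Y) := by
  have := hψ.continuous_primitive
  have hw := hd.continuous_velocityWeight
  refine continuous_integral_of_le_mul (w := velocityWeight u₀)
    (φ := fun a => ψM * (C * velocityWeight u₀ a + C))
    (f := fun a b => primitive ψ (a - b) - primitive ψ (Y a - Y b)) (by fun_prop)
    hd.integrable_velocityWeight (fun b => (velocityWeight_pos u₀ b).le) (by fun_prop) fun a b => ?_
  refine (hψ.abs_primitive_sub_le _ _).trans ?_
  rw [mul_assoc]
  refine mul_le_mul_of_nonneg_left ?_ hψ.bound_pos.le
  have h1 := hC a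
  have h2 := hC b
  have h3 : |a - b - (Y a - Y b)| ≤ |Y a - a| + |Y b - b| := by
    rw [show a - b - (Y a - Y b) = (Y b - b) - (Y a - a) by ring, add_comm]
    exact abs_sub _ _
  have h4 : 0 ≤ C * velocityWeight u₀ a := (abs_nonneg _).trans h1
  nlinarith [one_le_velocityWeight u₀ b]

end Drift

/-- `X` is the flow of the Lagrangian formulation of the system (once integrated in time), and `V`
is the velocity of particles along this flow. -/
structure IsLagrangianFlow (k : ℝ) (ψ ρ₀ u₀ : ℝ → ℝ) (X V : ℝ → ℝ → ℝ) : Prop where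
  initial : ∀ a, X 0 a = a
  continuous : Continuous (uncurry X)
  hasDerivAt : ∀ t a, HasDerivAt (fun s => X s a) (V t a) t
  velocity_eq : ∀ t a, V t a = u₀ a - k * t * centredMass ρ₀ a + alignmentDrift ψ ρ₀ (X t) a
  displacement : ∃ φ : ℝ → ℝ, Continuous φ ∧ ∀ t a, |X t a - a| ≤ φ t * velocityWeight u₀ a

theorem exists_isLagrangianFlow {k ψM : ℝ} {ψ ρ₀ u₀ : ℝ → ℝ} (hψ : IsInfluenceFunction ψ ψM)
    (hd : IsInitialData ρ₀ u₀) : ∃ X V, IsLagrangianFlow k ψ ρ₀ u₀ X V := by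
  set w := velocityWeight u₀ with hw
  have hwc : Continuous w := hd.continuous_velocityWeight
  have hw1 : ∀ a, 1 ≤ w a := one_le_velocityWeight u₀
  have hw0 : ∀ a, 0 < w a := velocityWeight_pos u₀
  set K : ℝ := ψM * (1 + ∫ b, w b ∂densityMeasure ρ₀) with hK
  have hI0 : 0 ≤ ∫ b, w b ∂densityMeasure ρ₀ := integral_nonneg fun b => (hw0 b).le
  have hK0 : 0 ≤ K := by have := hψ.bound_pos; positivity
  let pos : BoundedContinuousFunction ℝ ℝ → ℝ → ℝ := fun B a => a + w a * B a
  have hpos : ∀ B, Continuous (pos B) := fun B => by fun_prop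
  have hposd : ∀ B a, |pos B a - a| ≤ ‖B‖ * w a := fun B a => by
    simp only [pos, add_sub_cancel_left, abs_mul, abs_of_pos (hw0 a)]
    rw [mul_comm]
    exact mul_le_mul_of_nonneg_right (B.norm_coe_le_norm a) (hw0 a).le
  have bdd : ∀ {f : ℝ → ℝ} {C : ℝ}, (∀ a, |f a| ≤ C * w a) → ∀ a, ‖f a / w a‖ ≤ C := fun h a => by
    rw [norm_div, Real.norm_eq_abs, Real.norm_eq_abs, abs_of_pos (hw0 a), div_le_iff₀ (hw0 a)]
    exact h a
  let c₀ : BoundedContinuousFunction ℝ ℝ := BoundedContinuousFunction.ofNormedAddCommGroup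
    (fun a => u₀ a / w a) (hd.continuous_velocity.div hwc fun a => (hw0 a).ne') 1
    (bdd fun a => by simp [hw, velocityWeight])
  let c₁ : BoundedContinuousFunction ℝ ℝ := BoundedContinuousFunction.ofNormedAddCommGroup
    (fun a => k * centredMass ρ₀ a / w a)
    ((hd.continuous_centredMass.const_mul k).div hwc fun a => (hw0 a).ne') |k|
    (bdd fun a => by
      rw [abs_mul]
      have := hd.abs_centredMass_le a
      exact mul_le_mul_of_nonneg_left (this.trans (hw1 a)) (abs_nonneg k))
  let N : BoundedContinuousFunction ℝ ℝ → BoundedContinuousFunction ℝ ℝ := fun B =>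
    BoundedContinuousFunction.ofNormedAddCommGroup (fun a => alignmentDrift ψ ρ₀ (pos B) a / w a)
    ((continuous_alignmentDrift hψ hd (hpos B) (hposd B)).div hwc fun a => (hw0 a).ne')
    (K * ‖B‖) (bdd fun a => abs_alignmentDrift_le hψ hd (hpos B) (hposd B) a)
  have hN : LipschitzWith K.toNNReal N := LipschitzWith.of_dist_le_mul fun B B' => by
    rw [Real.coe_toNNReal _ hK0, BoundedContinuousFunction.dist_le (by positivity)]
    intro a
    simp only [N, BoundedContinuousFunction.coe_ofNormedAddCommGroup, dist_eq_norm, ← sub_div]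
    refine bdd (f := fun a => alignmentDrift ψ ρ₀ (pos B) a - alignmentDrift ψ ρ₀ (pos B') a)
      (abs_alignmentDrift_sub_le hψ hd (hpos B) (hposd B) (hpos B') (hposd B') fun b => ?_) a
    simp only [pos, add_sub_add_left_eq_sub, ← mul_sub, abs_mul, abs_of_pos (hw0 b)]
    rw [mul_comm]
    exact mul_le_mul_of_nonneg_right ((B - B').norm_coe_le_norm b) (hw0 b).le
  have hN0 : ‖N 0‖ ≤ 0 := by
    have := BoundedContinuousFunction.norm_ofNormedAddCommGroup_le (f := fun a => alignmentDrift ψ ρ₀ (pos 0) a / w a)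
      ((continuous_alignmentDrift hψ hd (hpos 0) (hposd 0)).div hwc fun a => (hw0 a).ne') le_rfl
      (by simpa using (bdd fun a => abs_alignmentDrift_le hψ hd (hpos 0) (hposd 0) a))
    exact this
  obtain ⟨B, hB0, hB⟩ := exists_forall_hasDerivAt_of_lipschitzWith
    (f := fun t B => c₀ - t • c₁ + N B) (K := K.toNNReal) (C := ‖c₀‖ + ‖c₁‖)
    (fun t => LipschitzWith.of_dist_le_mul fun B B' => by
      simp only [dist_add_left]; exact hN.dist_le_mul B B')
    (fun B => by fun_prop)
    (fun t => by
      have h1 : ‖c₀ - t • c₁ + N 0‖ ≤ ‖c₀‖ + |t| * ‖c₁‖ := by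
        refine (norm_add_le _ _).trans ?_
        have := norm_sub_le c₀ (t • c₁)
        rw [norm_smul, Real.norm_eq_abs] at this
        linarith
      have h2 := Real.add_one_le_exp |t|
      nlinarith [norm_nonneg c₀, norm_nonneg c₁, abs_nonneg t]) 0
  have hBc : Continuous B := continuous_iff_continuousAt.2 fun t => (hB t).continuousAt
  refine ⟨fun t a => pos (B t) a,
    fun t a => u₀ a - k * t * centredMass ρ₀ a + alignmentDrift ψ ρ₀ (pos (B t)) a,
    fun a => by simp [pos, hB0], ?_, ?_, fun t a => rfl, fun t => ‖B t‖, by fun_prop,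
    fun t a => hposd (B t) a⟩
  · have : Continuous fun p : ℝ × ℝ => B p.1 p.2 := by
      have e : Continuous fun p : BoundedContinuousFunction ℝ ℝ × ℝ => p.1 p.2 := continuous_eval
      exact e.comp (f := fun p : ℝ × ℝ => (B p.1, p.2)) (by fun_prop)
    exact continuous_snd.add ((hwc.comp continuous_snd).mul this)
  · intro t a
    have h1 : HasDerivAt (fun s => B s a) ((c₀ - t • c₁ + N (B t)) a) t :=
      (BoundedContinuousFunction.evalCLM (β := ℝ) ℝ a).hasFDerivAt.comp_hasDerivAt t (hB t)
    refine ((h1.const_mul (w a)).const_add a).congr_deriv ?_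
    have := (hw0 a).ne'
    simp only [BoundedContinuousFunction.coe_add, BoundedContinuousFunction.coe_sub,
      BoundedContinuousFunction.coe_smul, Pi.add_apply, Pi.sub_apply, smul_eq_mul, c₀, c₁, N,
      BoundedContinuousFunction.coe_ofNormedAddCommGroup]
    field_simp

/-- The source term of the equation for the Jacobian of the Lagrangian flow. -/
def slopeSource (k : ℝ) (ψ ρ₀ u₀ : ℝ → ℝ) (t a : ℝ) : ℝ :=
  deriv u₀ a + conv ψ ρ₀ a - k * t * ρ₀ a

/-- The influence `(ψ ⋆ ρ)(y, t)` felt at `y`, when the particle `b` is at `X t b`. -/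
def influence (ψ ρ₀ : ℝ → ℝ) (X : ℝ → ℝ → ℝ) (t y : ℝ) : ℝ :=
  ∫ b, ψ (y - X t b) ∂densityMeasure ρ₀

/-- The Jacobian `∂ₐX` of the Lagrangian flow. -/
def flowJacobian (k : ℝ) (ψ ρ₀ u₀ : ℝ → ℝ) (X : ℝ → ℝ → ℝ) (t a : ℝ) : ℝ :=
  linearSolution (fun s => slopeSource k ψ ρ₀ u₀ s a) (fun s => -influence ψ ρ₀ X s (X s a)) 1 t

/-- The time derivative of the Jacobian, which is also the spatial derivative of the velocity along
particle paths. -/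
def flowJacobianRate (k : ℝ) (ψ ρ₀ u₀ : ℝ → ℝ) (X : ℝ → ℝ → ℝ) (t a : ℝ) : ℝ :=
  slopeSource k ψ ρ₀ u₀ t a - influence ψ ρ₀ X t (X t a) * flowJacobian k ψ ρ₀ u₀ X t a

/-- The acceleration of the particle `a`. -/
def flowAcceleration (k : ℝ) (ψ ρ₀ : ℝ → ℝ) (X V : ℝ → ℝ → ℝ) (t a : ℝ) : ℝ :=
  (∫ b, ψ (X t a - X t b) * (V t b - V t a) ∂densityMeasure ρ₀) - k * centredMass ρ₀ a

section General
variable {k ψM : ℝ} {ψ ρ₀ u₀ : ℝ → ℝ}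

theorem hasDerivAt_integral_primitive_sub (hψ : IsInfluenceFunction ψ ψM)
    (hd : IsInitialData ρ₀ u₀) {Z : ℝ → ℝ} {C : ℝ} (hZ : Continuous Z)
    (hC : ∀ b, |Z b - b| ≤ C * velocityWeight u₀ b) (y : ℝ) :
    Integrable (fun b => primitive ψ (y - Z b) - primitive ψ (-b)) (densityMeasure ρ₀) ∧
    HasDerivAt (fun y => ∫ b, (primitive ψ (y - Z b) - primitive ψ (-b)) ∂densityMeasure ρ₀)
      (∫ b, ψ (y - Z b) ∂densityMeasure ρ₀) y := by
  have hΨ := hψ.continuous_primitive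
  have hψc := hψ.continuous
  have hi : ∀ y, Integrable (fun b => primitive ψ (y - Z b) - primitive ψ (-b))
      (densityMeasure ρ₀) := fun y => by
    refine integrable_of_le_mul (w := velocityWeight u₀) (c := ψM * (|y| + C)) (by fun_prop)
      hd.integrable_velocityWeight fun b => ?_
    refine (hψ.abs_primitive_sub_le _ _).trans ?_
    rw [mul_assoc]
    refine mul_le_mul_of_nonneg_left ?_ hψ.bound_pos.le
    have h3 : |y - Z b - -b| ≤ |y| + |Z b - b| := by
      rw [show y - Z b - -b = y - (Z b - b) by ring]
      exact abs_sub _ _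
    nlinarith [hC b, one_le_velocityWeight u₀ b, abs_nonneg y]
  refine ⟨hi y, hasDerivAt_integral_of_le_mul (w := velocityWeight u₀) (φ := fun _ => ψM)
    (f := fun y b => primitive ψ (y - Z b) - primitive ψ (-b))
    (f' := fun y b => ψ (y - Z b)) (fun s => by fun_prop) hi (fun s => by fun_prop) ?_
    hd.integrable_velocityWeight (fun b => (velocityWeight_pos u₀ b).le) continuous_const ?_ y⟩
  · intro s b
    have := (hψ.hasDerivAt_primitive (s - Z b)).comp s ((hasDerivAt_id s).sub_const (Z b))
    simpa using this.sub_const (primitive ψ (-b))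
  · intro s b
    refine (hψ.abs_le _).trans ?_
    nlinarith [one_le_velocityWeight u₀ b, hψ.bound_pos]

theorem IsInitialData.conv_eq (hd : IsInitialData ρ₀ u₀) (a : ℝ) :
    conv ψ ρ₀ a = ∫ b, ψ (a - b) ∂densityMeasure ρ₀ := by
  rw [hd.integral_densityMeasure, conv]

theorem IsInitialData.continuous_conv (hψ : IsInfluenceFunction ψ ψM) (hd : IsInitialData ρ₀ u₀) :
    Continuous (conv ψ ρ₀) := by
  have hψc := hψ.continuous
  rw [show conv ψ ρ₀ = _ from funext hd.conv_eq]
  refine continuous_integral_of_le_mul (w := velocityWeight u₀) (φ := fun _ => ψM)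
    (f := fun a b => ψ (a - b)) (by fun_prop) hd.integrable_velocityWeight
    (fun b => (velocityWeight_pos u₀ b).le) continuous_const fun a b => ?_
  refine (hψ.abs_le _).trans ?_
  nlinarith [one_le_velocityWeight u₀ b, hψ.bound_pos]

theorem IsInitialData.integral_mem_Icc (hψ : IsInfluenceFunction ψ ψM) (hd : IsInitialData ρ₀ u₀)
    {Z : ℝ → ℝ} (hZ : Continuous Z) :
    ∫ b, ψ (Z b) ∂densityMeasure ρ₀ ∈ Icc 0 ψM := by
  have := hd.isProbabilityMeasure
  have hψc := hψ.continuous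
  refine ⟨integral_nonneg fun b => hψ.nonneg _, ?_⟩
  have hi : Integrable (fun b => ψ (Z b)) (densityMeasure ρ₀) :=
    (integrable_const ψM).mono' (hψc.comp hZ).aestronglyMeasurable
      (Eventually.of_forall fun b => hψ.abs_le _)
  calc _ ≤ ∫ b, ψM ∂densityMeasure ρ₀ := integral_mono hi (integrable_const _) fun b => hψ.le_bound _
    _ = ψM := by simp

theorem IsInitialData.conv_mem_Icc (hψ : IsInfluenceFunction ψ ψM) (hd : IsInitialData ρ₀ u₀)
    (a : ℝ) : conv ψ ρ₀ a ∈ Icc 0 ψM := by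
  rw [hd.conv_eq]
  exact hd.integral_mem_Icc hψ (by fun_prop : Continuous fun b => a - b)

theorem IsInitialData.exists_density_le (hd : IsInitialData ρ₀ u₀) : ∃ R, 0 < R ∧ ∀ x, ρ₀ x ≤ R := by
  let f : ZeroAtInftyContinuousMap ℝ ℝ := ⟨⟨ρ₀, hd.continuous_density⟩, hd.density_vanishes⟩
  obtain ⟨C, hC⟩ := (ZeroAtInftyContinuousMap.isBounded_range f).exists_norm_le
  refine ⟨max C 1, by positivity, fun x => (le_abs_self _).trans ((hC (f x) ⟨x, rfl⟩).trans (le_max_left _ _))⟩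

theorem continuous_slopeSource (hψ : IsInfluenceFunction ψ ψM) (hd : IsInitialData ρ₀ u₀) :
    Continuous (uncurry (slopeSource k ψ ρ₀ u₀)) := by
  have h1 := hd.contDiff_deriv_velocity.continuous
  have h2 := hd.continuous_conv hψ
  have h3 := hd.continuous_density
  unfold slopeSource
  fun_prop

theorem exists_abs_slopeSource_le (hψ : IsInfluenceFunction ψ ψM) (hd : IsInitialData ρ₀ u₀)
    (k N : ℝ) : ∃ G, 0 ≤ G ∧ ∀ t, |t| ≤ N → ∀ a, |slopeSource k ψ ρ₀ u₀ t a| ≤ G := by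
  obtain ⟨C, hC⟩ := hd.slope_bounded
  obtain ⟨R, hR0, hR⟩ := hd.exists_density_le
  have hC0 : 0 ≤ C := (abs_nonneg _).trans (hC 0)
  have hψ0 := hψ.bound_pos
  refine ⟨C + ψM + |k| * |N| * R, by positivity, fun t ht a => ?_⟩
  have h1 := hd.conv_mem_Icc hψ a
  have h2 : |k * t * ρ₀ a| ≤ |k| * |N| * R := by
    rw [abs_mul, abs_mul, abs_of_nonneg (hd.density_nonneg a)]
    have := ht.trans (le_abs_self N)
    exact mul_le_mul (by gcongr) (hR a) (hd.density_nonneg a) (by positivity)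
  unfold slopeSource
  refine (abs_sub _ _).trans (add_le_add ((abs_add_le _ _).trans (add_le_add (hC a) ?_)) h2)
  rw [abs_of_nonneg h1.1]; exact h1.2

end General

namespace IsLagrangianFlow
variable {k ψM : ℝ} {ψ ρ₀ u₀ : ℝ → ℝ} {X V : ℝ → ℝ → ℝ}

theorem continuous_slice (hX : IsLagrangianFlow k ψ ρ₀ u₀ X V) (t : ℝ) : Continuous (X t) :=
  hX.continuous.comp (by fun_prop : Continuous fun a => (t, a))

theorem continuous_comp {T : Type*} [TopologicalSpace T] (hX : IsLagrangianFlow k ψ ρ₀ u₀ X V)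
    {p q : T → ℝ} (hp : Continuous p) (hq : Continuous q) : Continuous fun z => X (p z) (q z) :=
  hX.continuous.comp (hp.prodMk hq)

theorem influence_mem_Icc (hψ : IsInfluenceFunction ψ ψM) (hd : IsInitialData ρ₀ u₀)
    (hX : IsLagrangianFlow k ψ ρ₀ u₀ X V) (t y : ℝ) : influence ψ ρ₀ X t y ∈ Icc 0 ψM :=
  hd.integral_mem_Icc hψ (continuous_const.sub (hX.continuous_slice t))

theorem continuous_influence (hψ : IsInfluenceFunction ψ ψM) (hd : IsInitialData ρ₀ u₀)
    (hX : IsLagrangianFlow k ψ ρ₀ u₀ X V) : Continuous (uncurry (influence ψ ρ₀ X)) := by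
  have hψc := hψ.continuous
  refine continuous_integral_of_le_mul (T := ℝ × ℝ) (w := velocityWeight u₀) (φ := fun _ => ψM)
    (f := fun p b => ψ (p.2 - X p.1 b)) ?_ hd.integrable_velocityWeight
    (fun b => (velocityWeight_pos u₀ b).le) continuous_const fun p b => ?_
  · have := hX.continuous_comp (by fun_prop : Continuous fun q : (ℝ × ℝ) × ℝ => q.1.1) continuous_snd
    exact hψc.comp ((by fun_prop : Continuous fun q : (ℝ × ℝ) × ℝ => q.1.2).sub this)
  · refine (hψ.abs_le _).trans ?_
    nlinarith [one_le_velocityWeight u₀ b, hψ.bound_pos]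

theorem continuous_influence_along (hψ : IsInfluenceFunction ψ ψM) (hd : IsInitialData ρ₀ u₀)
    (hX : IsLagrangianFlow k ψ ρ₀ u₀ X V) :
    Continuous fun p : ℝ × ℝ => influence ψ ρ₀ X p.1 (X p.1 p.2) :=
  (hX.continuous_influence hψ hd).comp (continuous_fst.prodMk hX.continuous)

theorem hasDerivAt_space (hψ : IsInfluenceFunction ψ ψM) (hd : IsInitialData ρ₀ u₀)
    (hX : IsLagrangianFlow k ψ ρ₀ u₀ X V) (t a : ℝ) :
    HasDerivAt (X t) (flowJacobian k ψ ρ₀ u₀ X t a) a := by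
  obtain ⟨φ, hφ, hφX⟩ := hX.displacement
  have h0 := fun y => hasDerivAt_integral_primitive_sub hψ hd (Z := fun b => b) (C := 0)
    continuous_id (by simp) y
  have ht := fun t y => hasDerivAt_integral_primitive_sub hψ hd (hX.continuous_slice t) (hφX t) y
  refine hasDerivAt_flow (X := X)
    (W := fun t a => u₀ a - k * t * centredMass ρ₀ a +
      ∫ b, (primitive ψ (a - b) - primitive ψ (-b)) ∂densityMeasure ρ₀)
    (Wa := slopeSource k ψ ρ₀ u₀)
    (v := fun t y => -∫ b, (primitive ψ (y - X t b) - primitive ψ (-b)) ∂densityMeasure ρ₀)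
    (vy := fun t y => -influence ψ ρ₀ X t y)
    hX.continuous hX.initial ?_ ?_ (continuous_slopeSource hψ hd) ?_
    (hX.continuous_influence hψ hd).neg t a
  · intro t a
    refine (hX.hasDerivAt t a).congr_deriv ?_
    rw [hX.velocity_eq, add_assoc, ← sub_eq_add_neg, ← integral_sub (h0 a).1 (ht t (X t a)).1,
      alignmentDrift]
    congr 2
    funext b
    ring
  · intro t a
    refine (((hd.hasDerivAt_velocity a).sub ((hd.hasDerivAt_centredMass a).const_mul (k * t))).add
      (h0 a).2).congr_deriv ?_
    rw [← hd.conv_eq, slopeSource]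
    ring
  · intro t y
    exact (ht t y).2.neg

theorem hasDerivAt_jacobian (hψ : IsInfluenceFunction ψ ψM) (hd : IsInitialData ρ₀ u₀)
    (hX : IsLagrangianFlow k ψ ρ₀ u₀ X V) (t a : ℝ) :
    HasDerivAt (fun s => flowJacobian k ψ ρ₀ u₀ X s a) (flowJacobianRate k ψ ρ₀ u₀ X t a) t := by
  have h1 : Continuous fun s => slopeSource k ψ ρ₀ u₀ s a :=
    (continuous_slopeSource hψ hd).comp (by fun_prop : Continuous fun s : ℝ => (s, a))
  have h2 : Continuous fun s => -influence ψ ρ₀ X s (X s a) :=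
    ((hX.continuous_influence_along hψ hd).comp (by fun_prop : Continuous fun s : ℝ => (s, a))).neg
  refine (hasDerivAt_linearSolution h1 h2 1 t).congr_deriv ?_
  rw [flowJacobianRate, flowJacobian]
  ring

theorem continuous_jacobian (hψ : IsInfluenceFunction ψ ψM) (hd : IsInitialData ρ₀ u₀)
    (hX : IsLagrangianFlow k ψ ρ₀ u₀ X V) : Continuous (uncurry (flowJacobian k ψ ρ₀ u₀ X)) := by
  have := continuous_linearSolution_param (T := ℝ) (α := fun a s => slopeSource k ψ ρ₀ u₀ s a)
    (β := fun a s => -influence ψ ρ₀ X s (X s a))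
    ((continuous_slopeSource hψ hd).comp continuous_swap)
    ((hX.continuous_influence_along hψ hd).comp continuous_swap).neg 1
  exact this.comp continuous_swap

theorem jacobian_zero (a : ℝ) : flowJacobian k ψ ρ₀ u₀ X 0 a = 1 := by
  simp [flowJacobian, linearSolution]

theorem continuous_jacobianRate (hψ : IsInfluenceFunction ψ ψM) (hd : IsInitialData ρ₀ u₀)
    (hX : IsLagrangianFlow k ψ ρ₀ u₀ X V) :
    Continuous (uncurry (flowJacobianRate k ψ ρ₀ u₀ X)) :=
  (continuous_slopeSource hψ hd).sub
    ((hX.continuous_influence_along hψ hd).mul (hX.continuous_jacobian hψ hd))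

theorem hasDerivAt_velocity_space (hψ : IsInfluenceFunction ψ ψM) (hd : IsInitialData ρ₀ u₀)
    (hX : IsLagrangianFlow k ψ ρ₀ u₀ X V) (t a : ℝ) :
    HasDerivAt (V t) (flowJacobianRate k ψ ρ₀ u₀ X t a) a := by
  obtain ⟨φ, hφ, hφX⟩ := hX.displacement
  have h0 := fun y => hasDerivAt_integral_primitive_sub hψ hd (Z := fun b => b) (C := 0)
    continuous_id (by simp) y
  have ht := fun y => hasDerivAt_integral_primitive_sub hψ hd (hX.continuous_slice t) (hφX t) y
  have e : V t = fun a => u₀ a - k * t * centredMass ρ₀ a +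
      (∫ b, (primitive ψ (a - b) - primitive ψ (-b)) ∂densityMeasure ρ₀) -
      ∫ b, (primitive ψ (X t a - X t b) - primitive ψ (-b)) ∂densityMeasure ρ₀ := by
    funext a
    rw [hX.velocity_eq, add_sub_assoc, ← integral_sub (h0 a).1 (ht (X t a)).1, alignmentDrift]
    congr 2
    funext b
    ring
  rw [e]
  refine ((((hd.hasDerivAt_velocity a).sub ((hd.hasDerivAt_centredMass a).const_mul (k * t))).add
      (h0 a).2).sub ((ht (X t a)).2.comp a (hX.hasDerivAt_space hψ hd t a))).congr_deriv ?_
  rw [← hd.conv_eq, flowJacobianRate, slopeSource, influence]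
  ring

theorem exists_abs_velocity_le (hψ : IsInfluenceFunction ψ ψM) (hd : IsInitialData ρ₀ u₀)
    (hX : IsLagrangianFlow k ψ ρ₀ u₀ X V) :
    ∃ φ : ℝ → ℝ, Continuous φ ∧ ∀ t a, |V t a| ≤ φ t * velocityWeight u₀ a := by
  obtain ⟨φ, hφ, hφX⟩ := hX.displacement
  refine ⟨fun t => 1 + |k| * |t| +
    ψM * (1 + ∫ b, velocityWeight u₀ b ∂densityMeasure ρ₀) * φ t, by fun_prop, fun t a => ?_⟩
  have h1 := abs_alignmentDrift_le hψ hd (hX.continuous_slice t) (hφX t) a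
  have h2 := hd.abs_centredMass_le a
  have h3 := one_le_velocityWeight u₀ a
  have h4 : |k * t * centredMass ρ₀ a| ≤ |k| * |t| * velocityWeight u₀ a := by
    rw [abs_mul, abs_mul]
    gcongr
    exact h2.trans h3
  have h5 : |u₀ a| ≤ velocityWeight u₀ a := by unfold velocityWeight; linarith
  rw [hX.velocity_eq]
  refine (abs_add_le _ _).trans ?_
  have := abs_sub (u₀ a) (k * t * centredMass ρ₀ a)
  linarith

theorem continuous_velocity (hψ : IsInfluenceFunction ψ ψM) (hd : IsInitialData ρ₀ u₀)
    (hX : IsLagrangianFlow k ψ ρ₀ u₀ X V) : Continuous (uncurry V) := by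
  obtain ⟨φ, hφ, hφX⟩ := hX.displacement
  have hΨ := hψ.continuous_primitive
  have hw := hd.continuous_velocityWeight
  have hu := hd.continuous_velocity
  have hF := hd.continuous_centredMass
  have e : uncurry V = fun p : ℝ × ℝ => u₀ p.2 - k * p.1 * centredMass ρ₀ p.2 +
      ∫ b, (primitive ψ (p.2 - b) - primitive ψ (X p.1 p.2 - X p.1 b)) ∂densityMeasure ρ₀ := by
    funext p
    exact hX.velocity_eq p.1 p.2
  rw [e]
  refine Continuous.add (by fun_prop) ?_
  have e1 := hX.continuous_comp (by fun_prop : Continuous fun q : (ℝ × ℝ) × ℝ => q.1.1) continuous_snd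
  have e2 := hX.continuous_comp (by fun_prop : Continuous fun q : (ℝ × ℝ) × ℝ => q.1.1)
    (by fun_prop : Continuous fun q : (ℝ × ℝ) × ℝ => q.1.2)
  refine continuous_integral_of_le_mul (w := velocityWeight u₀)
    (φ := fun p : ℝ × ℝ => ψM * (φ p.1 * velocityWeight u₀ p.2 + φ p.1))
    (f := fun (p : ℝ × ℝ) b => primitive ψ (p.2 - b) - primitive ψ (X p.1 p.2 - X p.1 b)) ?_
    hd.integrable_velocityWeight (fun b => (velocityWeight_pos u₀ b).le) (by fun_prop) ?_
  · exact (hΨ.comp (by fun_prop : Continuous fun q : (ℝ × ℝ) × ℝ => q.1.2 - q.2)).sub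
      (hΨ.comp (e2.sub e1))
  · rintro ⟨t, a⟩ b
    refine (hψ.abs_primitive_sub_le _ _).trans ?_
    rw [mul_assoc]
    refine mul_le_mul_of_nonneg_left ?_ hψ.bound_pos.le
    have h1 := hφX t a
    have h2 := hφX t b
    have h3 : |a - b - (X t a - X t b)| ≤ |X t a - a| + |X t b - b| := by
      rw [show a - b - (X t a - X t b) = (X t b - b) - (X t a - a) by ring, add_comm]
      exact abs_sub _ _
    have h4 : 0 ≤ φ t * velocityWeight u₀ a := (abs_nonneg _).trans h1
    simp only
    nlinarith [one_le_velocityWeight u₀ b]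

theorem continuous_velocity_slice (hψ : IsInfluenceFunction ψ ψM) (hd : IsInitialData ρ₀ u₀)
    (hX : IsLagrangianFlow k ψ ρ₀ u₀ X V) (t : ℝ) : Continuous (V t) :=
  (hX.continuous_velocity hψ hd).comp (by fun_prop : Continuous fun a => (t, a))

theorem abs_alignment_le (hψ : IsInfluenceFunction ψ ψM) {φ : ℝ → ℝ}
    (hφ : ∀ t a, |V t a| ≤ φ t * velocityWeight u₀ a) (x t a b : ℝ) :
    |ψ x * (V t b - V t a)| ≤ ψM * (φ t * velocityWeight u₀ a + φ t) * velocityWeight u₀ b := by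
  rw [abs_mul, mul_assoc]
  refine mul_le_mul (hψ.abs_le _) ?_ (abs_nonneg _) hψ.bound_pos.le
  have h1 := hφ t a
  have h2 := hφ t b
  have h4 : 0 ≤ φ t * velocityWeight u₀ a := (abs_nonneg _).trans h1
  have := abs_sub (V t b) (V t a)
  nlinarith [one_le_velocityWeight u₀ b]

theorem continuous_acceleration (hψ : IsInfluenceFunction ψ ψM) (hd : IsInitialData ρ₀ u₀)
    (hX : IsLagrangianFlow k ψ ρ₀ u₀ X V) :
    Continuous (uncurry (flowAcceleration k ψ ρ₀ X V)) := by
  obtain ⟨φ, hφ, hφV⟩ := hX.exists_abs_velocity_le hψ hd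
  have hψc := hψ.continuous
  have hV := hX.continuous_velocity hψ hd
  have hw := hd.continuous_velocityWeight
  have hF := hd.continuous_centredMass
  have p1 : Continuous fun q : (ℝ × ℝ) × ℝ => (q.1.1, q.2) := by fun_prop
  have p2 : Continuous fun q : (ℝ × ℝ) × ℝ => (q.1.1, q.1.2) := by fun_prop
  have h := continuous_integral_of_le_mul (w := velocityWeight u₀) (μ := densityMeasure ρ₀)
    (φ := fun p : ℝ × ℝ => ψM * (φ p.1 * velocityWeight u₀ p.2 + φ p.1))
    (f := fun (p : ℝ × ℝ) b => ψ (X p.1 p.2 - X p.1 b) * (V p.1 b - V p.1 p.2))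
    ((hψc.comp ((hX.continuous.comp p2).sub (hX.continuous.comp p1))).mul
      ((hV.comp p1).sub (hV.comp p2)))
    hd.integrable_velocityWeight (fun b => (velocityWeight_pos u₀ b).le) (by fun_prop)
    fun p b => abs_alignment_le hψ hφV _ _ _ _
  exact h.sub (continuous_const.mul (hF.comp continuous_snd))

theorem hasDerivAt_velocity_time (hψ : IsInfluenceFunction ψ ψM) (hd : IsInitialData ρ₀ u₀)
    (hX : IsLagrangianFlow k ψ ρ₀ u₀ X V) (t a : ℝ) :
    HasDerivAt (fun s => V s a) (flowAcceleration k ψ ρ₀ X V t a) t := by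
  obtain ⟨φ, hφ, hφV⟩ := hX.exists_abs_velocity_le hψ hd
  obtain ⟨φ', hφ', hφX⟩ := hX.displacement
  have hψc := hψ.continuous
  have hΨ := hψ.continuous_primitive
  have e : (fun s => V s a) = fun s => u₀ a - k * s * centredMass ρ₀ a +
      alignmentDrift ψ ρ₀ (X s) a := funext fun s => hX.velocity_eq s a
  rw [e]
  have h1 := hasDerivAt_integral_of_le_mul (μ := densityMeasure ρ₀) (w := velocityWeight u₀)
    (φ := fun s => ψM * (φ s * velocityWeight u₀ a + φ s))
    (f := fun s b => primitive ψ (a - b) - primitive ψ (X s a - X s b))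
    (f' := fun s b => ψ (X s a - X s b) * (V s b - V s a))
    (fun s => by have := hX.continuous_slice s; fun_prop)
    (fun s => integrable_alignmentDrift hψ hd (hX.continuous_slice s) (hφX s) a)
    (fun s => by
      have := hX.continuous_slice s
      have := hX.continuous_velocity_slice hψ hd s
      fun_prop)
    (fun s b => by
      have := (hψ.hasDerivAt_primitive (X s a - X s b)).comp s
        ((hX.hasDerivAt s a).sub (hX.hasDerivAt s b))
      refine (this.const_sub (primitive ψ (a - b))).congr_deriv ?_
      ring)
    hd.integrable_velocityWeight (fun b => (velocityWeight_pos u₀ b).le) (by fun_prop)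
    (fun s b => abs_alignment_le hψ hφV _ _ _ _) t
  have h2 : HasDerivAt (fun s => u₀ a - k * s * centredMass ρ₀ a) (-(k * centredMass ρ₀ a)) t := by
    simpa using (((hasDerivAt_id t).const_mul k).mul_const (centredMass ρ₀ a)).const_sub (u₀ a)
  refine (h2.add h1).congr_deriv ?_
  rw [flowAcceleration]
  ring

theorem exists_abs_jacobian_le (hψ : IsInfluenceFunction ψ ψM) (hd : IsInitialData ρ₀ u₀)
    (hX : IsLagrangianFlow k ψ ρ₀ u₀ X V) (N : ℝ) :
    ∃ C, 0 ≤ C ∧ ∀ t, |t| ≤ N → ∀ a, |flowJacobian k ψ ρ₀ u₀ X t a| ≤ C ∧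
      |flowJacobianRate k ψ ρ₀ u₀ X t a| ≤ C := by
  obtain ⟨G, hG0, hG⟩ := exists_abs_slopeSource_le hψ hd k N
  have hψ0 := hψ.bound_pos
  set E := Real.exp (ψM * |N|) with hE
  have hE0 : 0 < E := Real.exp_pos _
  have hP : ∀ t, |t| ≤ N → ∀ a, |∫ s in (0 : ℝ)..t, -influence ψ ρ₀ X s (X s a)| ≤ ψM * |N| := by
    intro t ht a
    have := intervalIntegral.norm_integral_le_of_norm_le_const (a := 0) (b := t) (C := ψM)
      (f := fun s => -influence ψ ρ₀ X s (X s a)) fun s _ => by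
        have := hX.influence_mem_Icc hψ hd s (X s a)
        rw [norm_neg, Real.norm_eq_abs, abs_of_nonneg this.1]
        exact this.2
    rw [sub_zero, Real.norm_eq_abs] at this
    exact this.trans (mul_le_mul_of_nonneg_left (ht.trans (le_abs_self N)) (by positivity))
  have hJ : ∀ t, |t| ≤ N → ∀ a, |flowJacobian k ψ ρ₀ u₀ X t a| ≤ E * (1 + G * E * |N|) := by
    intro t ht a
    rw [flowJacobian, linearSolution, abs_mul, Real.abs_exp]
    have h1 : Real.exp (∫ s in (0 : ℝ)..t, -influence ψ ρ₀ X s (X s a)) ≤ E :=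
      Real.exp_le_exp.2 ((le_abs_self _).trans (hP t ht a))
    have h2 : |∫ s in (0 : ℝ)..t, slopeSource k ψ ρ₀ u₀ s a *
        Real.exp (-∫ r in (0 : ℝ)..s, -influence ψ ρ₀ X r (X r a))| ≤ G * E * |N| := by
      have := intervalIntegral.norm_integral_le_of_norm_le_const (a := 0) (b := t) (C := G * E)
        (f := fun s => slopeSource k ψ ρ₀ u₀ s a *
          Real.exp (-∫ r in (0 : ℝ)..s, -influence ψ ρ₀ X r (X r a))) fun s hs => by
        have hs' : |s| ≤ N := by
          have := abs_sub_left_of_mem_uIcc (uIoc_subset_uIcc hs)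
          simp only [sub_zero] at this
          exact this.trans ht
        rw [norm_mul, Real.norm_eq_abs, Real.norm_eq_abs, Real.abs_exp]
        gcongr
        · exact hG s hs' a
        · exact Real.exp_le_exp.2 ((neg_le_abs _).trans (hP s hs' a))
      rw [sub_zero, Real.norm_eq_abs] at this
      exact this.trans (mul_le_mul_of_nonneg_left (ht.trans (le_abs_self N)) (by positivity))
    gcongr
    refine (abs_add_le _ _).trans ?_
    rw [abs_one]
    gcongr
  refine ⟨E * (1 + G * E * |N|) + (G + ψM * (E * (1 + G * E * |N|))), by positivity,
    fun t ht a => ⟨(hJ t ht a).trans (le_add_of_nonneg_right (by positivity)), ?_⟩⟩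
  refine le_trans ?_ (le_add_of_nonneg_left (by positivity))
  rw [flowJacobianRate]
  refine (abs_sub _ _).trans (add_le_add (hG t ht a) ?_)
  have := hX.influence_mem_Icc hψ hd t (X t a)
  rw [abs_mul, abs_of_nonneg this.1]
  exact mul_le_mul this.2 (hJ t ht a) (abs_nonneg _) hψ0.le

end IsLagrangianFlow

/-! ### Times before the collapse of the flow -/

/-- The times `t` such that `J` has a positive lower bound on all times between `0` and `t`. -/
def goodTimes (J : ℝ → ℝ → ℝ) : Set ℝ := {t | ∃ c > 0, ∀ s ∈ uIcc 0 t, ∀ a, c ≤ J s a}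

theorem starShapedTimes_goodTimes (J : ℝ → ℝ → ℝ) : StarShapedTimes (goodTimes J) := by
  rintro t ⟨c, hc, h⟩ s hs
  exact ⟨c, hc, fun r hr => h r (uIcc_subset_uIcc left_mem_uIcc hs hr)⟩

/-- `J` is Lipschitz in time, uniformly in space and locally uniformly in time. -/
def LocallyLipschitzInTime (J : ℝ → ℝ → ℝ) : Prop :=
  ∀ N : ℝ, ∃ C : ℝ, 0 ≤ C ∧ ∀ s t, |s| ≤ N → |t| ≤ N → ∀ a, |J s a - J t a| ≤ C * |s - t|

theorem isOpen_goodTimes {J : ℝ → ℝ → ℝ} (hJ : LocallyLipschitzInTime J) : IsOpen (goodTimes J) := by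
  refine Metric.isOpen_iff.2 ?_
  rintro t ⟨c, hc, h⟩
  obtain ⟨C, hC0, hC⟩ := hJ (|t| + 1)
  refine ⟨min 1 (c / (2 * (C + 1))), by positivity, fun t' ht' => ⟨c / 2, by positivity, ?_⟩⟩
  rw [Metric.mem_ball, Real.dist_eq, lt_min_iff] at ht'
  intro s hs a
  rcases uIcc_subset_uIcc_union_uIcc (b := t) hs with hs | hs
  · exact (by linarith : c / 2 ≤ c).trans (h s hs a)
  · have h1 : |s - t| ≤ |t' - t| := abs_sub_left_of_mem_uIcc hs
    have h2 : |s| ≤ |t| + 1 := by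
      have := abs_add_le (s - t) t
      rw [sub_add_cancel] at this
      linarith
    have h3 := hC s t h2 (by linarith) a
    have h4 := h t right_mem_uIcc a
    have h5 : |t' - t| * (2 * (C + 1)) < c := (lt_div_iff₀ (by positivity)).1 ht'.2
    have h6 := (abs_le.1 h3).1
    nlinarith [abs_nonneg (t' - t), abs_nonneg (s - t)]

theorem zero_mem_goodTimes {J : ℝ → ℝ → ℝ} (hJ : ∀ a, J 0 a = 1) : (0 : ℝ) ∈ goodTimes J :=
  ⟨1, one_pos, fun s hs a => by
    rw [uIcc_self, mem_singleton_iff] at hs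
    rw [hs, hJ]⟩

theorem pos_of_mem_goodTimes {J : ℝ → ℝ → ℝ} {t : ℝ} (ht : t ∈ goodTimes J) (a : ℝ) : 0 < J t a := by
  obtain ⟨c, hc, h⟩ := ht
  exact hc.trans_le (h t right_mem_uIcc a)

/-! ### Inverting the flow -/

theorem surjective_of_le_deriv {f f' : ℝ → ℝ} {c : ℝ} (hf : ∀ x, HasDerivAt f (f' x) x) (hc : 0 < c)
    (h : ∀ x, c ≤ f' x) : Function.Surjective f := by
  have hd : Differentiable ℝ f := fun x => (hf x).differentiableAt
  have key : ∀ {x y}, x ≤ y → c * (y - x) ≤ f y - f x := fun hxy =>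
    mul_sub_le_image_sub_of_le_deriv hd (fun x => by rw [(hf x).deriv]; exact h x) hxy
  refine hd.continuous.surjective ?_ ?_
  · refine tendsto_atTop_mono' atTop (f₁ := fun x => f 0 + c * x) ?_
      (tendsto_atTop_add_const_left _ _ (tendsto_id.const_mul_atTop hc))
    filter_upwards [eventually_ge_atTop 0] with x hx
    have := key hx
    linarith
  · refine tendsto_atBot_mono' atBot (f₁ := fun x => f 0 + c * x) ?_
      (tendsto_atBot_add_const_left _ _ (tendsto_id.const_mul_atBot hc))
    filter_upwards [eventually_le_atBot 0] with x hx
    have := key hx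
    linarith

/-- The linear equivalence `(s, h) ↦ (s, α s + β h)`. -/
def shearEquiv (α β : ℝ) (hβ : β ≠ 0) : (ℝ × ℝ) ≃L[ℝ] (ℝ × ℝ) :=
  ContinuousLinearEquiv.equivOfInverse
    ((ContinuousLinearMap.fst ℝ ℝ ℝ).prod
      (α • ContinuousLinearMap.fst ℝ ℝ ℝ + β • ContinuousLinearMap.snd ℝ ℝ ℝ))
    ((ContinuousLinearMap.fst ℝ ℝ ℝ).prod
      (-(α / β) • ContinuousLinearMap.fst ℝ ℝ ℝ + β⁻¹ • ContinuousLinearMap.snd ℝ ℝ ℝ))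
    (fun p => by ext <;> simp; field_simp; ring)
    (fun p => by ext <;> simp; field_simp; ring)

theorem contDiffAt_inverse {X X₁ X₂ A : ℝ → ℝ → ℝ} {O : Set ℝ} (hO : IsOpen O)
    (h₁ : ∀ t a, HasDerivAt (fun s => X s a) (X₁ t a) t) (h₂ : ∀ t a, HasDerivAt (X t) (X₂ t a) a)
    (c₁ : Continuous (uncurry X₁)) (c₂ : Continuous (uncurry X₂))
    (hpos : ∀ t ∈ O, ∀ a, X₂ t a ≠ 0) (hinj : ∀ t ∈ O, Function.Injective (X t))
    (hA : ∀ t ∈ O, ∀ x, X t (A t x) = x) {t : ℝ} (ht : t ∈ O) (x : ℝ) :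
    ContDiffAt ℝ 1 (uncurry A) (t, x) := by
  let Θ : ℝ × ℝ → ℝ × ℝ := fun p => (p.1, X p.1 p.2)
  set p₀ : ℝ × ℝ := (t, A t x) with hp₀
  have hX : ContDiffAt ℝ 1 (uncurry X) p₀ :=
    (contDiffOn_one_of_partial_derivs isOpen_univ (fun p _ => h₁ p.1 p.2) (fun p _ => h₂ p.1 p.2)
      c₁.continuousOn c₂.continuousOn).contDiffAt univ_mem
  have hΘ : ContDiffAt ℝ 1 Θ p₀ := contDiffAt_fst.prodMk hX
  have hΘ' : HasFDerivAt Θ (shearEquiv (X₁ t (A t x)) (X₂ t (A t x)) (hpos t ht _) :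
      (ℝ × ℝ) →L[ℝ] (ℝ × ℝ)) p₀ :=
    hasFDerivAt_fst.prodMk (hasStrictFDerivAt_of_partial_derivs isOpen_univ
      (fun p _ => h₁ p.1 p.2) (fun p _ => h₂ p.1 p.2)
      c₁.continuousOn c₂.continuousOn (mem_univ p₀)).hasFDerivAt
  have hval : Θ p₀ = (t, x) := by simp [Θ, p₀, hA t ht x]
  have hg := hΘ.to_localInverse hΘ' one_ne_zero
  have hr := (hΘ.hasStrictFDerivAt' hΘ' one_ne_zero).eventually_right_inverse
  rw [hval] at hg hr
  refine (contDiffAt_snd.comp _ hg).congr_of_eventuallyEq ?_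
  have hO' : O ×ˢ (univ : Set ℝ) ∈ 𝓝 (t, x) := (hO.prod isOpen_univ).mem_nhds ⟨ht, mem_univ _⟩
  filter_upwards [hr, hO'] with q hq hqO
  have e1 := congrArg Prod.fst hq
  have e2 := congrArg Prod.snd hq
  simp only [Θ] at e1 e2
  rw [e1] at e2
  apply hinj q.1 hqO.1
  rw [uncurry, hA q.1 hqO.1]
  exact e2.symm

theorem hasDerivAt_along {F : ℝ → ℝ → ℝ} {y : ℝ → ℝ} {y' t : ℝ}
    (hF : DifferentiableAt ℝ (uncurry F) (t, y t)) (hy : HasDerivAt y y' t) :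
    HasDerivAt (fun s => F s (y s)) (deriv (fun s => F s (y t)) t + y' * deriv (F t) (y t)) t := by
  have e1 : HasDerivAt (fun s => F s (y t)) (fderiv ℝ (uncurry F) (t, y t) (1, 0)) t :=
    HasFDerivAt.comp_hasDerivAt (f := fun s => (s, y t)) t hF.hasFDerivAt
      ((hasDerivAt_id t).prodMk (hasDerivAt_const t (y t)))
  have e2 : HasDerivAt (F t) (fderiv ℝ (uncurry F) (t, y t) (0, 1)) (y t) :=
    hF.hasFDerivAt.comp_hasDerivAt (y t) ((hasDerivAt_const (y t) t).prodMk (hasDerivAt_id (y t)))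
  have e3 : HasDerivAt (fun s => F s (y s)) (fderiv ℝ (uncurry F) (t, y t) (1, y')) t :=
    HasFDerivAt.comp_hasDerivAt (f := fun s => (s, y s)) t hF.hasFDerivAt
      ((hasDerivAt_id t).prodMk hy)
  rw [e1.deriv, e2.deriv]
  refine e3.congr_deriv ?_
  rw [← smul_eq_mul, ← map_smul, ← map_add]
  simp

theorem differentiableAt_slice {F : ℝ → ℝ → ℝ} {t x : ℝ}
    (hF : DifferentiableAt ℝ (uncurry F) (t, x)) : DifferentiableAt ℝ (F t) x :=
  hF.comp (f := fun x : ℝ => (t, x)) x (by fun_prop)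

namespace IsLagrangianFlow
variable {k ψM : ℝ} {ψ ρ₀ u₀ : ℝ → ℝ} {X V : ℝ → ℝ → ℝ}

theorem locallyLipschitz_jacobian (hψ : IsInfluenceFunction ψ ψM) (hd : IsInitialData ρ₀ u₀)
    (hX : IsLagrangianFlow k ψ ρ₀ u₀ X V) :
    LocallyLipschitzInTime (flowJacobian k ψ ρ₀ u₀ X) := by
  intro N
  obtain ⟨C, hC0, hC⟩ := hX.exists_abs_jacobian_le hψ hd N
  refine ⟨C, hC0, fun s t hs ht a => ?_⟩
  have := (convex_Icc (-N) N).norm_image_sub_le_of_norm_hasDerivWithin_le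
    (fun z _ => (hX.hasDerivAt_jacobian hψ hd z a).hasDerivWithinAt)
    (fun z hz => (hC z (abs_le.2 hz) a).2) (abs_le.1 ht) (abs_le.1 hs)
  simpa using this

end IsLagrangianFlow

/-- The times at which the Lagrangian flow is a diffeomorphism with a uniformly positive Jacobian. -/
def regularTimes (k : ℝ) (ψ ρ₀ u₀ : ℝ → ℝ) (X : ℝ → ℝ → ℝ) : Set ℝ :=
  goodTimes (flowJacobian k ψ ρ₀ u₀ X)

/-- The label of the particle at `x` at time `t`. -/
def flowInverse (X : ℝ → ℝ → ℝ) (t x : ℝ) : ℝ := Function.invFun (X t) x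

/-- The density transported by the flow. -/
def flowDensity (k : ℝ) (ψ ρ₀ u₀ : ℝ → ℝ) (X : ℝ → ℝ → ℝ) (t x : ℝ) : ℝ :=
  ρ₀ (flowInverse X t x) / flowJacobian k ψ ρ₀ u₀ X t (flowInverse X t x)

/-- The Eulerian velocity of the flow. -/
def flowVelocity (X V : ℝ → ℝ → ℝ) (t x : ℝ) : ℝ := V t (flowInverse X t x)

namespace IsLagrangianFlow
variable {k ψM : ℝ} {ψ ρ₀ u₀ : ℝ → ℝ} {X V : ℝ → ℝ → ℝ}

theorem isOpen_regularTimes (hψ : IsInfluenceFunction ψ ψM) (hd : IsInitialData ρ₀ u₀)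
    (hX : IsLagrangianFlow k ψ ρ₀ u₀ X V) : IsOpen (regularTimes k ψ ρ₀ u₀ X) :=
  isOpen_goodTimes (hX.locallyLipschitz_jacobian hψ hd)

theorem zero_mem_regularTimes : (0 : ℝ) ∈ regularTimes k ψ ρ₀ u₀ X :=
  zero_mem_goodTimes jacobian_zero

theorem strictMono (hψ : IsInfluenceFunction ψ ψM) (hd : IsInitialData ρ₀ u₀)
    (hX : IsLagrangianFlow k ψ ρ₀ u₀ X V) {t : ℝ} (ht : t ∈ regularTimes k ψ ρ₀ u₀ X) :
    StrictMono (X t) :=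
  strictMono_of_deriv_pos fun a => by
    rw [(hX.hasDerivAt_space hψ hd t a).deriv]
    exact pos_of_mem_goodTimes ht a

theorem surjective (hψ : IsInfluenceFunction ψ ψM) (hd : IsInitialData ρ₀ u₀)
    (hX : IsLagrangianFlow k ψ ρ₀ u₀ X V) {t : ℝ} (ht : t ∈ regularTimes k ψ ρ₀ u₀ X) :
    Function.Surjective (X t) := by
  obtain ⟨c, hc, h⟩ := ht
  exact surjective_of_le_deriv (hX.hasDerivAt_space hψ hd t) hc fun a => h t right_mem_uIcc a

theorem apply_inverse (hψ : IsInfluenceFunction ψ ψM) (hd : IsInitialData ρ₀ u₀)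
    (hX : IsLagrangianFlow k ψ ρ₀ u₀ X V) {t : ℝ} (ht : t ∈ regularTimes k ψ ρ₀ u₀ X) (x : ℝ) :
    X t (flowInverse X t x) = x :=
  Function.rightInverse_invFun (hX.surjective hψ hd ht) x

theorem inverse_apply (hψ : IsInfluenceFunction ψ ψM) (hd : IsInitialData ρ₀ u₀)
    (hX : IsLagrangianFlow k ψ ρ₀ u₀ X V) {t : ℝ} (ht : t ∈ regularTimes k ψ ρ₀ u₀ X) (a : ℝ) :
    flowInverse X t (X t a) = a :=
  Function.leftInverse_invFun (hX.strictMono hψ hd ht).injective a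

theorem contDiffAt_flowInverse (hψ : IsInfluenceFunction ψ ψM) (hd : IsInitialData ρ₀ u₀)
    (hX : IsLagrangianFlow k ψ ρ₀ u₀ X V) {t : ℝ} (ht : t ∈ regularTimes k ψ ρ₀ u₀ X) (x : ℝ) :
    ContDiffAt ℝ 1 (uncurry (flowInverse X)) (t, x) :=
  contDiffAt_inverse (hX.isOpen_regularTimes hψ hd) hX.hasDerivAt (hX.hasDerivAt_space hψ hd)
    (hX.continuous_velocity hψ hd) (hX.continuous_jacobian hψ hd)
    (fun _ ht a => (pos_of_mem_goodTimes ht a).ne') (fun _ ht => (hX.strictMono hψ hd ht).injective)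
    (fun _ ht x => hX.apply_inverse hψ hd ht x) ht x

theorem contDiffAt_label (hψ : IsInfluenceFunction ψ ψM) (hd : IsInitialData ρ₀ u₀)
    (hX : IsLagrangianFlow k ψ ρ₀ u₀ X V) {t : ℝ} (ht : t ∈ regularTimes k ψ ρ₀ u₀ X) (x : ℝ) :
    ContDiffAt ℝ 1 (fun p : ℝ × ℝ => (p.1, flowInverse X p.1 p.2)) (t, x) :=
  contDiffAt_fst.prodMk (hX.contDiffAt_flowInverse hψ hd ht x)

theorem contDiffAt_flowVelocity (hψ : IsInfluenceFunction ψ ψM) (hd : IsInitialData ρ₀ u₀)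
    (hX : IsLagrangianFlow k ψ ρ₀ u₀ X V) {t : ℝ} (ht : t ∈ regularTimes k ψ ρ₀ u₀ X) (x : ℝ) :
    ContDiffAt ℝ 1 (uncurry (flowVelocity X V)) (t, x) := by
  have hV : ContDiffAt ℝ 1 (uncurry V) (t, flowInverse X t x) :=
    (contDiffOn_one_of_partial_derivs isOpen_univ
      (fun p _ => hX.hasDerivAt_velocity_time hψ hd p.1 p.2)
      (fun p _ => hX.hasDerivAt_velocity_space hψ hd p.1 p.2)
      (hX.continuous_acceleration hψ hd).continuousOn
      (hX.continuous_jacobianRate hψ hd).continuousOn).contDiffAt univ_mem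
  exact hV.comp (t, x) (hX.contDiffAt_label hψ hd ht x)

theorem flowDensity_mul_jacobian (hψ : IsInfluenceFunction ψ ψM) (hd : IsInitialData ρ₀ u₀)
    (hX : IsLagrangianFlow k ψ ρ₀ u₀ X V) {t : ℝ} (ht : t ∈ regularTimes k ψ ρ₀ u₀ X) (a : ℝ) :
    flowDensity k ψ ρ₀ u₀ X t (X t a) * flowJacobian k ψ ρ₀ u₀ X t a = ρ₀ a := by
  rw [flowDensity, hX.inverse_apply hψ hd ht, div_mul_cancel₀ _ (pos_of_mem_goodTimes ht a).ne']

theorem integrable_mul_flowDensity_iff (hψ : IsInfluenceFunction ψ ψM) (hd : IsInitialData ρ₀ u₀)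
    (hX : IsLagrangianFlow k ψ ρ₀ u₀ X V) {t : ℝ} (ht : t ∈ regularTimes k ψ ρ₀ u₀ X) (g : ℝ → ℝ) :
    Integrable (fun y => g y * flowDensity k ψ ρ₀ u₀ X t y) ↔
      Integrable fun a => g (X t a) * ρ₀ a :=
  integrable_mul_density_iff (hX.hasDerivAt_space hψ hd t) (pos_of_mem_goodTimes ht)
    (hX.surjective hψ hd ht) (hX.flowDensity_mul_jacobian hψ hd ht) g

theorem integral_mul_flowDensity_eq (hψ : IsInfluenceFunction ψ ψM) (hd : IsInitialData ρ₀ u₀)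
    (hX : IsLagrangianFlow k ψ ρ₀ u₀ X V) {t : ℝ} (ht : t ∈ regularTimes k ψ ρ₀ u₀ X) (g : ℝ → ℝ) :
    ∫ y, g y * flowDensity k ψ ρ₀ u₀ X t y = ∫ a, g (X t a) * ρ₀ a :=
  integral_mul_density_eq (hX.hasDerivAt_space hψ hd t) (pos_of_mem_goodTimes ht)
    (hX.surjective hψ hd ht) (hX.flowDensity_mul_jacobian hψ hd ht) g

theorem flowDensity_nonneg (hd : IsInitialData ρ₀ u₀)
    {t : ℝ} (ht : t ∈ regularTimes k ψ ρ₀ u₀ X) (x : ℝ) : 0 ≤ flowDensity k ψ ρ₀ u₀ X t x :=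
  div_nonneg (hd.density_nonneg _) (pos_of_mem_goodTimes ht _).le

theorem integrable_flowDensity (hψ : IsInfluenceFunction ψ ψM) (hd : IsInitialData ρ₀ u₀)
    (hX : IsLagrangianFlow k ψ ρ₀ u₀ X V) {t : ℝ} (ht : t ∈ regularTimes k ψ ρ₀ u₀ X) :
    Integrable (flowDensity k ψ ρ₀ u₀ X t) := by
  simpa using (hX.integrable_mul_flowDensity_iff hψ hd ht fun _ => 1).2
    (by simpa using hd.density_integrable)

theorem integral_flowDensity (hψ : IsInfluenceFunction ψ ψM) (hd : IsInitialData ρ₀ u₀)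
    (hX : IsLagrangianFlow k ψ ρ₀ u₀ X V) {t : ℝ} (ht : t ∈ regularTimes k ψ ρ₀ u₀ X) :
    ∫ x, flowDensity k ψ ρ₀ u₀ X t x = 1 := by
  have := hX.integral_mul_flowDensity_eq hψ hd ht fun _ => 1
  simpa [hd.density_mass] using this

theorem continuousOn_flowDensity (hψ : IsInfluenceFunction ψ ψM) (hd : IsInitialData ρ₀ u₀)
    (hX : IsLagrangianFlow k ψ ρ₀ u₀ X V) :
    ContinuousOn (uncurry (flowDensity k ψ ρ₀ u₀ X)) (regularTimes k ψ ρ₀ u₀ X ×ˢ univ) := by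
  rintro ⟨t, x⟩ ⟨ht, -⟩
  have hA := (hX.contDiffAt_flowInverse hψ hd ht x).continuousAt
  have hL := (hX.contDiffAt_label hψ hd ht x).continuousAt
  have h1 : ContinuousAt (fun p => ρ₀ (uncurry (flowInverse X) p)) (t, x) :=
    hd.continuous_density.continuousAt.comp hA
  have h2 : ContinuousAt (fun p : ℝ × ℝ => flowJacobian k ψ ρ₀ u₀ X p.1 (flowInverse X p.1 p.2))
      (t, x) :=
    ContinuousAt.comp (g := uncurry (flowJacobian k ψ ρ₀ u₀ X))
      (hX.continuous_jacobian hψ hd).continuousAt hL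
  exact (h1.div h2 (pos_of_mem_goodTimes ht _).ne').continuousWithinAt

/-- The derivative of the influence, `(ψ' ⋆ ρ)(y, t)`. -/
def _root_.influenceDeriv (ψ ρ₀ : ℝ → ℝ) (X : ℝ → ℝ → ℝ) (t y : ℝ) : ℝ :=
  ∫ b, deriv ψ (y - X t b) ∂densityMeasure ρ₀

theorem hasDerivAt_influence (hψ : IsInfluenceFunction ψ ψM) (hd : IsInitialData ρ₀ u₀)
    (hX : IsLagrangianFlow k ψ ρ₀ u₀ X V) {t : ℝ} (ht : t ∈ regularTimes k ψ ρ₀ u₀ X) (y : ℝ) :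
    HasDerivAt (influence ψ ρ₀ X t) (influenceDeriv ψ ρ₀ X t y) y := by
  have := hd.isProbabilityMeasure
  obtain ⟨L, hL⟩ := hψ.lipschitz
  have hXt := hX.continuous_slice t
  have hψc := hψ.continuous
  have hae : ∀ᵐ b ∂densityMeasure ρ₀, DifferentiableAt ℝ ψ (y - X t b) := by
    have h0 : volume {x | ¬ DifferentiableAt ℝ ψ x} = 0 := hL.ae_differentiableAt
    have h1 : volume ((fun z => y - z) ⁻¹' {x | ¬ DifferentiableAt ℝ ψ x}) = 0 :=
      (Measure.measurePreserving_sub_left volume y).quasiMeasurePreserving.preimage_null h0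
    have h2 := addHaar_image_eq_zero_of_differentiableOn_of_addHaar_eq_zero volume
      (f := flowInverse X t) (fun x _ => (differentiableAt_slice
        ((hX.contDiffAt_flowInverse hψ hd ht x).differentiableAt one_ne_zero)).differentiableWithinAt) h1
    refine (withDensity_absolutelyContinuous volume _) (measure_mono_null (fun b hb => ?_) h2)
    exact ⟨X t b, hb, hX.inverse_apply hψ hd ht b⟩
  refine (hasDerivAt_integral_of_dominated_loc_of_lip (bound := fun _ => (L : ℝ)) univ_mem
    (F := fun y b => ψ (y - X t b)) (F' := fun b => deriv ψ (y - X t b)) ?_ ?_ ?_ ?_ ?_ ?_).2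
  · exact Eventually.of_forall fun z => by
      have : Continuous fun b => ψ (z - X t b) := by fun_prop
      exact this.aestronglyMeasurable
  · have : Continuous fun b => ψ (y - X t b) := by fun_prop
    exact (integrable_const ψM).mono' this.aestronglyMeasurable
      (Eventually.of_forall fun b => hψ.abs_le _)
  · exact ((measurable_deriv ψ).comp (continuous_const.sub hXt).measurable).aestronglyMeasurable
  · refine Eventually.of_forall fun b => ?_
    rw [show Real.nnabs (L : ℝ) = L by ext; simp]
    refine LipschitzOnWith.of_dist_le_mul fun z _ z' _ => ?_
    have := hL.dist_le_mul (z - X t b) (z' - X t b)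
    rwa [dist_sub_right] at this
  · exact integrable_const _
  · filter_upwards [hae] with b hb
    have := hb.hasDerivAt.comp y ((hasDerivAt_id y).sub_const (X t b))
    rw [mul_one] at this
    exact this

theorem continuousOn_influenceDeriv (hψ : IsInfluenceFunction ψ ψM) (hd : IsInitialData ρ₀ u₀)
    (hX : IsLagrangianFlow k ψ ρ₀ u₀ X V) :
    ContinuousOn (uncurry (influenceDeriv ψ ρ₀ X)) (regularTimes k ψ ρ₀ u₀ X ×ˢ univ) := by
  obtain ⟨L, hL⟩ := hψ.lipschitz
  have e : ∀ p ∈ regularTimes k ψ ρ₀ u₀ X ×ˢ (univ : Set ℝ), uncurry (influenceDeriv ψ ρ₀ X) p =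
      ∫ z, deriv ψ z * flowDensity k ψ ρ₀ u₀ X p.1 (p.2 - z) := by
    rintro ⟨t, y⟩ ⟨ht, -⟩
    rw [uncurry, influenceDeriv, hd.integral_densityMeasure,
      ← hX.integral_mul_flowDensity_eq hψ hd ht fun z => deriv ψ (y - z),
      ← integral_sub_left_eq_self _ volume y]
    simp
  refine ContinuousOn.congr (fun p hp => ?_) e
  obtain ⟨t, y⟩ := p
  have ht : t ∈ regularTimes k ψ ρ₀ u₀ X := hp.1
  have hsub : ∀ {s}, s ∈ regularTimes k ψ ρ₀ u₀ X → ∀ x,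
      Integrable (fun z => flowDensity k ψ ρ₀ u₀ X s (x - z)) ∧
      ∫ z, flowDensity k ψ ρ₀ u₀ X s (x - z) = 1 := fun hs x =>
    ⟨(hX.integrable_flowDensity hψ hd hs).comp_sub_left x, by
      rw [integral_sub_left_eq_self (flowDensity k ψ ρ₀ u₀ X _) volume x,
        hX.integral_flowDensity hψ hd hs]⟩
  refine tendsto_integral_mul_of_tendsto_density (C := L)
    (F := fun (p : ℝ × ℝ) z => flowDensity k ψ ρ₀ u₀ X p.1 (p.2 - z))
    (f := fun z => flowDensity k ψ ρ₀ u₀ X t (y - z)) ?_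
    (fun z => flowDensity_nonneg hd ht _) (hsub ht y).1 (hsub ht y).2 ?_ (measurable_deriv ψ)
    (fun z => norm_deriv_le_of_lipschitz hL)
  · filter_upwards [self_mem_nhdsWithin] with p hp
    exact ⟨fun z => flowDensity_nonneg hd hp.1 _, hsub hp.1 p.2⟩
  · intro z
    have hc := hX.continuousOn_flowDensity hψ hd
    have hc' := hc.comp (f := fun p : ℝ × ℝ => (p.1, p.2 - z)) (by fun_prop)
      (s := regularTimes k ψ ρ₀ u₀ X ×ˢ univ) (fun p hp => ⟨hp.1, mem_univ _⟩)
    exact hc' (t, y) hp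

end IsLagrangianFlow

theorem contDiffOn_linearSolution_param {α β α' β' : ℝ → ℝ → ℝ} {O : Set ℝ} {y₀ : ℝ} (hO : IsOpen O)
    (hst : StarShapedTimes O) (hα : Continuous (uncurry α)) (hβ : Continuous (uncurry β))
    (hα' : ContinuousOn (uncurry α') (O ×ˢ univ)) (hβ' : ContinuousOn (uncurry β') (O ×ˢ univ))
    (hdα : ∀ s ∈ O, ∀ a, HasDerivAt (α s) (α' s a) a)
    (hdβ : ∀ s ∈ O, ∀ a, HasDerivAt (β s) (β' s a) a) :
    ContDiffOn ℝ 1 (fun p : ℝ × ℝ => linearSolution (fun s => α s p.2) (fun s => β s p.2) y₀ p.1)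
      (O ×ˢ univ) := by
  let S : ℝ → ℝ → ℝ := fun t a => ∫ s in (0 : ℝ)..t, β s a
  let S' : ℝ → ℝ → ℝ := fun t a => ∫ s in (0 : ℝ)..t, β' s a
  have cS : Continuous (uncurry S) :=
    (intervalIntegral.continuous_parametric_primitive_of_continuous (μ := volume) (a₀ := 0)
      (f := fun a s => β s a) (hβ.comp continuous_swap)).comp continuous_swap
  have cS' : ContinuousOn (uncurry S') (O ×ˢ univ) := continuousOn_intervalIntegral_param hO hst hβ'
  have dS : ∀ t ∈ O, ∀ a, HasDerivAt (S t) (S' t a) a := fun t ht a =>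
    hasDerivAt_intervalIntegral_param hst hβ.continuousOn hβ' hdβ ht a
  let γ : ℝ → ℝ → ℝ := fun s a => α s a * Real.exp (-S s a)
  let γ' : ℝ → ℝ → ℝ := fun s a => α' s a * Real.exp (-S s a) + α s a * (Real.exp (-S s a) * -S' s a)
  have cγ : Continuous (uncurry γ) := hα.mul cS.neg.rexp
  have cγ' : ContinuousOn (uncurry γ') (O ×ˢ univ) :=
    (hα'.mul cS.neg.rexp.continuousOn).add
      (hα.continuousOn.mul (cS.neg.rexp.continuousOn.mul cS'.neg))
  have dγ : ∀ t ∈ O, ∀ a, HasDerivAt (γ t) (γ' t a) a := fun t ht a =>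
    (hdα t ht a).mul (dS t ht a).neg.exp
  let R : ℝ → ℝ → ℝ := fun t a => ∫ s in (0 : ℝ)..t, γ s a
  let R' : ℝ → ℝ → ℝ := fun t a => ∫ s in (0 : ℝ)..t, γ' s a
  have cR : ContinuousOn (uncurry R) (O ×ˢ univ) :=
    continuousOn_intervalIntegral_param hO hst cγ.continuousOn
  have cR' : ContinuousOn (uncurry R') (O ×ˢ univ) := continuousOn_intervalIntegral_param hO hst cγ'
  have dR : ∀ t ∈ O, ∀ a, HasDerivAt (R t) (R' t a) a := fun t ht a =>
    hasDerivAt_intervalIntegral_param hst cγ.continuousOn cγ' dγ ht a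
  have slice : ∀ {f : ℝ → ℝ → ℝ}, Continuous (uncurry f) → ∀ a, Continuous fun s => f s a :=
    fun hf a => hf.comp (by fun_prop : Continuous fun s : ℝ => (s, a))
  have hrep : ∀ t a, linearSolution (fun s => α s a) (fun s => β s a) y₀ t =
      Real.exp (S t a) * (y₀ + R t a) := fun t a => rfl
  refine contDiffOn_one_of_partial_derivs
    (f := fun t a => linearSolution (fun s => α s a) (fun s => β s a) y₀ t)
    (f₁ := fun t a => α t a + β t a * (Real.exp (S t a) * (y₀ + R t a)))
    (f₂ := fun t a => Real.exp (S t a) * S' t a * (y₀ + R t a) + Real.exp (S t a) * R' t a)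
    (hO.prod isOpen_univ) ?_ ?_ ?_ ?_
  · rintro ⟨t, a⟩ -
    exact hasDerivAt_linearSolution (slice hα a) (slice hβ a) y₀ t
  · rintro ⟨t, a⟩ ⟨ht, -⟩
    exact (dS t ht a).exp.mul ((dR t ht a).const_add y₀)
  · exact hα.continuousOn.add (hβ.continuousOn.mul (cS.rexp.continuousOn.mul
      (continuousOn_const.add cR)))
  · exact ((cS.rexp.continuousOn.mul cS').mul (continuousOn_const.add cR)).add
      (cS.rexp.continuousOn.mul cR')

theorem deriv_newtonianPotential_of_ne {k x : ℝ} (hx : x ≠ 0) :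
    deriv (newtonianPotential k) x = k * SignType.sign x / 2 := by
  unfold newtonianPotential
  exact (((hasDerivAt_abs hx).const_mul k).div_const 2).deriv

theorem integral_deriv_newtonianPotential {k : ℝ} {ρ₀ u₀ Y : ℝ → ℝ} (hd : IsInitialData ρ₀ u₀)
    (hY : StrictMono Y) (a : ℝ) :
    ∫ b, deriv (newtonianPotential k) (Y a - Y b) * ρ₀ b = k * centredMass ρ₀ a := by
  have h1 : ∫ b, deriv (newtonianPotential k) (Y a - Y b) * ρ₀ b =
      ∫ b, (k * (Iic a).indicator ρ₀ b - k / 2 * ρ₀ b) := by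
    refine integral_congr_ae ?_
    filter_upwards [Measure.ae_ne volume a] with b hb
    rcases lt_or_gt_of_ne hb with h | h
    · have : 0 < Y a - Y b := sub_pos.2 (hY h)
      rw [deriv_newtonianPotential_of_ne this.ne', sign_pos this,
        indicator_of_mem (show b ∈ Iic a from h.le)]
      simp only [SignType.coe_one]
      ring
    · have : Y a - Y b < 0 := sub_neg.2 (hY h)
      rw [deriv_newtonianPotential_of_ne this.ne, sign_neg this,
        indicator_of_notMem (show b ∉ Iic a from not_le.2 h)]
      simp only [SignType.coe_neg_one]
      ring
  rw [h1, integral_sub ((hd.density_integrable.indicator measurableSet_Iic).const_mul k)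
    (hd.density_integrable.const_mul _), integral_const_mul, integral_const_mul,
    integral_indicator measurableSet_Iic, hd.density_mass, centredMass]
  ring

namespace IsLagrangianFlow
variable {k ψM : ℝ} {ψ ρ₀ u₀ : ℝ → ℝ} {X V : ℝ → ℝ → ℝ}

theorem contDiffOn_jacobian (hψ : IsInfluenceFunction ψ ψM) (hd : IsInitialData ρ₀ u₀)
    (hX : IsLagrangianFlow k ψ ρ₀ u₀ X V) :
    ContDiffOn ℝ 1 (uncurry (flowJacobian k ψ ρ₀ u₀ X)) (regularTimes k ψ ρ₀ u₀ X ×ˢ univ) := by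
  have hst := starShapedTimes_goodTimes (flowJacobian k ψ ρ₀ u₀ X)
  have h0 : (0 : ℝ) ∈ regularTimes k ψ ρ₀ u₀ X := zero_mem_regularTimes
  have hP := hX.continuousOn_influenceDeriv hψ hd
  have hρ' : Continuous (deriv ρ₀) := hd.contDiff_density.continuous_deriv_one
  have hu' : Continuous (deriv (deriv u₀)) := hd.contDiff_deriv_velocity.continuous_deriv_one
  refine contDiffOn_linearSolution_param (α := slopeSource k ψ ρ₀ u₀)
    (β := fun s a => -influence ψ ρ₀ X s (X s a))
    (α' := fun s a => deriv (deriv u₀) a + influenceDeriv ψ ρ₀ X 0 a - k * s * deriv ρ₀ a)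
    (β' := fun s a => -(influenceDeriv ψ ρ₀ X s (X s a) * flowJacobian k ψ ρ₀ u₀ X s a))
    (hX.isOpen_regularTimes hψ hd) hst
    (continuous_slopeSource hψ hd) (hX.continuous_influence_along hψ hd).neg ?_ ?_ ?_ ?_
  · have : ContinuousOn (fun p : ℝ × ℝ => influenceDeriv ψ ρ₀ X 0 p.2)
        (regularTimes k ψ ρ₀ u₀ X ×ˢ univ) :=
      hP.comp (f := fun p : ℝ × ℝ => (0, p.2)) (by fun_prop) fun p _ => ⟨h0, mem_univ _⟩
    refine ContinuousOn.sub (ContinuousOn.add ?_ this) ?_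
    · exact (hu'.comp continuous_snd).continuousOn
    · exact (by fun_prop : Continuous fun p : ℝ × ℝ => k * p.1 * deriv ρ₀ p.2).continuousOn
  · have : ContinuousOn (fun p : ℝ × ℝ => influenceDeriv ψ ρ₀ X p.1 (X p.1 p.2))
        (regularTimes k ψ ρ₀ u₀ X ×ˢ univ) :=
      hP.comp (f := fun p : ℝ × ℝ => (p.1, X p.1 p.2))
        (continuous_fst.prodMk hX.continuous).continuousOn fun p hp => ⟨hp.1, mem_univ _⟩
    exact (this.mul (hX.continuous_jacobian hψ hd).continuousOn).neg
  · intro s _ a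
    have h1 : HasDerivAt (conv ψ ρ₀) (influenceDeriv ψ ρ₀ X 0 a) a := by
      have e : conv ψ ρ₀ = influence ψ ρ₀ X 0 := by
        funext a
        rw [hd.conv_eq, influence]
        simp only [hX.initial]
      rw [e]
      exact hX.hasDerivAt_influence hψ hd h0 a
    have h2 : HasDerivAt (deriv u₀) (deriv (deriv u₀) a) a :=
      (hd.contDiff_deriv_velocity.differentiable one_ne_zero a).hasDerivAt
    have h3 : HasDerivAt ρ₀ (deriv ρ₀ a) a :=
      (hd.contDiff_density.differentiable one_ne_zero a).hasDerivAt
    exact (h2.add h1).sub (h3.const_mul (k * s))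
  · intro s hs a
    exact ((hX.hasDerivAt_influence hψ hd hs _).comp a (hX.hasDerivAt_space hψ hd s a)).neg

theorem contDiffAt_flowDensity (hψ : IsInfluenceFunction ψ ψM) (hd : IsInitialData ρ₀ u₀)
    (hX : IsLagrangianFlow k ψ ρ₀ u₀ X V) {t : ℝ} (ht : t ∈ regularTimes k ψ ρ₀ u₀ X) (x : ℝ) :
    ContDiffAt ℝ 1 (uncurry (flowDensity k ψ ρ₀ u₀ X)) (t, x) := by
  have hO : regularTimes k ψ ρ₀ u₀ X ×ˢ (univ : Set ℝ) ∈ 𝓝 (t, flowInverse X t x) :=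
    ((hX.isOpen_regularTimes hψ hd).prod isOpen_univ).mem_nhds ⟨ht, mem_univ _⟩
  have h1 : ContDiffAt ℝ 1 (fun p => ρ₀ (uncurry (flowInverse X) p)) (t, x) :=
    hd.contDiff_density.contDiffAt.comp _ (hX.contDiffAt_flowInverse hψ hd ht x)
  have h2 : ContDiffAt ℝ 1
      (fun p : ℝ × ℝ => flowJacobian k ψ ρ₀ u₀ X p.1 (flowInverse X p.1 p.2)) (t, x) :=
    ContDiffAt.comp (g := uncurry (flowJacobian k ψ ρ₀ u₀ X))
      (f := fun p : ℝ × ℝ => (p.1, flowInverse X p.1 p.2)) (t, x)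
      ((hX.contDiffOn_jacobian hψ hd).contDiffAt hO) (hX.contDiffAt_label hψ hd ht x)
  exact h1.div h2 (pos_of_mem_goodTimes ht _).ne'

theorem flowVelocity_apply (hψ : IsInfluenceFunction ψ ψM) (hd : IsInitialData ρ₀ u₀)
    (hX : IsLagrangianFlow k ψ ρ₀ u₀ X V) {t : ℝ} (ht : t ∈ regularTimes k ψ ρ₀ u₀ X) (a : ℝ) :
    flowVelocity X V t (X t a) = V t a := by
  rw [flowVelocity, hX.inverse_apply hψ hd ht]

theorem deriv_flowVelocity_mul_jacobian (hψ : IsInfluenceFunction ψ ψM) (hd : IsInitialData ρ₀ u₀)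
    (hX : IsLagrangianFlow k ψ ρ₀ u₀ X V) {t : ℝ} (ht : t ∈ regularTimes k ψ ρ₀ u₀ X) (a : ℝ) :
    deriv (flowVelocity X V t) (X t a) * flowJacobian k ψ ρ₀ u₀ X t a =
      flowJacobianRate k ψ ρ₀ u₀ X t a := by
  have h1 := (differentiableAt_slice ((hX.contDiffAt_flowVelocity hψ hd ht
    (X t a)).differentiableAt one_ne_zero)).hasDerivAt.comp a (hX.hasDerivAt_space hψ hd t a)
  have h2 := hX.hasDerivAt_velocity_space hψ hd t a
  exact (h1.congr_of_eventuallyEq (f₁ := V t) (Eventually.of_forall fun b =>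
    (hX.flowVelocity_apply hψ hd ht b).symm)).unique h2

theorem flow_continuity_eq (hψ : IsInfluenceFunction ψ ψM) (hd : IsInitialData ρ₀ u₀)
    (hX : IsLagrangianFlow k ψ ρ₀ u₀ X V) {t : ℝ} (ht : t ∈ regularTimes k ψ ρ₀ u₀ X) (x : ℝ) :
    deriv (fun s => flowDensity k ψ ρ₀ u₀ X s x) t +
      deriv (fun y => flowDensity k ψ ρ₀ u₀ X t y * flowVelocity X V t y) x = 0 := by
  obtain ⟨a, rfl⟩ := hX.surjective hψ hd ht x
  have hρ := (hX.contDiffAt_flowDensity hψ hd ht (X t a)).differentiableAt one_ne_zero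
  have hu := (hX.contDiffAt_flowVelocity hψ hd ht (X t a)).differentiableAt one_ne_zero
  have hJ := pos_of_mem_goodTimes ht a
  have h1 := hasDerivAt_along hρ (hX.hasDerivAt t a)
  have h2 := h1.mul (hX.hasDerivAt_jacobian hψ hd t a)
  have h3 : HasDerivAt (fun _ : ℝ => ρ₀ a) 0 t := hasDerivAt_const t _
  have h4 : (fun _ : ℝ => ρ₀ a) =ᶠ[𝓝 t]
      (fun s => flowDensity k ψ ρ₀ u₀ X s (X s a)) * (fun s => flowJacobian k ψ ρ₀ u₀ X s a) := by
    filter_upwards [(hX.isOpen_regularTimes hψ hd).mem_nhds ht] with s hs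
    exact (hX.flowDensity_mul_jacobian hψ hd hs a).symm
  have h5 := (h2.congr_of_eventuallyEq h4).unique h3
  have h6 := hX.deriv_flowVelocity_mul_jacobian hψ hd ht a
  rw [deriv_fun_mul (differentiableAt_slice hρ) (differentiableAt_slice hu),
    hX.flowVelocity_apply hψ hd ht]
  apply mul_right_cancel₀ hJ.ne'
  linear_combination h5 + flowDensity k ψ ρ₀ u₀ X t (X t a) * h6

theorem flow_momentum_eq (hψ : IsInfluenceFunction ψ ψM) (hd : IsInitialData ρ₀ u₀)
    (hX : IsLagrangianFlow k ψ ρ₀ u₀ X V) {t : ℝ} (ht : t ∈ regularTimes k ψ ρ₀ u₀ X) (x : ℝ) :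
    deriv (fun s => flowVelocity X V s x) t +
      flowVelocity X V t x * deriv (flowVelocity X V t) x =
    (∫ y, ψ (x - y) * (flowVelocity X V t y - flowVelocity X V t x) * flowDensity k ψ ρ₀ u₀ X t y) -
      conv (deriv (newtonianPotential k)) (flowDensity k ψ ρ₀ u₀ X t) x := by
  obtain ⟨a, rfl⟩ := hX.surjective hψ hd ht x
  have hu := (hX.contDiffAt_flowVelocity hψ hd ht (X t a)).differentiableAt one_ne_zero
  have h1 := hasDerivAt_along hu (hX.hasDerivAt t a)
  have h2 : (fun s => V s a) =ᶠ[𝓝 t] fun s => flowVelocity X V s (X s a) := by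
    filter_upwards [(hX.isOpen_regularTimes hψ hd).mem_nhds ht] with s hs
    exact (hX.flowVelocity_apply hψ hd hs a).symm
  have h3 := (h1.congr_of_eventuallyEq h2).unique (hX.hasDerivAt_velocity_time hψ hd t a)
  rw [hX.flowVelocity_apply hψ hd ht, h3, flowAcceleration, conv,
    hX.integral_mul_flowDensity_eq hψ hd ht fun y => deriv (newtonianPotential k) (X t a - y),
    hX.integral_mul_flowDensity_eq hψ hd ht fun y => ψ (X t a - y) * (flowVelocity X V t y - V t a),
    integral_deriv_newtonianPotential hd (hX.strictMono hψ hd ht), hd.integral_densityMeasure]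
  simp only [hX.flowVelocity_apply hψ hd ht]

theorem isClassicalSolution (hψ : IsInfluenceFunction ψ ψM) (hd : IsInitialData ρ₀ u₀)
    (hX : IsLagrangianFlow k ψ ρ₀ u₀ X V) {I : Set ℝ} (hI : I ⊆ regularTimes k ψ ρ₀ u₀ X)
    (hI0 : I ⊆ Ici 0) :
    IsClassicalSolution k ψ ρ₀ u₀ I (flowDensity k ψ ρ₀ u₀ X) (flowVelocity X V) := by
  have h0 : (0 : ℝ) ∈ regularTimes k ψ ρ₀ u₀ X := zero_mem_regularTimes
  have hinv0 : ∀ x, flowInverse X 0 x = x := fun x => by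
    have := hX.inverse_apply hψ hd h0 x
    rwa [hX.initial] at this
  obtain ⟨φ, hφ, hφV⟩ := hX.exists_abs_velocity_le hψ hd
  have hw := hd.integrable_velocityWeight
  have hVi : ∀ t, Integrable (V t) (densityMeasure ρ₀) := fun t =>
    integrable_of_le_mul (hX.continuous_velocity_slice hψ hd t) hw (hφV t)
  refine ⟨?_, ?_, ?_, ?_, ?_, ?_, ?_, ?_, ?_, ?_, ?_⟩
  · rintro ⟨t, x⟩ ⟨ht, -⟩
    exact (hX.contDiffAt_flowDensity hψ hd (hI ht) x).contDiffWithinAt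
  · rintro ⟨t, x⟩ ⟨ht, -⟩
    exact (hX.contDiffAt_flowVelocity hψ hd (hI ht) x).contDiffWithinAt
  · intro x
    rw [flowDensity, hinv0, jacobian_zero, div_one]
  · intro x
    have hw0 := hX.velocity_eq 0 x
    have : alignmentDrift ψ ρ₀ (X 0) x = 0 := by
      rw [show X 0 = fun a => a from funext hX.initial, alignmentDrift_id, Pi.zero_apply]
    rw [flowVelocity, hinv0, hw0, this]
    ring
  · exact fun t ht x => flowDensity_nonneg hd (hI ht) x
  · exact fun t ht => hX.integrable_flowDensity hψ hd (hI ht)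
  · exact fun t ht => hX.integral_flowDensity hψ hd (hI ht)
  · intro t ht
    have := (hX.integrable_mul_flowDensity_iff hψ hd (hI ht) (flowVelocity X V t)).2 (by
      simp only [hX.flowVelocity_apply hψ hd (hI ht)]
      exact hd.integrable_densityMeasure_iff.1 (hVi t))
    simpa only [mul_comm] using this
  · intro t ht
    have ht0 : 0 ≤ t := hI0 ht
    obtain ⟨c, hc, hcJ⟩ := hI ht
    obtain ⟨R, hR0, hR⟩ := hd.exists_density_le
    obtain ⟨C, hC0, hC⟩ := hX.exists_abs_jacobian_le hψ hd t
    obtain ⟨B, hB⟩ := (isCompact_Icc (a := 0) (b := t)).exists_bound_of_continuousOn hφ.continuousOn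
    set I₁ := ∫ b, velocityWeight u₀ b ∂densityMeasure ρ₀ with hI₁
    have hI₁0 : 0 ≤ I₁ := integral_nonneg fun b => (velocityWeight_pos u₀ b).le
    refine ⟨max (R / c) (max (C / c) (B * I₁)), fun s hs => ⟨fun x => ?_, fun x => ?_, ?_⟩⟩
    all_goals
      have hs' : s ∈ uIcc 0 t := by rwa [uIcc_of_le ht0]
      have hsO : s ∈ regularTimes k ψ ρ₀ u₀ X := starShapedTimes_goodTimes _ t (hI ht) hs'
    · refine le_trans ?_ (le_max_left _ _)
      rw [flowDensity]
      exact div_le_div₀ hR0.le (hR _) hc (hcJ s hs' _)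
    · refine le_trans ?_ ((le_max_left _ _).trans (le_max_right _ _))
      obtain ⟨a, rfl⟩ := hX.surjective hψ hd hsO x
      have hJ := hcJ s hs' a
      rw [eq_div_of_mul_eq (pos_of_mem_goodTimes hsO a).ne'
        (hX.deriv_flowVelocity_mul_jacobian hψ hd hsO a), abs_div, abs_of_pos (hc.trans_le hJ)]
      exact div_le_div₀ hC0 (hC s (by rw [abs_of_nonneg hs.1]; exact hs.2) a).2 hc hJ
    · refine le_trans ?_ ((le_max_right _ _).trans (le_max_right _ _))
      have e : ∫ x, |flowDensity k ψ ρ₀ u₀ X s x * flowVelocity X V s x| =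
          ∫ a, |V s a| ∂densityMeasure ρ₀ := by
        rw [hd.integral_densityMeasure]
        have := hX.integral_mul_flowDensity_eq hψ hd hsO fun y => |flowVelocity X V s y|
        simp only [hX.flowVelocity_apply hψ hd hsO] at this
        rw [← this]
        congr 1
        funext x
        rw [abs_mul, abs_of_nonneg (flowDensity_nonneg hd hsO x), mul_comm]
      rw [e, ← integral_const_mul]
      refine integral_mono (hVi s).abs (hw.const_mul B) fun a => (hφV s a).trans ?_
      exact mul_le_mul_of_nonneg_right ((le_abs_self _).trans (hB s hs)) (velocityWeight_pos u₀ a).le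
  · exact fun t ht _ x => hX.flow_continuity_eq hψ hd (hI ht) x
  · exact fun t ht _ x => hX.flow_momentum_eq hψ hd (hI ht) x

end IsLagrangianFlow

/-! ### The flow of a classical solution -/

theorem hasDerivAt_slice_of_contDiffOn {F : ℝ → ℝ → ℝ} {T : ℝ}
    (hF : ContDiffOn ℝ 1 (uncurry F) (Ico 0 T ×ˢ univ)) :
    (∀ t ∈ Ico 0 T, ∀ x, HasDerivAt (F t) (deriv (F t) x) x) ∧
      ContinuousOn (fun p : ℝ × ℝ => deriv (F p.1) p.2) (Ico 0 T ×ˢ univ) := by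
  have key : ∀ t ∈ Ico 0 T, ∀ x, HasDerivAt (F t)
      (fderivWithin ℝ (uncurry F) (Ico 0 T ×ˢ univ) (t, x) (0, 1)) x := by
    intro t ht x
    have h1 := (hF.differentiableOn one_ne_zero (t, x) ⟨ht, mem_univ _⟩).hasFDerivWithinAt
    have h2 : HasDerivWithinAt (fun x : ℝ => (t, x)) ((0 : ℝ), (1 : ℝ)) univ x :=
      ((hasDerivAt_const x t).prodMk (hasDerivAt_id x)).hasDerivWithinAt
    have := h1.comp_hasDerivWithinAt x h2 fun y _ => (⟨ht, mem_univ _⟩ : (t, y) ∈ Ico 0 T ×ˢ univ)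
    exact hasDerivWithinAt_univ.1 this
  refine ⟨fun t ht x => (key t ht x).differentiableAt.hasDerivAt, ?_⟩
  have hc : ContinuousOn (fun p => fderivWithin ℝ (uncurry F) (Ico 0 T ×ˢ univ) p (0, 1))
      (Ico 0 T ×ˢ univ) :=
    (hF.continuousOn_fderivWithin ((uniqueDiffOn_Ico 0 T).prod uniqueDiffOn_univ)
      le_rfl).clm_apply continuousOn_const
  exact hc.congr fun p hp => (key p.1 hp.1 p.2).deriv

theorem differentiableAt_of_contDiffOn {F : ℝ → ℝ → ℝ} {T t : ℝ}
    (hF : ContDiffOn ℝ 1 (uncurry F) (Ico 0 T ×ˢ univ)) (ht : t ∈ Ioo 0 T) (x : ℝ) :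
    DifferentiableAt ℝ (uncurry F) (t, x) := by
  refine (hF.contDiffAt ?_).differentiableAt one_ne_zero
  exact mem_of_superset ((isOpen_Ioo.prod isOpen_univ).mem_nhds ⟨ht, mem_univ _⟩)
    (prod_mono Ioo_subset_Ico_self Subset.rfl)

/-- `Y` is the flow on `[0, τ]` of the velocity field `u`, and `J` is its Jacobian. -/
structure IsVelocityFlow (u : ℝ → ℝ → ℝ) (τ : ℝ) (Y J : ℝ → ℝ → ℝ) : Prop where
  initial : ∀ a, Y 0 a = a
  continuous : Continuous (uncurry Y)
  hasDerivAt_time : ∀ t ∈ Icc 0 τ, ∀ a, HasDerivAt (fun s => Y s a) (u t (Y t a)) t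
  hasDerivAt_space : ∀ t a, HasDerivAt (Y t) (J t a) a
  jacobian_pos : ∀ t a, 0 < J t a
  jacobian_initial : ∀ a, J 0 a = 1
  hasDerivAt_jacobian : ∀ t ∈ Icc 0 τ, ∀ a,
    HasDerivAt (fun s => J s a) (deriv (u t) (Y t a) * J t a) t
  surjective : ∀ t, Function.Surjective (Y t)

theorem exists_isVelocityFlow {u : ℝ → ℝ → ℝ} {T τ C : ℝ}
    (hu : ContDiffOn ℝ 1 (uncurry u) (Ico 0 T ×ˢ univ)) (hτ0 : 0 ≤ τ) (hτ : τ < T)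
    (hC : ∀ s ∈ Icc 0 τ, ∀ x, |deriv (u s) x| ≤ C) : ∃ Y J, IsVelocityFlow u τ Y J := by
  obtain ⟨hd, hdc⟩ := hasDerivAt_slice_of_contDiffOn hu
  let pr : ℝ → ℝ := fun t => projIcc 0 τ hτ0 t
  have hpr : Continuous pr := continuous_subtype_val.comp continuous_projIcc
  have hprI : ∀ t, pr t ∈ Icc 0 τ := fun t => (projIcc 0 τ hτ0 t).2
  have hprT : ∀ t, pr t ∈ Ico 0 T := fun t => ⟨(hprI t).1, (hprI t).2.trans_lt hτ⟩
  have hpr_eq : ∀ t ∈ Icc 0 τ, pr t = t := fun t ht => by simp only [pr, projIcc_of_mem hτ0 ht]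
  let v : ℝ → ℝ → ℝ := fun t x => u (pr t) x
  let vx : ℝ → ℝ → ℝ := fun t x => deriv (u (pr t)) x
  have hmap : Continuous fun p : ℝ × ℝ => (pr p.1, p.2) := by fun_prop
  have hv : Continuous (uncurry v) :=
    hu.continuousOn.comp_continuous hmap fun p => ⟨hprT p.1, mem_univ _⟩
  have hvx : Continuous (uncurry vx) :=
    hdc.comp_continuous hmap fun p => ⟨hprT p.1, mem_univ _⟩
  have hvd : ∀ t y, HasDerivAt (v t) (vx t y) y := fun t y => hd (pr t) (hprT t) y
  have hvC : ∀ t y, |vx t y| ≤ C := fun t y => hC (pr t) (hprI t) y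
  have hC0 : 0 ≤ C := (abs_nonneg _).trans (hvC 0 0)
  obtain ⟨B, hB⟩ := (isCompact_Icc (a := 0) (b := τ)).exists_bound_of_continuousOn
    (f := fun s => u s 0) (hu.continuousOn.comp (f := fun s => (s, (0 : ℝ))) (by fun_prop)
      fun s hs => ⟨⟨hs.1, hs.2.trans_lt hτ⟩, mem_univ _⟩)
  have hex := fun a => exists_forall_hasDerivAt_of_lipschitzWith (f := v) (K := C.toNNReal) (C := |B|)
    (fun t => by
      refine lipschitzWith_of_nnnorm_deriv_le (fun y => (hvd t y).differentiableAt) fun y => ?_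
      rw [(hvd t y).deriv, ← NNReal.coe_le_coe, coe_nnnorm, Real.coe_toNNReal _ hC0]
      exact hvC t y)
    (fun x => hv.comp (by fun_prop : Continuous fun t : ℝ => (t, x)))
    (fun t => by
      have h1 := (hB (pr t) (hprI t)).trans (le_abs_self B)
      have h2 := Real.one_le_exp (abs_nonneg t)
      exact h1.trans (le_mul_of_one_le_right (abs_nonneg B) h2)) a
  choose y hy0 hy using hex
  let Y : ℝ → ℝ → ℝ := fun t a => y a t
  have hyc : ∀ a, Continuous (y a) := fun a =>
    continuous_iff_continuousAt.2 fun t => (hy a t).continuousAt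
  have hint : ∀ {β : ℝ → ℝ}, (∀ s, |β s| ≤ C) → ∀ t, |∫ s in (0 : ℝ)..t, β s| ≤ C * |t| := by
    intro β hβ t
    have := intervalIntegral.norm_integral_le_of_norm_le_const (a := 0) (b := t) (C := C) (f := β)
      fun s _ => hβ s
    simpa using this
  have hlip : ∀ t a a', |Y t a' - Y t a| ≤ |a' - a| * Real.exp (C * |t|) := by
    intro t a a'
    let β : ℝ → ℝ := fun s => ∫ θ in (0 : ℝ)..1, vx s (y a s + θ * (y a' s - y a s))
    have hβ : Continuous β := by
      have := hyc a
      have := hyc a'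
      refine intervalIntegral.continuous_parametric_intervalIntegral_of_continuous'
        (f := fun s θ => vx s (y a s + θ * (y a' s - y a s))) ?_ 0 1
      exact hvx.comp (by fun_prop : Continuous fun q : ℝ × ℝ =>
        (q.1, y a q.1 + q.2 * (y a' q.1 - y a q.1)))
    have hβC : ∀ s, |β s| ≤ C := fun s => by
      have := intervalIntegral.norm_integral_le_of_norm_le_const (a := 0) (b := 1) (C := C)
        (f := fun θ => vx s (y a s + θ * (y a' s - y a s))) fun θ _ => hvC _ _
      simpa using this
    have h := eq_linearSolution (α := fun _ => 0) (y := fun t => y a' t - y a t) continuous_const hβ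
      (fun s => by
        refine ((hy a' s).sub (hy a s)).congr_deriv ?_
        rw [sub_eq_mul_integral_segment (hvd s)
          (hvx.comp (by fun_prop : Continuous fun y => (s, y))) (y a s) (y a' s), zero_add, mul_comm]) t
    simp only [linearSolution, zero_mul, intervalIntegral.integral_zero, add_zero, hy0] at h
    simp only [Y]
    rw [h, abs_mul, Real.abs_exp, mul_comm]
    gcongr
    exact (le_abs_self _).trans (hint hβC t)
  have hYc : Continuous (uncurry Y) := by
    refine continuous_iff_continuousAt.2 ?_
    rintro ⟨t₀, a₀⟩
    rw [ContinuousAt, tendsto_iff_dist_tendsto_zero]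
    have hlim : Tendsto (fun p : ℝ × ℝ => |p.2 - a₀| * Real.exp (C * |p.1|) + |y a₀ p.1 - y a₀ t₀|)
        (𝓝 (t₀, a₀)) (𝓝 0) := by
      have : Continuous fun p : ℝ × ℝ =>
          |p.2 - a₀| * Real.exp (C * |p.1|) + |y a₀ p.1 - y a₀ t₀| := by
        have := hyc a₀
        fun_prop
      simpa using this.tendsto (t₀, a₀)
    refine squeeze_zero (fun _ => dist_nonneg) (fun p => ?_) hlim
    have h1 := hlip p.1 a₀ p.2
    have h2 := abs_add_le (Y p.1 p.2 - Y p.1 a₀) (Y p.1 a₀ - Y t₀ a₀)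
    rw [sub_add_sub_cancel] at h2
    rw [Real.dist_eq]
    exact h2.trans (add_le_add_left h1 _)
  have hsp := hasDerivAt_flow (X := Y) (W := fun _ _ => 0) (Wa := fun _ _ => 0) (v := v) (vy := vx)
    hYc hy0 (fun t a => (hy a t).congr_deriv (zero_add _).symm) (fun t a => hasDerivAt_const a _)
    continuous_const hvd hvx
  let J : ℝ → ℝ → ℝ := fun t a => Real.exp (∫ s in (0 : ℝ)..t, vx s (Y s a))
  have hJ : ∀ t a, HasDerivAt (Y t) (J t a) a := fun t a => by
    have := hsp t a
    simpa [linearSolution] using this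
  refine ⟨Y, J, hy0, hYc, fun t ht a => ?_, hJ, fun t a => Real.exp_pos _, fun a => by simp [J],
    fun t ht a => ?_, fun t => ?_⟩
  · have := hy a t
    simp only [v, hpr_eq t ht] at this
    exact this
  · have hc : Continuous fun s => vx s (Y s a) :=
      hvx.comp (continuous_id.prodMk (hyc a))
    refine (hasDerivAt_primitive hc t).exp.congr_deriv ?_
    simp only [vx, hpr_eq t ht, J]
    ring
  · refine surjective_of_le_deriv (hJ t) (Real.exp_pos (-(C * |t|))) fun a => ?_
    exact Real.exp_le_exp.2 (neg_le_of_abs_le (hint (fun s => hvC _ _) t))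

namespace IsVelocityFlow
variable {k ψM T τ : ℝ} {ψ ρ₀ u₀ : ℝ → ℝ} {ρ u Y J : ℝ → ℝ → ℝ}

theorem strictMono (hY : IsVelocityFlow u τ Y J) (t : ℝ) : StrictMono (Y t) :=
  strictMono_of_deriv_pos fun a => by
    rw [(hY.hasDerivAt_space t a).deriv]
    exact hY.jacobian_pos t a

theorem continuous_slice (hY : IsVelocityFlow u τ Y J) (t : ℝ) : Continuous (Y t) :=
  hY.continuous.comp (by fun_prop : Continuous fun a => (t, a))

theorem continuousOn_along {F : ℝ → ℝ → ℝ} (hF : ContinuousOn (uncurry F) (Ico 0 T ×ˢ univ))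
    (hτ : τ < T) (hY : IsVelocityFlow u τ Y J) (a : ℝ) :
    ContinuousOn (fun s => F s (Y s a)) (Icc 0 τ) :=
  hF.comp (f := fun s => (s, Y s a))
    (continuous_id.prodMk (hY.continuous.comp (by fun_prop : Continuous fun s : ℝ => (s, a)))).continuousOn
    fun _ hs => ⟨⟨hs.1, hs.2.trans_lt hτ⟩, mem_univ _⟩

theorem density_mul_jacobian (hs : IsClassicalSolution k ψ ρ₀ u₀ (Ico 0 T) ρ u) (hτ : τ < T)
    (hY : IsVelocityFlow u τ Y J) {t : ℝ} (ht : t ∈ Icc 0 τ) (a : ℝ) :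
    ρ t (Y t a) * J t a = ρ₀ a := by
  have hcont : ContinuousOn (fun s => ρ s (Y s a) * J s a) (Icc 0 t) := by
    refine ((continuousOn_along hs.contDiff_density.continuousOn hτ hY a).mul fun s hs' =>
      (hY.hasDerivAt_jacobian s hs' a).continuousAt.continuousWithinAt).mono
      (Icc_subset_Icc_right ht.2)
  have hder : ∀ s ∈ Ioo 0 t, HasDerivAt (fun s => ρ s (Y s a) * J s a) 0 s := by
    intro s hs'
    have hsτ : s ∈ Icc 0 τ := ⟨hs'.1.le, hs'.2.le.trans ht.2⟩
    have hsT : s ∈ Ioo 0 T := ⟨hs'.1, hsτ.2.trans_lt hτ⟩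
    have hρ := differentiableAt_of_contDiffOn hs.contDiff_density hsT (Y s a)
    have hu := differentiableAt_of_contDiffOn hs.contDiff_velocity hsT (Y s a)
    have h1 := (hasDerivAt_along hρ (hY.hasDerivAt_time s hsτ a)).mul (hY.hasDerivAt_jacobian s hsτ a)
    refine h1.congr_deriv ?_
    have h2 := hs.continuity_eq s ⟨hsT.1.le, hsT.2⟩ hsT.1 (Y s a)
    rw [deriv_fun_mul (differentiableAt_slice hρ) (differentiableAt_slice hu)] at h2
    linear_combination J s a * h2
  rcases ht.1.eq_or_lt with h0 | h0
  · rw [← h0, hY.initial, hY.jacobian_initial, mul_one, hs.initial_density]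
  · have := intervalIntegral.integral_eq_sub_of_hasDerivAt_of_le h0.le hcont hder
      (by simp : IntervalIntegrable (fun _ => (0 : ℝ)) volume 0 t)
    rw [intervalIntegral.integral_zero, hY.initial, hY.jacobian_initial, mul_one,
      hs.initial_density] at this
    linarith

theorem integral_mul_density (hs : IsClassicalSolution k ψ ρ₀ u₀ (Ico 0 T) ρ u)
    (hd : IsInitialData ρ₀ u₀) (hτ : τ < T) (hY : IsVelocityFlow u τ Y J) {t : ℝ} (ht : t ∈ Icc 0 τ)
    (g : ℝ → ℝ) : ∫ y, g y * ρ t y = ∫ a, g (Y t a) ∂densityMeasure ρ₀ := by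
  rw [hd.integral_densityMeasure]
  exact integral_mul_density_eq (hY.hasDerivAt_space t) (hY.jacobian_pos t) (hY.surjective t)
    (density_mul_jacobian hs hτ hY ht) g

theorem integrable_velocity (hs : IsClassicalSolution k ψ ρ₀ u₀ (Ico 0 T) ρ u)
    (hd : IsInitialData ρ₀ u₀) (hτ : τ < T) (hY : IsVelocityFlow u τ Y J) {t : ℝ} (ht : t ∈ Icc 0 τ) :
    Integrable (fun a => u t (Y t a)) (densityMeasure ρ₀) := by
  rw [hd.integrable_densityMeasure_iff]
  refine (integrable_mul_density_iff (hY.hasDerivAt_space t) (hY.jacobian_pos t) (hY.surjective t)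
    (density_mul_jacobian hs hτ hY ht) (u t)).1 ?_
  simpa only [mul_comm] using hs.momentum_integrable t ⟨ht.1, ht.2.trans_lt hτ⟩

theorem exists_integral_abs_velocity_le (hs : IsClassicalSolution k ψ ρ₀ u₀ (Ico 0 T) ρ u)
    (hd : IsInitialData ρ₀ u₀) (hτ0 : 0 ≤ τ) (hτ : τ < T) (hY : IsVelocityFlow u τ Y J) :
    ∃ M, ∀ t ∈ Icc 0 τ, ∫ a, |u t (Y t a)| ∂densityMeasure ρ₀ ≤ M := by
  obtain ⟨C, hC⟩ := hs.locally_bounded τ ⟨hτ0, hτ⟩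
  refine ⟨C, fun t ht => le_trans (le_of_eq ?_) (hC t ht).2.2⟩
  rw [← integral_mul_density hs hd hτ hY ht fun y => |u t y|]
  congr 1
  funext y
  rw [abs_mul, abs_of_nonneg (hs.density_nonneg t ⟨ht.1, ht.2.trans_lt hτ⟩ y), mul_comm]

theorem hasDerivAt_velocity (hs : IsClassicalSolution k ψ ρ₀ u₀ (Ico 0 T) ρ u)
    (hd : IsInitialData ρ₀ u₀) (hτ : τ < T) (hY : IsVelocityFlow u τ Y J) {t : ℝ} (ht : t ∈ Ioo 0 τ)
    (a : ℝ) :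
    HasDerivAt (fun s => u s (Y s a))
      ((∫ b, ψ (Y t a - Y t b) * (u t (Y t b) - u t (Y t a)) ∂densityMeasure ρ₀) -
        k * centredMass ρ₀ a) t := by
  have htτ : t ∈ Icc 0 τ := ⟨ht.1.le, ht.2.le⟩
  have htT : t ∈ Ioo 0 T := ⟨ht.1, ht.2.trans hτ⟩
  have hu := differentiableAt_of_contDiffOn hs.contDiff_velocity htT (Y t a)
  refine (hasDerivAt_along hu (hY.hasDerivAt_time t htτ a)).congr_deriv ?_
  rw [hs.momentum_eq t ⟨htT.1.le, htT.2⟩ htT.1,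
    integral_mul_density hs hd hτ hY htτ fun y => ψ (Y t a - y) * (u t y - u t (Y t a)), conv,
    integral_mul_density hs hd hτ hY htτ fun y => deriv (newtonianPotential k) (Y t a - y),
    hd.integral_densityMeasure (fun b => deriv (newtonianPotential k) (Y t a - Y t b)),
    integral_deriv_newtonianPotential hd (hY.strictMono t)]

theorem exists_abs_velocity_le (hψ : IsInfluenceFunction ψ ψM)
    (hs : IsClassicalSolution k ψ ρ₀ u₀ (Ico 0 T) ρ u)
    (hd : IsInitialData ρ₀ u₀) (hτ0 : 0 ≤ τ) (hτ : τ < T) (hY : IsVelocityFlow u τ Y J) :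
    ∃ B, ∀ t ∈ Icc 0 τ, ∀ a, |u t (Y t a)| ≤ B * velocityWeight u₀ a := by
  have := hd.isProbabilityMeasure
  obtain ⟨M₀, hM₀⟩ := exists_integral_abs_velocity_le hs hd hτ0 hτ hY
  have hM₀0 : 0 ≤ M₀ := (integral_nonneg fun _ => abs_nonneg _).trans (hM₀ 0 ⟨le_rfl, hτ0⟩)
  have hψ0 := hψ.bound_pos
  set M := ψM * M₀ + |k| with hM
  have hM0 : 0 ≤ M := by positivity
  set l := 2 * ψM + M with hl
  have hl0 : 0 ≤ l := by positivity
  have hacc : ∀ t ∈ Ioo 0 τ, ∀ a,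
      |(∫ b, ψ (Y t a - Y t b) * (u t (Y t b) - u t (Y t a)) ∂densityMeasure ρ₀) -
        k * centredMass ρ₀ a| ≤ ψM * |u t (Y t a)| + M := by
    intro t ht a
    have htτ : t ∈ Icc 0 τ := ⟨ht.1.le, ht.2.le⟩
    have hi := integrable_velocity hs hd hτ hY htτ
    have h1 : |∫ b, ψ (Y t a - Y t b) * (u t (Y t b) - u t (Y t a)) ∂densityMeasure ρ₀| ≤
        ψM * (M₀ + |u t (Y t a)|) := by
      have hib : Integrable (fun b => ψM * (|u t (Y t b)| + |u t (Y t a)|)) (densityMeasure ρ₀) :=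
        (hi.abs.add (integrable_const _)).const_mul _
      rw [← Real.norm_eq_abs]
      refine (norm_integral_le_of_norm_le hib (Eventually.of_forall fun b => ?_)).trans ?_
      · rw [norm_mul]
        exact mul_le_mul (hψ.abs_le _) (abs_sub _ _) (norm_nonneg _) hψ0.le
      · rw [integral_const_mul, integral_add hi.abs (integrable_const _), integral_const,
          probReal_univ, one_smul]
        have := hM₀ t htτ
        gcongr
    have h2 : |k * centredMass ρ₀ a| ≤ |k| := by
      rw [abs_mul]
      exact mul_le_of_le_one_right (abs_nonneg k) (hd.abs_centredMass_le a)
    have := abs_sub (∫ b, ψ (Y t a - Y t b) * (u t (Y t b) - u t (Y t a)) ∂densityMeasure ρ₀)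
      (k * centredMass ρ₀ a)
    linarith
  refine ⟨Real.exp (l * τ), fun t ht a => ?_⟩
  let z : ℝ → ℝ := fun s => (u s (Y s a) ^ 2 + 1) * Real.exp (-(l * s))
  have hz : AntitoneOn z (Icc 0 τ) := by
    have hc := continuousOn_along hs.contDiff_velocity.continuousOn hτ hY a
    have hzd : ∀ s ∈ Ioo 0 τ, HasDerivAt z ((2 * u s (Y s a) *
        ((∫ b, ψ (Y s a - Y s b) * (u s (Y s b) - u s (Y s a)) ∂densityMeasure ρ₀) -
        k * centredMass ρ₀ a) - l * (u s (Y s a) ^ 2 + 1)) * Real.exp (-(l * s))) s := by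
      intro s hs'
      have h1 := (((hasDerivAt_velocity hs hd hτ hY hs' a).pow 2).add_const 1).mul
        ((hasDerivAt_id s).const_mul l).neg.exp
      refine h1.congr_deriv ?_
      simp only [Pi.pow_apply, Pi.neg_apply, id]
      push_cast
      ring
    refine antitoneOn_of_deriv_nonpos (convex_Icc _ _) ?_ ?_ ?_
    · exact ((hc.pow 2).add continuousOn_const).mul (by fun_prop)
    · rw [interior_Icc]
      exact fun s hs' => (hzd s hs').differentiableAt.differentiableWithinAt
    · rw [interior_Icc]
      intro s hs'
      rw [(hzd s hs').deriv]
      refine mul_nonpos_of_nonpos_of_nonneg ?_ (Real.exp_pos _).le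
      have h1 := hacc s hs' a
      set A := (∫ b, ψ (Y s a - Y s b) * (u s (Y s b) - u s (Y s a)) ∂densityMeasure ρ₀) -
        k * centredMass ρ₀ a
      set U := u s (Y s a)
      have h2 : U * A ≤ |U| * (ψM * |U| + M) := by
        calc U * A ≤ |U * A| := le_abs_self _
          _ = |U| * |A| := abs_mul _ _
          _ ≤ _ := by gcongr
      have h3 : |U| ^ 2 = U ^ 2 := sq_abs U
      nlinarith [sq_nonneg (|U| - 1), mul_nonneg hM0 (sq_nonneg (|U| - 1))]
  have h1 := hz ⟨le_rfl, hτ0⟩ ht ht.1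
  simp only [z, hY.initial, hs.initial_velocity, mul_zero, neg_zero, Real.exp_zero, mul_one] at h1
  have hE : 1 ≤ Real.exp (l * τ) := Real.one_le_exp (by positivity)
  have hE2 : Real.exp (l * t) ≤ Real.exp (l * τ) := Real.exp_le_exp.2 (by gcongr; exact ht.2)
  have h2 : u t (Y t a) ^ 2 + 1 ≤ (u₀ a ^ 2 + 1) * Real.exp (l * τ) := by
    have e : Real.exp (-(l * t)) * Real.exp (l * t) = 1 := by rw [← Real.exp_add]; simp
    calc u t (Y t a) ^ 2 + 1
        = (u t (Y t a) ^ 2 + 1) * Real.exp (-(l * t)) * Real.exp (l * t) := by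
          rw [mul_assoc, e, mul_one]
      _ ≤ (u₀ a ^ 2 + 1) * Real.exp (l * t) := by gcongr
      _ ≤ _ := by gcongr
  have hw : u₀ a ^ 2 + 1 ≤ velocityWeight u₀ a ^ 2 := by
    unfold velocityWeight
    nlinarith [abs_nonneg (u₀ a), sq_abs (u₀ a)]
  refine abs_le_of_sq_le_sq ?_ (mul_nonneg (Real.exp_pos _).le (velocityWeight_pos u₀ a).le)
  calc u t (Y t a) ^ 2 ≤ (u₀ a ^ 2 + 1) * Real.exp (l * τ) := by linarith
    _ ≤ velocityWeight u₀ a ^ 2 * (Real.exp (l * τ) * Real.exp (l * τ)) := by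
        gcongr
        exact le_mul_of_one_le_right (Real.exp_pos _).le hE
    _ = _ := by ring

theorem exists_displacement_le (hψ : IsInfluenceFunction ψ ψM)
    (hs : IsClassicalSolution k ψ ρ₀ u₀ (Ico 0 T) ρ u)
    (hd : IsInitialData ρ₀ u₀) (hτ0 : 0 ≤ τ) (hτ : τ < T) (hY : IsVelocityFlow u τ Y J) :
    ∃ B, ∀ t ∈ Icc 0 τ, ∀ a, |Y t a - a| ≤ B * velocityWeight u₀ a ∧
      |u t (Y t a)| ≤ B * velocityWeight u₀ a := by
  obtain ⟨B, hB⟩ := exists_abs_velocity_le hψ hs hd hτ0 hτ hY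
  have hB0 : 0 ≤ B := nonneg_of_mul_nonneg_left ((abs_nonneg _).trans (hB 0 ⟨le_rfl, hτ0⟩ 0))
    (velocityWeight_pos u₀ 0)
  refine ⟨B + B * τ, fun t ht a => ⟨?_, ?_⟩⟩
  · have h1 := (convex_Icc 0 τ).norm_image_sub_le_of_norm_hasDerivWithin_le
      (fun s hs' => (hY.hasDerivAt_time s hs' a).hasDerivWithinAt) (fun s hs' => hB s hs' a)
      ⟨le_rfl, hτ0⟩ ht
    rw [hY.initial, sub_zero, Real.norm_eq_abs, Real.norm_eq_abs, abs_of_nonneg ht.1] at h1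
    refine h1.trans ?_
    have hw := velocityWeight_pos u₀ a
    calc B * velocityWeight u₀ a * t ≤ B * velocityWeight u₀ a * τ := by
          gcongr; exact ht.2
      _ ≤ _ := by nlinarith [mul_nonneg hB0 hw.le]
  · refine (hB t ht a).trans ?_
    have hw := velocityWeight_pos u₀ a
    gcongr
    exact le_add_of_nonneg_right (by positivity)

theorem velocity_eq (hψ : IsInfluenceFunction ψ ψM)
    (hs : IsClassicalSolution k ψ ρ₀ u₀ (Ico 0 T) ρ u)
    (hd : IsInitialData ρ₀ u₀) (hτ0 : 0 ≤ τ) (hτ : τ < T) (hY : IsVelocityFlow u τ Y J)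
    {t : ℝ} (ht : t ∈ Icc 0 τ) (a : ℝ) :
    u t (Y t a) = u₀ a - k * t * centredMass ρ₀ a + alignmentDrift ψ ρ₀ (Y t) a := by
  obtain ⟨B, hB⟩ := exists_displacement_le hψ hs hd hτ0 hτ hY
  have hB0 : 0 ≤ B := nonneg_of_mul_nonneg_left
    ((abs_nonneg _).trans (hB 0 ⟨le_rfl, hτ0⟩ 0).1) (velocityWeight_pos u₀ 0)
  have hΨ := hψ.continuous_primitive
  have hψc := hψ.continuous
  have hdrift_c : ContinuousOn (fun s => alignmentDrift ψ ρ₀ (Y s) a) (Icc 0 τ) := by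
    let pr : ℝ → ℝ := fun t => projIcc 0 τ hτ0 t
    have hpr : Continuous pr := continuous_subtype_val.comp continuous_projIcc
    have e1 : Continuous fun q : ℝ × ℝ => Y (pr q.1) a :=
      hY.continuous.comp (by fun_prop : Continuous fun q : ℝ × ℝ => (pr q.1, a))
    have e2 : Continuous fun q : ℝ × ℝ => Y (pr q.1) q.2 :=
      hY.continuous.comp (by fun_prop : Continuous fun q : ℝ × ℝ => (pr q.1, q.2))
    have hc : Continuous fun s => alignmentDrift ψ ρ₀ (Y (pr s)) a := by
      refine continuous_integral_of_le_mul (w := velocityWeight u₀)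
        (φ := fun _ => ψM * (B * velocityWeight u₀ a + B))
        (f := fun s b => primitive ψ (a - b) - primitive ψ (Y (pr s) a - Y (pr s) b))
        ((hΨ.comp (by fun_prop : Continuous fun q : ℝ × ℝ => a - q.2)).sub (hΨ.comp (e1.sub e2)))
        hd.integrable_velocityWeight (fun b => (velocityWeight_pos u₀ b).le) continuous_const fun s b => ?_
      have hps : pr s ∈ Icc 0 τ := (projIcc 0 τ hτ0 s).2
      refine (hψ.abs_primitive_sub_le _ _).trans ?_
      rw [mul_assoc]
      refine mul_le_mul_of_nonneg_left ?_ hψ.bound_pos.le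
      have h1 := (hB _ hps a).1
      have h2 := (hB _ hps b).1
      have h3 : |a - b - (Y (pr s) a - Y (pr s) b)| ≤ |Y (pr s) a - a| + |Y (pr s) b - b| := by
        rw [show a - b - (Y (pr s) a - Y (pr s) b) = (Y (pr s) b - b) - (Y (pr s) a - a) by ring,
          add_comm]
        exact abs_sub _ _
      have h4 : 0 ≤ B * velocityWeight u₀ a := (abs_nonneg _).trans h1
      nlinarith [one_le_velocityWeight u₀ b]
    refine hc.continuousOn.congr fun s hs' => ?_
    simp only [pr, projIcc_of_mem hτ0 hs']
  have hdrift_d : ∀ s ∈ Ioo 0 τ, HasDerivAt (fun s => alignmentDrift ψ ρ₀ (Y s) a)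
      (∫ b, ψ (Y s a - Y s b) * (u s (Y s b) - u s (Y s a)) ∂densityMeasure ρ₀) s := by
    intro s hs'
    have hsl := hY.continuous_slice
    have hsT : ∀ {r}, r ∈ Ioo 0 τ → r ∈ Icc 0 τ := fun hr => ⟨hr.1.le, hr.2.le⟩
    refine (hasDerivAt_integral_of_dominated_loc_of_deriv_le
      (bound := fun b => ψM * (B * velocityWeight u₀ a + B) * velocityWeight u₀ b)
      (F := fun s b => primitive ψ (a - b) - primitive ψ (Y s a - Y s b))
      (F' := fun s b => ψ (Y s a - Y s b) * (u s (Y s b) - u s (Y s a)))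
      (isOpen_Ioo.mem_nhds hs') ?_ ?_ ?_ ?_ (hd.integrable_velocityWeight.const_mul _) ?_).2
    · refine Eventually.of_forall fun r => ?_
      have := hsl r
      exact (by fun_prop : Continuous fun b =>
        primitive ψ (a - b) - primitive ψ (Y r a - Y r b)).aestronglyMeasurable
    · exact integrable_alignmentDrift hψ hd (hsl s) (fun b => (hB s (hsT hs') b).1) a
    · have h1 := hsl s
      have h2 : Continuous (u s) := continuous_iff_continuousAt.2 fun x =>
        ((hasDerivAt_slice_of_contDiffOn hs.contDiff_velocity).1 s
          ⟨hs'.1.le, hs'.2.trans hτ⟩ x).continuousAt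
      exact (by fun_prop : Continuous fun b =>
        ψ (Y s a - Y s b) * (u s (Y s b) - u s (Y s a))).aestronglyMeasurable
    · refine Eventually.of_forall fun b r hr => ?_
      rw [norm_mul, mul_assoc]
      refine mul_le_mul (hψ.abs_le _) ?_ (norm_nonneg _) hψ.bound_pos.le
      have h1 := (hB r (hsT hr) a).2
      have h2 := (hB r (hsT hr) b).2
      have h4 : 0 ≤ B * velocityWeight u₀ a := (abs_nonneg _).trans h1
      have := abs_sub (u r (Y r b)) (u r (Y r a))
      rw [Real.norm_eq_abs]
      nlinarith [one_le_velocityWeight u₀ b]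
    · refine Eventually.of_forall fun b r hr => ?_
      have := (hψ.hasDerivAt_primitive (Y r a - Y r b)).comp r
        ((hY.hasDerivAt_time r (hsT hr) a).sub (hY.hasDerivAt_time r (hsT hr) b))
      refine (this.const_sub (primitive ψ (a - b))).congr_deriv ?_
      ring
  rcases ht.1.eq_or_lt with h0 | h0
  · have : alignmentDrift ψ ρ₀ (Y 0) a = 0 := by
      rw [show Y 0 = fun a => a from funext hY.initial, alignmentDrift_id, Pi.zero_apply]
    rw [← h0, hY.initial, this, hs.initial_velocity]
    ring
  · have hcont := ((continuousOn_along hs.contDiff_velocity.continuousOn hτ hY a).sub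
      hdrift_c).add (continuousOn_id.const_mul (k * centredMass ρ₀ a)) |>.mono
      (Icc_subset_Icc_right ht.2)
    have hder : ∀ s ∈ Ioo 0 t, HasDerivAt (fun s => u s (Y s a) - alignmentDrift ψ ρ₀ (Y s) a +
        k * centredMass ρ₀ a * s) 0 s := by
      intro s hs'
      have hsτ : s ∈ Ioo 0 τ := ⟨hs'.1, hs'.2.trans_le ht.2⟩
      refine (((hasDerivAt_velocity hs hd hτ hY hsτ a).sub (hdrift_d s hsτ)).add
        ((hasDerivAt_id s).const_mul (k * centredMass ρ₀ a))).congr_deriv ?_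
      ring
    have := intervalIntegral.integral_eq_sub_of_hasDerivAt_of_le h0.le hcont hder
      (by simp : IntervalIntegrable (fun _ => (0 : ℝ)) volume 0 t)
    have h1 : alignmentDrift ψ ρ₀ (Y 0) a = 0 := by
      rw [show Y 0 = fun a => a from funext hY.initial, alignmentDrift_id, Pi.zero_apply]
    simp only [intervalIntegral.integral_zero, Pi.add_apply, Pi.sub_apply, id, hY.initial,
      h1, hs.initial_velocity] at this
    linarith

theorem eq_lagrangianFlow {X V : ℝ → ℝ → ℝ} (hψ : IsInfluenceFunction ψ ψM)
    (hs : IsClassicalSolution k ψ ρ₀ u₀ (Ico 0 T) ρ u)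
    (hd : IsInitialData ρ₀ u₀) (hX : IsLagrangianFlow k ψ ρ₀ u₀ X V) (hτ0 : 0 ≤ τ) (hτ : τ < T)
    (hY : IsVelocityFlow u τ Y J) {t : ℝ} (ht : t ∈ Icc 0 τ) (a : ℝ) : Y t a = X t a := by
  obtain ⟨B, hB⟩ := exists_displacement_le hψ hs hd hτ0 hτ hY
  obtain ⟨φ, hφ, hφX⟩ := hX.displacement
  obtain ⟨D, hD⟩ := (isCompact_Icc (a := 0) (b := τ)).exists_bound_of_continuousOn hφ.continuousOn
  set I₁ := ∫ b, velocityWeight u₀ b ∂densityMeasure ρ₀ with hI₁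
  have hI₁0 : 0 ≤ I₁ := integral_nonneg fun b => (velocityWeight_pos u₀ b).le
  set K := ψM * (1 + I₁) with hK
  have hK0 : 0 ≤ K := by have := hψ.bound_pos; positivity
  have hXD : ∀ s ∈ Icc 0 τ, ∀ b, |X s b - b| ≤ D * velocityWeight u₀ b := fun s hs' b =>
    (hφX s b).trans (mul_le_mul_of_nonneg_right ((le_abs_self _).trans (hD s hs'))
      (velocityWeight_pos u₀ b).le)
  have step : ∀ M : ℝ, (∀ s ∈ Icc 0 τ, ∀ b,
      |Y s b - X s b| ≤ M * Real.exp (2 * K * s) * velocityWeight u₀ b) →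
      ∀ s ∈ Icc 0 τ, ∀ b, |Y s b - X s b| ≤ M / 2 * Real.exp (2 * K * s) * velocityWeight u₀ b := by
    intro M hM s hs' b
    have hM0 : 0 ≤ M := by
      have h1 := (abs_nonneg _).trans (hM 0 ⟨le_rfl, hτ0⟩ b)
      simp only [mul_zero, Real.exp_zero, mul_one] at h1
      exact nonneg_of_mul_nonneg_left h1 (velocityWeight_pos u₀ b)
    have hder : ∀ r ∈ Icc 0 τ, HasDerivAt (fun r => Y r b - X r b)
        (alignmentDrift ψ ρ₀ (Y r) b - alignmentDrift ψ ρ₀ (X r) b) r := fun r hr => by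
      refine ((hY.hasDerivAt_time r hr b).sub (hX.hasDerivAt r b)).congr_deriv ?_
      rw [velocity_eq hψ hs hd hτ0 hτ hY hr, hX.velocity_eq]
      ring
    have hBd : ∀ r, HasDerivAt (fun r => M / 2 * Real.exp (2 * K * r) * velocityWeight u₀ b)
        (M / 2 * (Real.exp (2 * K * r) * (2 * K)) * velocityWeight u₀ b) r := fun r => by
      have := ((hasDerivAt_id r).const_mul (2 * K)).exp
      simpa using (this.const_mul (M / 2)).mul_const (velocityWeight u₀ b)
    refine image_norm_le_of_norm_deriv_right_le_deriv_boundary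
      (f := fun r => Y r b - X r b) (a := 0) (b := τ)
      (fun r hr => (hder r hr).continuousAt.continuousWithinAt)
      (fun r hr => (hder r ⟨hr.1, hr.2.le⟩).hasDerivWithinAt) ?_ hBd ?_ hs'
    · rw [hY.initial, hX.initial, sub_self, norm_zero]
      have := velocityWeight_pos u₀ b
      positivity
    · intro r hr
      have hr' : r ∈ Icc 0 τ := ⟨hr.1, hr.2.le⟩
      have := abs_alignmentDrift_sub_le hψ hd (hY.continuous_slice r) (fun b => (hB r hr' b).1)
        (hX.continuous_slice r) (hXD r hr') (hM r hr') b
      rw [Real.norm_eq_abs]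
      refine this.trans (le_of_eq ?_)
      ring
  have hM : ∀ n : ℕ, ∀ s ∈ Icc 0 τ, ∀ b,
      |Y s b - X s b| ≤ (B + D) / 2 ^ n * Real.exp (2 * K * s) * velocityWeight u₀ b := by
    intro n
    induction n with
    | zero =>
      intro s hs' b
      have h1 := (hB s hs' b).1
      have h2 := hXD s hs' b
      have h3 := abs_sub (Y s b - b) (X s b - b)
      rw [sub_sub_sub_cancel_right] at h3
      have h4 : 1 ≤ Real.exp (2 * K * s) := Real.one_le_exp (mul_nonneg (by positivity) hs'.1)
      have h5 : 0 ≤ (B + D) * velocityWeight u₀ b := by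
        have := abs_nonneg (Y s b - b)
        have := abs_nonneg (X s b - b)
        linarith
      rw [pow_zero, div_one]
      nlinarith
    | succ n ih =>
      intro s hs' b
      have := step _ ih s hs' b
      rwa [div_div, ← pow_succ] at this
  have hlim : Tendsto (fun n : ℕ => (B + D) / 2 ^ n * Real.exp (2 * K * t) * velocityWeight u₀ a)
      atTop (𝓝 0) := by
    have h1 : Tendsto (fun n : ℕ => (B + D) / (2 : ℝ) ^ n) atTop (𝓝 0) :=
      tendsto_const_nhds.div_atTop (tendsto_pow_atTop_atTop_of_one_lt one_lt_two)
    simpa using (h1.mul_const (Real.exp (2 * K * t))).mul_const (velocityWeight u₀ a)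
  have := ge_of_tendsto' hlim fun n => hM n t ht a
  have := abs_nonpos_iff.1 this
  linarith

end IsVelocityFlow

theorem IsClassicalSolution.velocity_along_flow {k ψM T : ℝ} {ψ ρ₀ u₀ : ℝ → ℝ} {ρ u X V : ℝ → ℝ → ℝ}
    (hψ : IsInfluenceFunction ψ ψM) (hd : IsInitialData ρ₀ u₀)
    (hs : IsClassicalSolution k ψ ρ₀ u₀ (Ico 0 T) ρ u)
    (hX : IsLagrangianFlow k ψ ρ₀ u₀ X V) {t : ℝ} (ht : t ∈ Ico 0 T) (a : ℝ) :
    u t (X t a) = V t a := by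
  obtain ⟨C, hC⟩ := hs.locally_bounded t ht
  obtain ⟨Y, J, hY⟩ := exists_isVelocityFlow hs.contDiff_velocity ht.1 ht.2 fun s hs' => (hC s hs').2.1
  have htt : t ∈ Icc 0 t := ⟨ht.1, le_rfl⟩
  have e : Y t = X t := funext fun a => hY.eq_lagrangianFlow hψ hs hd hX ht.1 ht.2 htt a
  rw [← e, hY.velocity_eq hψ hs hd ht.1 ht.2 htt, hX.velocity_eq, e]

theorem IsClassicalSolution.deriv_velocity_mul_jacobian {k ψM T : ℝ} {ψ ρ₀ u₀ : ℝ → ℝ}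
    {ρ u X V : ℝ → ℝ → ℝ} (hψ : IsInfluenceFunction ψ ψM) (hd : IsInitialData ρ₀ u₀)
    (hs : IsClassicalSolution k ψ ρ₀ u₀ (Ico 0 T) ρ u)
    (hX : IsLagrangianFlow k ψ ρ₀ u₀ X V) {t : ℝ} (ht : t ∈ Ico 0 T) (a : ℝ) :
    deriv (u t) (X t a) * flowJacobian k ψ ρ₀ u₀ X t a = flowJacobianRate k ψ ρ₀ u₀ X t a := by
  have h1 := ((hasDerivAt_slice_of_contDiffOn hs.contDiff_velocity).1 t ht (X t a)).comp a
    (hX.hasDerivAt_space hψ hd t a)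
  exact (h1.congr_of_eventuallyEq (f₁ := V t) (Eventually.of_forall fun b =>
    (hs.velocity_along_flow hψ hd hX ht b).symm)).unique (hX.hasDerivAt_velocity_space hψ hd t a)

namespace IsLagrangianFlow
variable {k ψM : ℝ} {ψ ρ₀ u₀ : ℝ → ℝ} {X V : ℝ → ℝ → ℝ}

theorem slopeSource_eq_add (s t a : ℝ) :
    slopeSource k ψ ρ₀ u₀ s a = slopeSource k ψ ρ₀ u₀ t a + k * (t - s) * ρ₀ a := by
  unfold slopeSource; ring

theorem jacobian_lower_bound (hψ : IsInfluenceFunction ψ ψM) (hd : IsInitialData ρ₀ u₀)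
    (hX : IsLagrangianFlow k ψ ρ₀ u₀ X V) {s t m a : ℝ} (hst : s ≤ t) (hm : 0 ≤ m)
    (hJ : ∀ r ∈ Icc s t, 0 ≤ flowJacobian k ψ ρ₀ u₀ X r a)
    (hg : ∀ r ∈ Icc s t, -m ≤ slopeSource k ψ ρ₀ u₀ r a) :
    flowJacobian k ψ ρ₀ u₀ X s a - m * Real.exp (ψM * (t - s)) * (t - s) ≤
      flowJacobian k ψ ρ₀ u₀ X t a * Real.exp (ψM * (t - s)) := by
  set z : ℝ → ℝ := fun r => flowJacobian k ψ ρ₀ u₀ X r a * Real.exp (ψM * (r - s)) +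
    m * Real.exp (ψM * (t - s)) * (r - s) with hz
  have hzd : ∀ r, HasDerivAt z ((flowJacobianRate k ψ ρ₀ u₀ X r a +
      ψM * flowJacobian k ψ ρ₀ u₀ X r a) * Real.exp (ψM * (r - s)) +
      m * Real.exp (ψM * (t - s))) r := fun r => by
    have h1 := ((hasDerivAt_id r).sub_const s).const_mul ψM
    refine (((hX.hasDerivAt_jacobian hψ hd r a).mul h1.exp).add
      (((hasDerivAt_id r).sub_const s).const_mul (m * Real.exp (ψM * (t - s))))).congr_deriv ?_
    simp only [id]
    ring
  have hmono : MonotoneOn z (Icc s t) := by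
    refine monotoneOn_of_deriv_nonneg (convex_Icc s t)
      (fun r _ => (hzd r).continuousAt.continuousWithinAt)
      (fun r _ => (hzd r).differentiableAt.differentiableWithinAt) fun r hr => ?_
    rw [interior_Icc] at hr
    have hr' : r ∈ Icc s t := Ioo_subset_Icc_self hr
    rw [(hzd r).deriv, flowJacobianRate]
    have h1 := hg r hr'
    have h2 := hJ r hr'
    have h3 := (hX.influence_mem_Icc hψ hd r (X r a)).2
    have h4 : Real.exp (ψM * (r - s)) ≤ Real.exp (ψM * (t - s)) := by
      have := hψ.bound_pos.le
      have := hr.2.le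
      gcongr
    have h5 : -m ≤ slopeSource k ψ ρ₀ u₀ r a -
        influence ψ ρ₀ X r (X r a) * flowJacobian k ψ ρ₀ u₀ X r a +
        ψM * flowJacobian k ψ ρ₀ u₀ X r a := by nlinarith
    have h6 := mul_le_mul_of_nonneg_right h5 (Real.exp_pos (ψM * (r - s))).le
    nlinarith
  have := hmono ⟨le_rfl, hst⟩ ⟨hst, le_rfl⟩ hst
  simp only [hz, sub_self, mul_zero, Real.exp_zero, mul_one, add_zero] at this
  linarith

theorem jacobian_upper_bound (hψ : IsInfluenceFunction ψ ψM) (hd : IsInitialData ρ₀ u₀)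
    (hX : IsLagrangianFlow k ψ ρ₀ u₀ X V) {t : ℝ} (ht0 : 0 ≤ t)
    (ht : t ∈ regularTimes k ψ ρ₀ u₀ X) (a : ℝ) :
    flowJacobian k ψ ρ₀ u₀ X t a ≤
      1 + (deriv u₀ a + conv ψ ρ₀ a) * t - k * ρ₀ a * t ^ 2 / 2 := by
  set z : ℝ → ℝ := fun r => flowJacobian k ψ ρ₀ u₀ X r a -
    ((deriv u₀ a + conv ψ ρ₀ a) * r - k * ρ₀ a / 2 * r ^ 2) with hz
  have hzd : ∀ r, HasDerivAt z (flowJacobianRate k ψ ρ₀ u₀ X r a -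
      slopeSource k ψ ρ₀ u₀ r a) r := fun r => by
    refine ((hX.hasDerivAt_jacobian hψ hd r a).sub
      (((hasDerivAt_id r).const_mul (deriv u₀ a + conv ψ ρ₀ a)).sub
        (((hasDerivAt_id r).pow 2).const_mul (k * ρ₀ a / 2)))).congr_deriv ?_
    simp only [id, slopeSource]
    push_cast
    ring
  have hanti : AntitoneOn z (Icc 0 t) := by
    refine antitoneOn_of_deriv_nonpos (convex_Icc 0 t)
      (fun r _ => (hzd r).continuousAt.continuousWithinAt)
      (fun r _ => (hzd r).differentiableAt.differentiableWithinAt) fun r hr => ?_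
    rw [interior_Icc] at hr
    have hrO : r ∈ regularTimes k ψ ρ₀ u₀ X :=
      starShapedTimes_goodTimes _ t ht (by rw [uIcc_of_le ht0]; exact Ioo_subset_Icc_self hr)
    rw [(hzd r).deriv, flowJacobianRate]
    have h1 := mul_nonneg (hX.influence_mem_Icc hψ hd r (X r a)).1 (pos_of_mem_goodTimes hrO a).le
    linarith
  have := hanti ⟨le_rfl, ht0⟩ ⟨ht0, le_rfl⟩ ht0
  simp only [hz, jacobian_zero, mul_zero, sub_zero, ne_eq, OfNat.ofNat_ne_zero,
    not_false_eq_true, zero_pow] at this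
  linarith

theorem regularTimes_le_of_nonpos (hψ : IsInfluenceFunction ψ ψM) (hd : IsInitialData ρ₀ u₀)
    (hX : IsLagrangianFlow k ψ ρ₀ u₀ X V) {t a : ℝ} (ht0 : 0 ≤ t)
    (h : 1 + (deriv u₀ a + conv ψ ρ₀ a) * t - k * ρ₀ a * t ^ 2 / 2 ≤ 0) :
    ∀ s ∈ regularTimes k ψ ρ₀ u₀ X, s ≤ t := by
  intro s hs
  by_contra hlt
  rw [not_le] at hlt
  have ht : t ∈ regularTimes k ψ ρ₀ u₀ X :=
    starShapedTimes_goodTimes _ s hs (by rw [uIcc_of_le (ht0.trans hlt.le)]; exact ⟨ht0, hlt.le⟩)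
  exact absurd (hX.jacobian_upper_bound hψ hd ht0 ht a)
    (not_le.2 (h.trans_lt (pos_of_mem_goodTimes ht a)))

theorem neg_mul_jacobian_le_slopeSource {M t a d : ℝ} (hψ : IsInfluenceFunction ψ ψM)
    (hd : IsInitialData ρ₀ u₀) (hX : IsLagrangianFlow k ψ ρ₀ u₀ X V)
    (ht : t ∈ regularTimes k ψ ρ₀ u₀ X)
    (hdJ : d * flowJacobian k ψ ρ₀ u₀ X t a = flowJacobianRate k ψ ρ₀ u₀ X t a) (hM : -M ≤ d) :
    -(M * flowJacobian k ψ ρ₀ u₀ X t a) ≤ slopeSource k ψ ρ₀ u₀ t a := by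
  have hJ := (pos_of_mem_goodTimes ht a).le
  have h1 := mul_nonneg (hX.influence_mem_Icc hψ hd t (X t a)).1 hJ
  have h2 := mul_le_mul_of_nonneg_right hM hJ
  rw [flowJacobianRate] at hdJ
  linarith

theorem blowsUp_of_regularTimes_bddAbove (hψ : IsInfluenceFunction ψ ψM) (hd : IsInitialData ρ₀ u₀)
    (hX : IsLagrangianFlow k ψ ρ₀ u₀ X V) (hb : BddAbove (regularTimes k ψ ρ₀ u₀ X)) :
    BlowsUpInFiniteTime k ψ ρ₀ u₀ := by
  set O := regularTimes k ψ ρ₀ u₀ X with hO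
  set J := flowJacobian k ψ ρ₀ u₀ X with hJdef
  have hopen : IsOpen O := hX.isOpen_regularTimes hψ hd
  have h0 : (0 : ℝ) ∈ O := zero_mem_regularTimes
  set T := sSup O with hT
  have hTO : T ∉ O := fun h => by
    obtain ⟨ε, hε, hball⟩ := Metric.isOpen_iff.1 hopen T h
    have := le_csSup hb (hball (show T + ε / 2 ∈ Metric.ball T ε by
      rw [Metric.mem_ball, Real.dist_eq, add_sub_cancel_left, abs_of_pos (by positivity)]
      linarith))
    linarith
  have hT0 : 0 < T := (le_csSup hb h0).lt_of_ne fun h => hTO (by rw [hT, ← h]; exact h0)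
  have hI : Ico 0 T ⊆ O := fun t ht => by
    obtain ⟨s, hs, hts⟩ := exists_lt_of_lt_csSup ⟨0, h0⟩ ht.2
    exact starShapedTimes_goodTimes _ s hs (by
      rw [uIcc_of_le (ht.1.trans hts.le)]; exact ⟨ht.1, hts.le⟩)
  have hJpos : ∀ t ∈ Ico 0 T, ∀ a, 0 < J t a := fun t ht a => pos_of_mem_goodTimes (hI ht) a
  have hlower : ∀ c > 0, ∃ s ∈ Ico 0 T, ∃ a, J s a < c := by
    intro c hc
    by_contra! hcon
    refine hTO ⟨c, hc, fun s hs a => ?_⟩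
    rw [uIcc_of_le hT0.le] at hs
    rcases hs.2.eq_or_lt with h | h
    · rw [h]
      have hcont : Tendsto (fun s => J s a) (𝓝[<] T) (𝓝 (J T a)) :=
        (hX.hasDerivAt_jacobian hψ hd T a).continuousAt.tendsto.mono_left nhdsWithin_le_nhds
      refine ge_of_tendsto hcont ?_
      filter_upwards [Ioo_mem_nhdsLT hT0] with r hr using hcon r ⟨hr.1.le, hr.2⟩ a
    · exact hcon s ⟨hs.1, h⟩ a
  refine ⟨T, hT0, ⟨_, _, hX.isClassicalSolution hψ hd hI fun t ht => ht.1⟩, ?_⟩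
  intro ρ u hs M'
  set M := max M' 0 with hM
  have hM0 : 0 ≤ M := le_max_right _ _
  have hψ0 := hψ.bound_pos
  suffices h : ∃ δ > 0, ∀ t ∈ Ico 0 T, T - t < δ → ∃ x, deriv (u t) x < -M by
    obtain ⟨δ, hδ, h⟩ := h
    filter_upwards [Ioo_mem_nhdsLT (show max 0 (T - δ) < T from max_lt hT0 (by linarith))] with t ht
    obtain ⟨x, hx⟩ := h t ⟨(le_max_left _ _).trans ht.1.le, ht.2⟩
      (by linarith [(le_max_right 0 (T - δ)).trans_lt ht.1])
    exact ⟨x, hx.trans_le (neg_le_neg (le_max_left _ _))⟩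
  have hsource : ∀ t ∈ Ico 0 T, (∀ x, -M ≤ deriv (u t) x) → ∀ a,
      -(M * J t a) ≤ slopeSource k ψ ρ₀ u₀ t a := fun t ht hx a =>
    hX.neg_mul_jacobian_le_slopeSource hψ hd (hI ht)
      (hs.deriv_velocity_mul_jacobian hψ hd hX ht a) (hx _)
  rcases le_total 0 k with hk | hk
  · obtain ⟨C, hC0, hC⟩ := hX.locallyLipschitz_jacobian hψ hd T
    set c := Real.exp (-(ψM * T)) / (1 + M * T) with hc
    have hc0 : 0 < c := by positivity
    refine ⟨c / (2 * (C + 1)), by positivity, fun t ht hδ => ?_⟩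
    by_contra! hx
    have hJt : ∀ a, c ≤ J t a := by
      intro a
      have h1 := hX.jacobian_lower_bound hψ hd ht.1 (mul_nonneg hM0 (hJpos t ht a).le)
        (fun r hr => (hJpos r ⟨hr.1, hr.2.trans_lt ht.2⟩ a).le) (a := a) (fun r hr => by
          have h2 := hsource t ht hx a
          have h3 := mul_nonneg (mul_nonneg hk (sub_nonneg.2 hr.2)) (hd.density_nonneg a)
          rw [slopeSource_eq_add r t]
          linarith)
      rw [jacobian_zero, sub_zero] at h1
      have h4 : Real.exp (ψM * t) ≤ Real.exp (ψM * T) := by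
        have := ht.2.le
        gcongr
      have h5 : 1 ≤ J t a * Real.exp (ψM * t) * (1 + M * t) := by linarith
      have h6 : J t a * Real.exp (ψM * t) * (1 + M * t) ≤
          J t a * Real.exp (ψM * T) * (1 + M * T) := by
        have := (hJpos t ht a).le
        have := ht.2.le
        have := ht.1
        gcongr
      rw [hc, div_le_iff₀ (by positivity), Real.exp_neg, inv_le_iff_one_le_mul₀ (Real.exp_pos _)]
      linarith
    obtain ⟨c₁, hc₁, hct⟩ := hI ht
    obtain ⟨s, hsT, a, hsa⟩ := hlower (min c₁ (c / 2)) (by positivity)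
    rw [lt_min_iff] at hsa
    rcases le_total s t with hst | hst
    · exact absurd (hct s (by rw [uIcc_of_le ht.1]; exact ⟨hsT.1, hst⟩) a) (not_le.2 hsa.1)
    · have h1 := hC s t (by rw [abs_of_nonneg hsT.1]; exact hsT.2.le)
        (by rw [abs_of_nonneg ht.1]; exact ht.2.le) a
      rw [abs_of_nonneg (sub_nonneg.2 hst)] at h1
      have h2 := (abs_le.1 h1).1
      have h3 := hJt a
      have h4 : (T - t) * (2 * (C + 1)) < c := (lt_div_iff₀ (by positivity)).1 hδ
      have h5 := hsT.2
      have h6 : C * (s - t) ≤ C * (T - t) := mul_le_mul_of_nonneg_left (by linarith) hC0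
      nlinarith [hsa.2]
  · refine ⟨min 1 (1 / (2 * (M + 1) * Real.exp ψM)), by positivity, fun t ht hδ => ?_⟩
    rw [lt_min_iff] at hδ
    by_contra! hx
    obtain ⟨c₁, hc₁, hct⟩ := hI ht
    obtain ⟨s, hsT, a, hsa⟩ := hlower (min c₁ (c₁ / 2 * Real.exp (-ψM))) (by positivity)
    rw [lt_min_iff] at hsa
    rcases le_total s t with hst | hst
    · exact absurd (hct s (by rw [uIcc_of_le ht.1]; exact ⟨hsT.1, hst⟩) a) (not_le.2 hsa.1)
    · have h1 := hX.jacobian_lower_bound hψ hd hst (mul_nonneg hM0 (hJpos t ht a).le)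
        (fun r hr => (hJpos r ⟨ht.1.trans hr.1, hr.2.trans_lt hsT.2⟩ a).le) (a := a) (fun r hr => by
          have h2 := hsource t ht hx a
          have h3 := mul_nonneg (mul_nonneg (neg_nonneg.2 hk) (sub_nonneg.2 hr.1)) (hd.density_nonneg a)
          rw [slopeSource_eq_add r t]
          linarith)
      have h4 : s - t ≤ 1 := by linarith [hsT.2, hδ.1]
      have h5 : Real.exp (ψM * (s - t)) ≤ Real.exp ψM :=
        Real.exp_le_exp.2 (mul_le_of_le_one_right hψ0.le h4)
      have hJt : c₁ ≤ J t a := hct t right_mem_uIcc a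
      have h6 : M * Real.exp (ψM * (s - t)) * (s - t) ≤ 1 / 2 := by
        have h7 : (T - t) * (2 * (M + 1) * Real.exp ψM) < 1 := (lt_div_iff₀ (by positivity)).1 hδ.2
        have h8 : M * Real.exp (ψM * (s - t)) * (s - t) ≤ (M + 1) * Real.exp ψM * (T - t) := by
          have := hsT.2.le
          gcongr
          linarith
        linarith
      have h9 : J s a * Real.exp (ψM * (s - t)) ≤ J s a * Real.exp ψM :=
        mul_le_mul_of_nonneg_left h5 (hJpos s hsT a).le
      have h10 : J t a / 2 ≤ J s a * Real.exp ψM := by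
        have : J t a * (M * Real.exp (ψM * (s - t)) * (s - t)) ≤ J t a * (1 / 2) :=
          mul_le_mul_of_nonneg_left h6 (hJpos t ht a).le
        linarith
      have h11 := hsa.2
      rw [Real.exp_neg, ← div_eq_mul_inv, lt_div_iff₀ (Real.exp_pos _)] at h11
      linarith

end IsLagrangianFlow

/-! ### Thresholds -/

theorem strictMonoOn_exp_sub_one_sub : StrictMonoOn (fun z : ℝ => Real.exp z - 1 - z) (Ici 0) := by
  have hd : ∀ z : ℝ, HasDerivAt (fun z : ℝ => Real.exp z - 1 - z) (Real.exp z - 1) z := fun z =>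
    ((Real.hasDerivAt_exp z).sub_const 1).sub (hasDerivAt_id z)
  refine strictMonoOn_of_deriv_pos (convex_Ici 0) (by fun_prop) fun z hz => ?_
  rw [interior_Ici] at hz
  rw [(hd z).deriv, sub_pos]
  exact Real.one_lt_exp_iff.2 hz

theorem exists_pos_exp_sub_one_sub_eq {c : ℝ} (hc : 0 < c) : ∃ z > 0, Real.exp z - 1 - z = c := by
  have hcont : ContinuousOn (fun z : ℝ => Real.exp z - 1 - z) (Icc 0 (c + 2)) := by fun_prop
  have h1 := Real.quadratic_le_exp_of_nonneg (show 0 ≤ c + 2 by linarith)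
  obtain ⟨z, hz, hzc⟩ := intermediate_value_Icc (by linarith : (0 : ℝ) ≤ c + 2) hcont
    (show c ∈ Icc _ _ from ⟨by simp [hc.le], by nlinarith⟩)
  refine ⟨z, hz.1.lt_of_ne fun h => ?_, hzc⟩
  rw [← h] at hzc
  simp at hzc
  linarith

theorem upperThreshold_eq_iff {k ψM r σ : ℝ} (hk : k ≠ 0) (hψ : ψM ≠ 0) (hr : r ≠ 0) :
    1 / r - 1 / ψM ^ 2 * (k + ψM * σ / r - k * Real.exp (ψM * σ / (k * r))) = 0 ↔
      -k * r * (Real.exp (ψM * σ / (k * r)) - 1 - ψM * σ / (k * r)) = ψM ^ 2 := by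
  set e := Real.exp (ψM * σ / (k * r))
  field_simp
  constructor <;> intro h <;> linear_combination -h

theorem existsUnique_isUpperThreshold {k ψM : ℝ} {ρ₀ : ℝ → ℝ} (hk : k < 0) (hψ : 0 < ψM)
    (h0 : ∀ x, 0 ≤ ρ₀ x) : ∃! σ : ℝ → ℝ, IsUpperThreshold k ψM ρ₀ σ := by
  have hex : ∀ x, ∃ s : ℝ, (ρ₀ x = 0 → s = 0) ∧ (0 < ρ₀ x → s < 0 ∧
      1 / ρ₀ x - 1 / ψM ^ 2 * (k + ψM * s / ρ₀ x - k * Real.exp (ψM * s / (k * ρ₀ x))) = 0) := by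
    intro x
    rcases (h0 x).eq_or_lt with h | h
    · exact ⟨0, fun _ => rfl, fun h' => absurd h h'.ne⟩
    · have hkr : 0 < -k * ρ₀ x := mul_pos (neg_pos.2 hk) h
      obtain ⟨z, hz, hzc⟩ := exists_pos_exp_sub_one_sub_eq (div_pos (pow_pos hψ 2) hkr)
      have e : ψM * (k * ρ₀ x * z / ψM) / (k * ρ₀ x) = z := by
        have := hk.ne
        field_simp
      refine ⟨k * ρ₀ x * z / ψM, fun h' => absurd h' h.ne', fun _ => ⟨?_, ?_⟩⟩
      · exact div_neg_of_neg_of_pos (mul_neg_of_neg_of_pos (mul_neg_of_neg_of_pos hk h) hz) hψ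
      · rw [upperThreshold_eq_iff hk.ne hψ.ne' h.ne', e, hzc, mul_div_cancel₀ _ hkr.ne']
  choose σ hσ using hex
  refine ⟨σ, hσ, fun τ hτ => funext fun x => ?_⟩
  rcases (h0 x).eq_or_lt with h | h
  · rw [(hτ x).1 h.symm, (hσ x).1 h.symm]
  · obtain ⟨h1, e1⟩ := (hσ x).2 h
    obtain ⟨h2, e2⟩ := (hτ x).2 h
    rw [upperThreshold_eq_iff hk.ne hψ.ne' h.ne'] at e1 e2
    have hkr : k * ρ₀ x < 0 := mul_neg_of_neg_of_pos hk h
    have p1 : 0 ≤ ψM * σ x / (k * ρ₀ x) :=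
      (div_pos_of_neg_of_neg (mul_neg_of_pos_of_neg hψ h1) hkr).le
    have p2 : 0 ≤ ψM * τ x / (k * ρ₀ x) :=
      (div_pos_of_neg_of_neg (mul_neg_of_pos_of_neg hψ h2) hkr).le
    have hne : -k * ρ₀ x ≠ 0 := (mul_pos (neg_pos.2 hk) h).ne'
    have := strictMonoOn_exp_sub_one_sub.injOn p2 p1 (mul_left_cancel₀ hne (e2.trans e1.symm))
    rw [div_left_inj' hkr.ne] at this
    exact mul_left_cancel₀ hψ.ne' this

theorem IsUpperThreshold.neg_sqrt_le {k ψM : ℝ} {ρ₀ σ : ℝ → ℝ} (hσ : IsUpperThreshold k ψM ρ₀ σ)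
    (hk : k < 0) (hψ : 0 < ψM) (h0 : ∀ x, 0 ≤ ρ₀ x) (x : ℝ) :
    -Real.sqrt (-2 * k * ρ₀ x) ≤ σ x := by
  rcases (h0 x).eq_or_lt with h | h
  · rw [(hσ x).1 h.symm]
    exact neg_nonpos.2 (Real.sqrt_nonneg _)
  · obtain ⟨h1, e1⟩ := (hσ x).2 h
    rw [upperThreshold_eq_iff hk.ne hψ.ne' h.ne'] at e1
    have hkr : k * ρ₀ x < 0 := mul_neg_of_neg_of_pos hk h
    set z := ψM * σ x / (k * ρ₀ x) with hz
    have hz0 : 0 ≤ z := (div_pos_of_neg_of_neg (mul_neg_of_pos_of_neg hψ h1) hkr).le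
    have hσz : ψM * σ x = k * ρ₀ x * z := by rw [hz, mul_div_cancel₀ _ hkr.ne]
    have h2 := Real.quadratic_le_exp_of_nonneg hz0
    have h3 : -k * ρ₀ x * (z ^ 2 / 2) ≤ ψM ^ 2 := by
      rw [← e1]
      exact mul_le_mul_of_nonneg_left (by linarith) (by linarith)
    have h4 : ψM ^ 2 * σ x ^ 2 ≤ ψM ^ 2 * (-2 * k * ρ₀ x) := by
      have : ψM ^ 2 * σ x ^ 2 = (k * ρ₀ x * z) ^ 2 := by rw [← hσz]; ring
      rw [this]
      nlinarith
    have h5 : σ x ^ 2 ≤ -2 * k * ρ₀ x := le_of_mul_le_mul_left h4 (pow_pos hψ 2)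
    have h6 := Real.abs_le_sqrt h5
    exact (abs_le.1 h6).1

namespace IsLagrangianFlow
variable {k ψM : ℝ} {ψ ρ₀ u₀ : ℝ → ℝ} {X V : ℝ → ℝ → ℝ}

theorem bddAbove_regularTimes_of_pos (hψ : IsInfluenceFunction ψ ψM) (hd : IsInitialData ρ₀ u₀)
    (hX : IsLagrangianFlow k ψ ρ₀ u₀ X V) (hk : 0 < k) : BddAbove (regularTimes k ψ ρ₀ u₀ X) := by
  obtain ⟨a, ha⟩ : ∃ a, 0 < ρ₀ a := by
    by_contra! h
    have h1 : ρ₀ = 0 := funext fun x => le_antisymm (h x) (hd.density_nonneg x)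
    have h2 := hd.density_mass
    rw [h1] at h2
    simp at h2
  set G := deriv u₀ a + conv ψ ρ₀ a with hG
  set c := k * ρ₀ a / 2 with hc
  have hc0 : 0 < c := by positivity
  refine ⟨(|G| + 1) / c + 1, hX.regularTimes_le_of_nonpos hψ hd (a := a) (by positivity) ?_⟩
  set t := (|G| + 1) / c + 1 with ht
  have h1 : 1 ≤ t := by rw [ht]; exact le_add_of_nonneg_left (by positivity)
  have h2 : |G| + 1 ≤ c * t := by
    rw [ht, mul_add, mul_div_cancel₀ _ hc0.ne']
    linarith
  have h3 : G * t ≤ |G| * t := mul_le_mul_of_nonneg_right (le_abs_self G) (by linarith)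
  have h4 := mul_le_mul_of_nonneg_right h2 (by linarith : (0 : ℝ) ≤ t)
  have h5 : k * ρ₀ a * t ^ 2 / 2 = c * t * t := by rw [hc]; ring
  rw [h5]
  linarith

theorem bddAbove_regularTimes_of_supercritical (hψ : IsInfluenceFunction ψ ψM)
    (hd : IsInitialData ρ₀ u₀) (hX : IsLagrangianFlow k ψ ρ₀ u₀ X V) (hk : k < 0) {a : ℝ}
    (ha : deriv u₀ a < -conv ψ ρ₀ a + lowerThreshold k ρ₀ a) :
    BddAbove (regularTimes k ψ ρ₀ u₀ X) := by
  set G := deriv u₀ a + conv ψ ρ₀ a with hG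
  have h1 : G < -Real.sqrt (-2 * k * ρ₀ a) := by
    rw [lowerThreshold] at ha
    linarith
  have h0 := Real.sqrt_nonneg (-2 * k * ρ₀ a)
  have hG0 : G < 0 := by linarith
  rcases (hd.density_nonneg a).eq_or_lt with hρ | hρ
  · refine ⟨-1 / G, hX.regularTimes_le_of_nonpos hψ hd (a := a) (div_nonneg_of_nonpos (by norm_num) hG0.le) ?_⟩
    rw [← hρ, ← hG, mul_div_cancel₀ _ hG0.ne]
    norm_num
  · have hkr : 0 < -k * ρ₀ a := mul_pos (neg_pos.2 hk) hρ
    refine ⟨-G / (-k * ρ₀ a), hX.regularTimes_le_of_nonpos hψ hd (a := a) (div_nonneg (by linarith) hkr.le) ?_⟩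
    rw [← hG]
    have h2 : -2 * k * ρ₀ a < G ^ 2 := by
      have := Real.lt_sq_of_sqrt_lt (show Real.sqrt (-2 * k * ρ₀ a) < -G by linarith)
      rwa [neg_sq] at this
    have h3 : 1 + G * (-G / (-k * ρ₀ a)) - k * ρ₀ a * (-G / (-k * ρ₀ a)) ^ 2 / 2 =
        1 - G ^ 2 / (2 * (-k * ρ₀ a)) := by
      have := hk.ne
      field_simp
      ring
    rw [h3, sub_nonpos, one_le_div (by positivity)]
    linarith

theorem subcritical_source_bound {E : ℝ → ℝ} {G κ z s : ℝ} (hψM : 0 < ψM) (hκ : 0 < κ) (hG : G < 0)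
    (hz : z = ψM * (-G / κ)) (hE : Continuous E)
    (hE1 : ∀ r, 0 ≤ r → 0 ≤ E r ∧ E r ≤ Real.exp (ψM * r)) (hs : 0 ≤ s) :
    -(κ / ψM ^ 2 * (Real.exp z - 1 - z)) ≤ ∫ r in (0 : ℝ)..s, (G + κ * r) * E r := by
  set r₀ := -G / κ with hr₀
  have hr₀0 : 0 ≤ r₀ := div_nonneg (by linarith) hκ.le
  have hκr : κ * r₀ = -G := mul_div_cancel₀ _ hκ.ne'
  set N : ℝ → ℝ := fun s => ∫ r in (0 : ℝ)..s, (G + κ * r) * E r with hN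
  have hNd : ∀ r, HasDerivAt N ((G + κ * r) * E r) r :=
    hasDerivAt_primitive (by fun_prop)
  have h1 : N r₀ ≤ N s := by
    rcases le_total s r₀ with h | h
    · have : AntitoneOn N (Icc 0 r₀) := by
        refine antitoneOn_of_deriv_nonpos (convex_Icc 0 r₀)
          (fun r _ => (hNd r).continuousAt.continuousWithinAt)
          (fun r _ => (hNd r).differentiableAt.differentiableWithinAt) fun r hr => ?_
        rw [interior_Icc] at hr
        rw [(hNd r).deriv]
        exact mul_nonpos_of_nonpos_of_nonneg (by nlinarith [hr.2]) (hE1 r hr.1.le).1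
      exact this ⟨hs, h⟩ ⟨hr₀0, le_rfl⟩ h
    · have : MonotoneOn N (Ici r₀) := by
        refine monotoneOn_of_deriv_nonneg (convex_Ici r₀)
          (fun r _ => (hNd r).continuousAt.continuousWithinAt)
          (fun r _ => (hNd r).differentiableAt.differentiableWithinAt) fun r hr => ?_
        rw [interior_Ici] at hr
        rw [(hNd r).deriv]
        have hr' : r₀ < r := hr
        exact mul_nonneg (by nlinarith) (hE1 r (hr₀0.trans hr'.le)).1
      exact this self_mem_Ici h h
  set H : ℝ → ℝ := fun r => (G + κ * r) * Real.exp (ψM * r) / ψM -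
    κ / ψM ^ 2 * Real.exp (ψM * r) with hH
  have hHd : ∀ r, HasDerivAt H ((G + κ * r) * Real.exp (ψM * r)) r := fun r => by
    have e1 : HasDerivAt (fun r => G + κ * r) κ r := by
      simpa using ((hasDerivAt_id r).const_mul κ).const_add G
    have e2 : HasDerivAt (fun r => Real.exp (ψM * r)) (Real.exp (ψM * r) * ψM) r := by
      simpa using ((hasDerivAt_id r).const_mul ψM).exp
    refine (((e1.mul e2).div_const ψM).sub (e2.const_mul (κ / ψM ^ 2))).congr_deriv ?_
    field_simp
    ring
  have h2 : H r₀ - H 0 ≤ N r₀ - N 0 := by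
    have hmono : MonotoneOn (fun r => N r - H r) (Icc 0 r₀) := by
      have hd := fun r => (hNd r).sub (hHd r)
      refine monotoneOn_of_deriv_nonneg (convex_Icc 0 r₀)
        (fun r _ => (hd r).continuousAt.continuousWithinAt)
        (fun r _ => (hd r).differentiableAt.differentiableWithinAt) fun r hr => ?_
      rw [interior_Icc] at hr
      have e := (hd r).deriv
      rw [show deriv (fun r => N r - H r) r = _ from e, ← mul_sub]
      exact mul_nonneg_of_nonpos_of_nonpos (by nlinarith [hr.2])
        (by linarith [(hE1 r hr.1.le).2])
    have := hmono ⟨le_rfl, hr₀0⟩ ⟨hr₀0, le_rfl⟩ hr₀0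
    simp only at this
    linarith
  have h3 : H r₀ - H 0 = -(κ / ψM ^ 2 * (Real.exp z - 1 - z)) := by
    simp only [hH, hκr, mul_zero, Real.exp_zero, ← hz]
    have : G = -κ * z / ψM := by
      rw [hz]
      field_simp
      linarith
    rw [this]
    field_simp
    ring
  have h4 : N 0 = 0 := intervalIntegral.integral_same
  rw [← h3]
  linarith

theorem jacobian_representation (hψ : IsInfluenceFunction ψ ψM) (hd : IsInitialData ρ₀ u₀)
    (hX : IsLagrangianFlow k ψ ρ₀ u₀ X V) (a : ℝ) :
    ∃ E : ℝ → ℝ, Continuous E ∧ (∀ r, 0 ≤ r → 1 ≤ E r ∧ E r ≤ Real.exp (ψM * r)) ∧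
      ∀ s, flowJacobian k ψ ρ₀ u₀ X s a =
        (E s)⁻¹ * (1 + ∫ r in (0 : ℝ)..s, slopeSource k ψ ρ₀ u₀ r a * E r) := by
  have hΦ : Continuous fun s => influence ψ ρ₀ X s (X s a) :=
    (hX.continuous_influence_along hψ hd).comp (by fun_prop : Continuous fun s : ℝ => (s, a))
  refine ⟨fun r => Real.exp (-∫ s in (0 : ℝ)..r, -influence ψ ρ₀ X s (X s a)),
    (continuous_primitive' hΦ.neg).neg.rexp, fun r hr => ?_, fun s => ?_⟩
  · beta_reduce
    rw [intervalIntegral.integral_neg, neg_neg]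
    have h1 : 0 ≤ ∫ s in (0 : ℝ)..r, influence ψ ρ₀ X s (X s a) :=
      intervalIntegral.integral_nonneg hr fun s _ => (hX.influence_mem_Icc hψ hd s _).1
    have h2 : ∫ s in (0 : ℝ)..r, influence ψ ρ₀ X s (X s a) ≤ ∫ _ in (0 : ℝ)..r, ψM :=
      intervalIntegral.integral_mono_on hr (hΦ.intervalIntegrable _ _)
        intervalIntegrable_const fun s _ => (hX.influence_mem_Icc hψ hd s _).2
    rw [intervalIntegral.integral_const, sub_zero, smul_eq_mul, mul_comm] at h2
    exact ⟨Real.one_le_exp h1, Real.exp_le_exp.2 h2⟩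
  · rw [flowJacobian, linearSolution, ← Real.exp_neg, neg_neg]

theorem mem_regularTimes_of_subcritical (hψ : IsInfluenceFunction ψ ψM) (hd : IsInitialData ρ₀ u₀)
    (hX : IsLagrangianFlow k ψ ρ₀ u₀ X V) (hk : k < 0) {σ : ℝ → ℝ}
    (hσ : IsUpperThreshold k ψM ρ₀ σ) (hsub : ∀ x, deriv u₀ x > -conv ψ ρ₀ x + σ x) {t : ℝ}
    (ht : 0 ≤ t) : t ∈ regularTimes k ψ ρ₀ u₀ X := by
  have hψ0 := hψ.bound_pos
  have hg : ∀ r a, slopeSource k ψ ρ₀ u₀ r a =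
      (deriv u₀ a + conv ψ ρ₀ a) + (-k * ρ₀ a) * r := fun r a => by
    unfold slopeSource; ring
  have hκ : ∀ a, 0 ≤ -k * ρ₀ a := fun a => mul_nonneg (neg_nonneg.2 hk.le) (hd.density_nonneg a)
  have hpos : ∀ s, 0 ≤ s → ∀ a, 0 < flowJacobian k ψ ρ₀ u₀ X s a := by
    intro s hs a
    obtain ⟨E, hEc, hE, hrep⟩ := hX.jacobian_representation hψ hd a
    rw [hrep]
    refine mul_pos (inv_pos.2 (one_pos.trans_le (hE s hs).1)) ?_
    simp only [hg]
    set G := deriv u₀ a + conv ψ ρ₀ a with hG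
    have hGσ : σ a < G := by have := hsub a; linarith
    rcases le_or_gt 0 G with hG0 | hG0
    · have : 0 ≤ ∫ r in (0 : ℝ)..s, (G + -k * ρ₀ a * r) * E r :=
        intervalIntegral.integral_nonneg hs fun r hr => mul_nonneg
          (add_nonneg hG0 (mul_nonneg (hκ a) hr.1)) (zero_le_one.trans (hE r hr.1).1)
      linarith
    · have hρ : 0 < ρ₀ a := (hd.density_nonneg a).lt_of_ne fun h => by
        have := (hσ a).1 h.symm
        linarith
      have hκ0 : 0 < -k * ρ₀ a := mul_pos (neg_pos.2 hk) hρ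
      obtain ⟨hσ0, hσe⟩ := (hσ a).2 hρ
      rw [upperThreshold_eq_iff hk.ne hψ0.ne' hρ.ne'] at hσe
      have h1 := subcritical_source_bound hψ0 hκ0 hG0 rfl hEc
        (fun r hr => ⟨zero_le_one.trans (hE r hr).1, (hE r hr).2⟩) hs
      set z := ψM * (-G / (-k * ρ₀ a)) with hz
      have hz0 : 0 ≤ z := mul_nonneg hψ0.le (div_nonneg (by linarith) hκ0.le)
      have hzσ : z < ψM * σ a / (k * ρ₀ a) := by
        have e : ψM * σ a / (k * ρ₀ a) = ψM * (-σ a / (-k * ρ₀ a)) := by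
          rw [neg_mul, neg_div_neg_eq, mul_div_assoc]
        rw [e, hz]
        gcongr
      have h2 := strictMonoOn_exp_sub_one_sub hz0 (hz0.trans hzσ.le) hzσ
      simp only at h2
      have h3 : -k * ρ₀ a / ψM ^ 2 * (Real.exp z - 1 - z) < 1 := by
        rw [div_mul_eq_mul_div, div_lt_one (by positivity), ← hσe]
        exact mul_lt_mul_of_pos_left h2 hκ0
      linarith
  set L := t * Real.exp (ψM * t) with hL
  have hL0 : 0 ≤ L := by positivity
  have hsmall : ∀ᶠ a in cocompact ℝ, L * Real.sqrt (-2 * k * ρ₀ a) < 1 / 2 := by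
    have h1 : Tendsto (fun a => L * Real.sqrt (-2 * k * ρ₀ a)) (cocompact ℝ) (𝓝 0) := by
      have := ((hd.density_vanishes.const_mul (-2 * k)).sqrt).const_mul L
      simpa using this
    exact h1.eventually_lt_const (by norm_num)
  obtain ⟨S, hS, hSc⟩ := mem_cocompact.1 hsmall
  have hfar : ∀ s ∈ Icc 0 t, ∀ a, L * Real.sqrt (-2 * k * ρ₀ a) < 1 / 2 →
      Real.exp (-(ψM * t)) / 2 ≤ flowJacobian k ψ ρ₀ u₀ X s a := by
    intro s hs a ha
    obtain ⟨E, hEc, hE, hrep⟩ := hX.jacobian_representation hψ hd a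
    have hGσ : -Real.sqrt (-2 * k * ρ₀ a) ≤ deriv u₀ a + conv ψ ρ₀ a := by
      have h1 := hsub a
      have h2 := hσ.neg_sqrt_le hk hψ0 hd.density_nonneg a
      linarith
    have hint : -(1 / 2) ≤ ∫ r in (0 : ℝ)..s, slopeSource k ψ ρ₀ u₀ r a * E r := by
      have h1 : ∫ _ in (0 : ℝ)..s, -(Real.sqrt (-2 * k * ρ₀ a) * Real.exp (ψM * t)) ≤
          ∫ r in (0 : ℝ)..s, slopeSource k ψ ρ₀ u₀ r a * E r := by
        refine intervalIntegral.integral_mono_on hs.1 intervalIntegrable_const ?_ fun r hr => ?_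
        · have : Continuous fun r => slopeSource k ψ ρ₀ u₀ r a :=
            (continuous_slopeSource hψ hd).comp (by fun_prop : Continuous fun r : ℝ => (r, a))
          exact (this.mul hEc).intervalIntegrable _ _
        · have h2 := hE r hr.1
          have h3 : E r ≤ Real.exp (ψM * t) := h2.2.trans (Real.exp_le_exp.2
            (mul_le_mul_of_nonneg_left (hr.2.trans hs.2) hψ0.le))
          have h4 : -Real.sqrt (-2 * k * ρ₀ a) ≤ slopeSource k ψ ρ₀ u₀ r a := by
            rw [hg]
            linarith [mul_nonneg (hκ a) hr.1]
          have h5 := mul_le_mul_of_nonneg_left h3 (Real.sqrt_nonneg (-2 * k * ρ₀ a))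
          have h6 := mul_le_mul_of_nonneg_right h4 (zero_le_one.trans h2.1)
          linarith
      refine le_trans ?_ h1
      rw [intervalIntegral.integral_const, sub_zero, smul_eq_mul]
      have h7 : s * (Real.sqrt (-2 * k * ρ₀ a) * Real.exp (ψM * t)) ≤
          t * (Real.sqrt (-2 * k * ρ₀ a) * Real.exp (ψM * t)) :=
        mul_le_mul_of_nonneg_right hs.2 (by positivity)
      rw [hL] at ha
      linarith
    rw [hrep]
    have h8 : Real.exp (-(ψM * t)) ≤ (E s)⁻¹ := by
      rw [Real.exp_neg]
      refine inv_anti₀ (one_pos.trans_le (hE s hs.1).1) ((hE s hs.1).2.trans ?_)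
      exact Real.exp_le_exp.2 (mul_le_mul_of_nonneg_left hs.2 hψ0.le)
    have h9 : (1 : ℝ) / 2 ≤ 1 + ∫ r in (0 : ℝ)..s, slopeSource k ψ ρ₀ u₀ r a * E r := by linarith
    calc Real.exp (-(ψM * t)) / 2 = Real.exp (-(ψM * t)) * (1 / 2) := by ring
      _ ≤ _ := mul_le_mul h8 h9 (by norm_num) ((Real.exp_pos _).le.trans h8)
  obtain ⟨c, hc, hcJ⟩ : ∃ c > 0, ∀ s ∈ Icc 0 t, ∀ a ∈ S, c ≤ flowJacobian k ψ ρ₀ u₀ X s a := by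
    rcases S.eq_empty_or_nonempty with rfl | hne
    · exact ⟨1, one_pos, fun s _ a ha => absurd ha (notMem_empty a)⟩
    · obtain ⟨p, hp, hmin⟩ := (isCompact_Icc.prod hS).exists_isMinOn
        ((nonempty_Icc.2 ht).prod hne) (hX.continuous_jacobian hψ hd).continuousOn
      exact ⟨_, hpos p.1 hp.1.1 p.2, fun s hs a ha => hmin (show (s, a) ∈ _ from ⟨hs, ha⟩)⟩
  refine ⟨min c (Real.exp (-(ψM * t)) / 2), by positivity, fun s hs a => ?_⟩
  rw [uIcc_of_le ht] at hs
  by_cases ha : a ∈ S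
  · exact (min_le_left _ _).trans (hcJ s hs a ha)
  · exact (min_le_right _ _).trans (hfar s hs a (hSc ha))

end IsLagrangianFlow

end

theorem theorem1p2 (k ψM : ℝ) (ψ ρ₀ u₀ : ℝ → ℝ)
    (hψ : IsInfluenceFunction ψ ψM) (hdata : IsInitialData ρ₀ u₀) :
    (0 < k → BlowsUpInFiniteTime k ψ ρ₀ u₀) ∧
    (k < 0 →
      (∃! σ : ℝ → ℝ, IsUpperThreshold k ψM ρ₀ σ) ∧
      (∀ σ : ℝ → ℝ, IsUpperThreshold k ψM ρ₀ σ →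
        (∀ x, deriv u₀ x > -conv ψ ρ₀ x + σ x) → HasGlobalClassicalSolution k ψ ρ₀ u₀) ∧
      ((∃ x, deriv u₀ x < -conv ψ ρ₀ x + lowerThreshold k ρ₀ x) →
        BlowsUpInFiniteTime k ψ ρ₀ u₀)) := by
  obtain ⟨X, V, hX⟩ := exists_isLagrangianFlow (k := k) hψ hdata
  refine ⟨fun hk => ?_, fun hk => ⟨?_, fun σ hσ hsub => ?_, fun ⟨x, hx⟩ => ?_⟩⟩
  · exact hX.blowsUp_of_regularTimes_bddAbove hψ hdata
      (hX.bddAbove_regularTimes_of_pos hψ hdata hk)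
  · exact existsUnique_isUpperThreshold hk hψ.bound_pos hdata.density_nonneg
  · exact ⟨_, _, hX.isClassicalSolution hψ hdata
      (fun t ht => hX.mem_regularTimes_of_subcritical hψ hdata hk hσ hsub ht) Subset.rfl⟩
  · exact hX.blowsUp_of_regularTimes_bddAbove hψ hdata
      (hX.bddAbove_regularTimes_of_supercritical hψ hdata hk hx)
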